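/- **Setting.** All manifolds are smooth, real and finite-dimensional. Let $G$ and $T$ be Lie groups with Lie algebras $\mathfrak g$, $\mathfrak t$, with $T$ abelian; $\theta^L,\theta^R$ are the left- and right-invariant Maurer–Cartan forms of $G$ and $\theta^T$ that of $T$. *Gerbes.* A $T$-gerbe over a manifold $X$ is given by a smooth Čech 2-cocycle $\lambda_{ijk}\colon U_{ijk}\to T$ on an open cover. A connective structure on it consists of 1-forms $A_{ij}\in\Omega^1(U_{ij},\mathfrak t)$ with $A_{ij}-A_{ik}+A_{jk}=\lambda_{ijk}^*\theta^T$, and a curving consists of $B_i\in\Omega^2(U_i,\mathfrak t)$ with $B_i-B_j=dA_{ij}$; its curvature is the global 3-form $dB_i$. An isomorphism of gerbes $\lambda\to\lambda'$ is given, on a common refinement $\{V_a\}$, by $s_{ab}\colon V_{ab}\to T$ with $s_{ac}\lambda_{abc}=\lambda'_{abc}s_{bc}s_{ab}$; a connection on it consists of 1-forms $\eta_a$ with $\eta_a-\eta_b=A_{ab}-A'_{ab}-s_{ab}^*\theta^T$, and its curvature with respect to curvings $B,B'$ is the 2-form $d\eta_a-B_a+B'_a$. A 2-isomorphism $s\Rightarrow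 s'$ is given by functions $\alpha_a$ with $\alpha_a s_{ab}=s'_{ab}\alpha_b$; it is flat if $\eta'_a-\eta_a+\alpha_a^*\theta^T=0$. *Multiplicative gerbes.* A multiplicative $T$-gerbe $\mathcal G$ over $G$ is a $T$-gerbe on $G$ with an isomorphism $m\colon g_1^*\mathcal G\otimes g_2^*\mathcal G\to(g_1g_2)^*\mathcal G$ over $G\times G$ and an associator 2-isomorphism $\alpha$ over $G^3$ that satisfies the pentagon identity over $G^4$. A connective structure $(\nabla,\nabla_m)$ on $\mathcal G$ is a connective structure on the gerbe and a connection on $m$ for which $\alpha$ is flat. If $M$ is a local 1-form of $\nabla_m$ near $(1,1)$, the associated symmetric pairing $\langle\cdot,\cdot\rangle\colon\mathfrak g\otimes\mathfrak g\to\mathfrak t$ is $$\langle u,v\rangle=\tfrac12\,dM_{(1,1)}\big((0,u),(v,0)\big)+\tfrac12\,dM_{(1,1)}\big((0,v),(u,0)\big).$$ The Maurer–Cartan curving $\Theta^L$ is the curving of $(\mathcal G,\nabla)$ such that $\nabla_m$ has curvature $-\langle g_1^*\theta^L\wedge g_2^*\theta^R\rangle$ with respect to $g_1^*\Theta^L\otimes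 g_2^*\Theta^L$ and $(g_1g_2)^*\Theta^L$. Fix $\mathcal G$ with a connective structure and its Maurer–Cartan curving. *Bundles and connections.* A principal $\mathcal G$-bundle over a manifold $M$ is a principal $G$-bundle $\pi\colon P\to M$, a $T$-gerbe $\mathcal P$ over $P$, an isomorphism $\rho\colon p^*\mathcal P\otimes g^*\mathcal G\to(pg)^*\mathcal P$ over $P\times G$, and a 2-isomorphism $\alpha^\rho$ over $P\times G^2$ from $(pg_1,g_2)^*\rho\circ((p,g_1)^*\rho\otimes\mathrm{id})$ to $(p,g_1g_2)^*\rho\circ(\mathrm{id}\otimes(g_1,g_2)^*m)$ that is coherent with $\alpha$ over $P\times G^3$. A connection on it consists of 1. a connective structure $\nabla$ on $\mathcal P$ and a connection $\nabla_\rho$ on $\rho$ for which $\alpha^\rho$ is flat; 2. a $G$-connection $A\in\Omega^1(P,\mathfrak g)$ on $P$; 3. a curving $B$ on $\mathcal P$ such that $\nabla_\rho$ has curvature $-\langle p^*A\wedge g^*\theta^R\rangle$ with respect to $p^*B\otimes g^*\Theta^L$ and $(pg)^*B$. *Curvature.* Put $F_A=dA+\tfrac12[A\wedge A]$ and $CS(A)=\langle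 dA\wedge A\rangle+\tfrac13\langle A\wedge[A\wedge A]\rangle$, and let $\hat H\in\Omega^3(P,\mathfrak t)$ be the curvature of $B$. The curvature of the connection is the pair $(F_A,H)$, where $H\in\Omega^3(M,\mathfrak t)$ is the form with $\pi^*H=\hat H+CS(A)$. **Proposition (Bianchi identity).** Let $(\nabla,\nabla_\rho,A,B)$ be a connection on a principal $\mathcal G$-bundle as above. Then $F_A$ is (the form on $P$ corresponding to) an element of $\Omega^2(M,\mathrm{ad}\,P)$, there is exactly one form $H\in\Omega^3(M,\mathfrak t)$ as above, and the curvature $(F_A,H)$ satisfies $$d_AF_A=0,\qquad dH-\langle F_A\wedge F_A\rangle=0 .$$ -/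

import Mathlib

open scoped Manifold ContDiff

noncomputable section

namespace TwoBundle

universe w

/-! ## Vector-valued differential forms on manifolds

All manifolds are smooth, real, finite-dimensional and without boundary. In Mathlib the tangent
space of `X` at any point is the model vector space `E` (the identification being the derivative of
the preferred chart at that point), so a `V`-valued `k`-form on `X` is a map
`X → E [⋀^Fin k]→L[ℝ] V`. Local forms (on an open subset) are represented by globally defined maps
whose values outside that subset are irrelevant. -/

section Forms

theorem update_castAdd {Z : Type*} {k l : ℕ} (v : Fin (k + l) → Z) (i : Fin k) (z : Z) :
    (fun i' => Function.update v (Fin.castAdd l i) z (Fin.castAdd l i')) =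
      Function.update (fun i' => v (Fin.castAdd l i')) i z :=
  Function.update_comp_eq_of_injective v (Fin.castAdd_injective k l) i z

theorem update_natAdd {Z : Type*} {k l : ℕ} (v : Fin (k + l) → Z) (j : Fin l) (z : Z) :
    (fun j' => Function.update v (Fin.natAdd k j) z (Fin.natAdd k j')) =
      Function.update (fun j' => v (Fin.natAdd k j')) j z :=
  Function.update_comp_eq_of_injective v (Fin.natAdd_injective l k) j z

theorem update_castAdd_natAdd {Z : Type*} {k l : ℕ} (v : Fin (k + l) → Z) (i : Fin k) (z : Z) :
    (fun j => Function.update v (Fin.castAdd l i) z (Fin.natAdd k j)) =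
      fun j => v (Fin.natAdd k j) := by
  ext j
  rw [Function.update_of_ne]
  intro h; have := congrArg Fin.val h; simp at this; omega

theorem update_natAdd_castAdd {Z : Type*} {k l : ℕ} (v : Fin (k + l) → Z) (j : Fin l) (z : Z) :
    (fun i => Function.update v (Fin.natAdd k j) z (Fin.castAdd l i)) =
      fun i => v (Fin.castAdd l i) := by
  ext i
  rw [Function.update_of_ne]
  intro h; have := congrArg Fin.val h; simp at this; omega

variable {E H E' H' V V₁ V₂ V₃ : Type*}
  [NormedAddCommGroup E] [NormedSpace ℝ E] [TopologicalSpace H]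
  [NormedAddCommGroup E'] [NormedSpace ℝ E'] [TopologicalSpace H']
  [NormedAddCommGroup V] [NormedSpace ℝ V]
  [NormedAddCommGroup V₁] [NormedSpace ℝ V₁]
  [NormedAddCommGroup V₂] [NormedSpace ℝ V₂]
  [NormedAddCommGroup V₃] [NormedSpace ℝ V₃]
  {X X' : Type*} [TopologicalSpace X] [ChartedSpace H X] [TopologicalSpace X'] [ChartedSpace H' X']

/-- `V`-valued `k`-forms (not necessarily smooth) on a manifold `X` modelled on `E`. -/
abbrev DForm (E X : Type*) [NormedAddCommGroup E] [NormedSpace ℝ E] (k : ℕ) (V : Type*)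
    [NormedAddCommGroup V] [NormedSpace ℝ V] : Type _ :=
  X → E [⋀^Fin k]→L[ℝ] V

/-- The derivative of `f : X → X'` at `x`, as a map between the model vector spaces. -/
def tderiv (I : ModelWithCorners ℝ E H) (I' : ModelWithCorners ℝ E' H') (f : X → X') (x : X) :
    E →L[ℝ] E' :=
  mfderiv I I' f x

/-- The pull-back `f^* φ`. -/
def pull (I : ModelWithCorners ℝ E H) (I' : ModelWithCorners ℝ E' H') (f : X → X') {k : ℕ}
    (φ : DForm E' X' k V) : DForm E X k V :=
  fun x => (φ (f x)).compContinuousLinearMap (tderiv I I' f x)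

/-- The expression of `φ` in the preferred chart at `x₀`: the pull-back of `φ` along the inverse of
that chart, a form on (an open subset of) the vector space `E`. -/
def inChart (I : ModelWithCorners ℝ E H) (x₀ : X) {k : ℕ} (φ : DForm E X k V) : DForm E E k V :=
  pull 𝓘(ℝ, E) I (extChartAt I x₀).symm φ

/-- `φ` is smooth on (a neighbourhood of each point of) the open set `s`. -/
def SmoothForm (I : ModelWithCorners ℝ E H) {k : ℕ} (φ : DForm E X k V) (s : Set X) : Prop :=
  ∀ x ∈ s, ContDiffAt ℝ ∞ (inChart I x φ) (extChartAt I x x)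

/-- The exterior derivative, computed at `x` in the preferred chart at `x`. -/
def extD (I : ModelWithCorners ℝ E H) {k : ℕ} (φ : DForm E X k V) : DForm E X (k + 1) V :=
  fun x => (extDeriv (inChart I x φ) (extChartAt I x x)).compContinuousLinearMap
    (tderiv I 𝓘(ℝ, E) (extChartAt I x) x)

/-- The multilinear map `(v₁, …, v_{k+l}) ↦ B (a (v₁, …, v_k), b (v_{k+1}, …, v_{k+l}))`. -/
def mulForm (B : V₁ →L[ℝ] V₂ →L[ℝ] V₃) {k l : ℕ} (a : E [⋀^Fin k]→L[ℝ] V₁)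
    (b : E [⋀^Fin l]→L[ℝ] V₂) : ContinuousMultilinearMap ℝ (fun _ : Fin (k + l) => E) V₃ where
  toFun v := B (a fun i => v (Fin.castAdd l i)) (b fun j => v (Fin.natAdd k j))
  map_update_add' := by
    intro inst v i x y
    obtain rfl : inst = instDecidableEqFin (k + l) := Subsingleton.elim _ _
    induction i using Fin.addCases with
    | left i =>
      simp only [update_castAdd, update_castAdd_natAdd, a.map_update_add, map_add,
        add_apply]
    | right j => simp only [update_natAdd, update_natAdd_castAdd, b.map_update_add, map_add]
  map_update_smul' := by
    intro inst v i c x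
    obtain rfl : inst = instDecidableEqFin (k + l) := Subsingleton.elim _ _
    induction i using Fin.addCases with
    | left i =>
      simp only [update_castAdd, update_castAdd_natAdd, a.map_update_smul, map_smul,
        smul_apply]
    | right j => simp only [update_natAdd, update_natAdd_castAdd, b.map_update_smul, map_smul]
  cont := by fun_prop

/-- The wedge product `B(a ∧ b)` of alternating maps along a bilinear map `B`, normalized so that
`B(a ∧ b)(u, v) = B(a u, b v) - B(a v, b u)` in degrees `1, 1` (a sum over shuffles in general). -/
def wedgeAlt (B : V₁ →L[ℝ] V₂ →L[ℝ] V₃) {k l : ℕ} (a : E [⋀^Fin k]→L[ℝ] V₁)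
    (b : E [⋀^Fin l]→L[ℝ] V₂) : E [⋀^Fin (k + l)]→L[ℝ] V₃ :=
  ((k.factorial * l.factorial : ℕ) : ℝ)⁻¹ • ContinuousMultilinearMap.alternatization (mulForm B a b)

/-- The wedge product `B(α ∧ β)` of differential forms along a bilinear map `B`. -/
def wedge (B : V₁ →L[ℝ] V₂ →L[ℝ] V₃) {k l : ℕ} (α : DForm E X k V₁) (β : DForm E X l V₂) :
    DForm E X (k + l) V₃ :=
  fun x => wedgeAlt B (α x) (β x)

end Forms

/-! ## Lie groups -/

section LieGroups

variable {E : Type*} [NormedAddCommGroup E] [NormedSpace ℝ E]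
  {G : Type*} [TopologicalSpace G] [ChartedSpace E G] [Group G]

/-- The left-invariant Maurer-Cartan form `θ^L`, with values in the Lie algebra `T_1 G = E`. -/
def thetaL (E G : Type*) [NormedAddCommGroup E] [NormedSpace ℝ E] [TopologicalSpace G]
    [ChartedSpace E G] [Group G] : DForm E G 1 E :=
  fun g => ContinuousAlternatingMap.ofSubsingleton ℝ E E 0
    (tderiv 𝓘(ℝ, E) 𝓘(ℝ, E) (fun h : G => g⁻¹ * h) g)

/-- The right-invariant Maurer-Cartan form `θ^R`. -/
def thetaR (E G : Type*) [NormedAddCommGroup E] [NormedSpace ℝ E] [TopologicalSpace G]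
    [ChartedSpace E G] [Group G] : DForm E G 1 E :=
  fun g => ContinuousAlternatingMap.ofSubsingleton ℝ E E 0
    (tderiv 𝓘(ℝ, E) 𝓘(ℝ, E) (fun h : G => h * g⁻¹) g)

/-- The adjoint action of `G` on its Lie algebra. -/
def Ad (g : G) : E →L[ℝ] E :=
  tderiv 𝓘(ℝ, E) 𝓘(ℝ, E) (fun h : G => g * h * g⁻¹) 1

/-- The Lie bracket of the Lie algebra of `G`, as a continuous bilinear map. -/
def bracket (E G : Type*) [NormedAddCommGroup E] [NormedSpace ℝ E] [FiniteDimensional ℝ E]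
    [TopologicalSpace G] [ChartedSpace E G] [Group G] [LieGroup 𝓘(ℝ, E) ∞ G] :
    E →L[ℝ] E →L[ℝ] E :=
  haveI : LieGroup 𝓘(ℝ, E) (minSmoothness ℝ 3) G := by
    rw [minSmoothness_of_isRCLikeNormedField]; infer_instance
  haveI : CompleteSpace E := FiniteDimensional.complete ℝ E
  let b : GroupLieAlgebra 𝓘(ℝ, E) G →ₗ[ℝ] GroupLieAlgebra 𝓘(ℝ, E) G →ₗ[ℝ]
      GroupLieAlgebra 𝓘(ℝ, E) G :=
    LinearMap.mk₂ ℝ (fun u v => ⁅u, v⁆) add_lie smul_lie lie_add (fun c u v => lie_smul c u v)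
  LinearMap.toContinuousBilinearMap (𝕜 := ℝ) (E := E) (F := E) (G := E) b

end LieGroups

/-! ## Gerbes as cocycle data -/

section Gerbes

variable {E H E' H' F : Type*}
  [NormedAddCommGroup E] [NormedSpace ℝ E] [TopologicalSpace H]
  [NormedAddCommGroup E'] [NormedSpace ℝ E'] [TopologicalSpace H']
  [NormedAddCommGroup F] [NormedSpace ℝ F]
  {I : ModelWithCorners ℝ E H} {I' : ModelWithCorners ℝ E' H'}
  {X X' : Type*} [TopologicalSpace X] [ChartedSpace H X] [TopologicalSpace X'] [ChartedSpace H' X']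
  {T : Type*} [TopologicalSpace T] [ChartedSpace F T] [CommGroup T]

/-- A `T`-gerbe over `X`: an open cover and a smooth `T`-valued Čech 2-cocycle on it.
The Lie algebra of `T` is the model space `F`. -/
structure Gerbe (I : ModelWithCorners ℝ E H) (X : Type*) [TopologicalSpace X] [ChartedSpace H X]
    (F T : Type*) [NormedAddCommGroup F] [NormedSpace ℝ F]
    [TopologicalSpace T] [ChartedSpace F T] [CommGroup T] where
  ι : Type w
  U : ι → Set X
  isOpen : ∀ i, IsOpen (U i)
  cover : ∀ x, ∃ i, x ∈ U i
  lam : ι → ι → ι → X → T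
  smooth : ∀ i j k, ContMDiffOn I 𝓘(ℝ, F) ∞ (lam i j k) (U i ∩ U j ∩ U k)
  cocycle : ∀ i j k l, ∀ x ∈ U i ∩ U j ∩ U k ∩ U l,
    lam i k l x * lam i j k x = lam i j l x * lam j k l x

namespace Gerbe

/-- The pull-back `f^* L` of a gerbe along a smooth map. -/
def pullback (L : Gerbe.{w} I' X' F T) (f : X → X') (hf : ContMDiff I I' ∞ f) :
    Gerbe.{w} I X F T where
  ι := L.ι
  U i := f ⁻¹' L.U i
  isOpen i := (L.isOpen i).preimage hf.continuous
  cover x := L.cover (f x)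
  lam i j k x := L.lam i j k (f x)
  smooth i j k := (L.smooth i j k).comp hf.contMDiffOn fun _ hx => hx
  cocycle i j k l x hx := L.cocycle i j k l (f x) hx

/-- The tensor product of two gerbes. -/
def tensor [LieGroup 𝓘(ℝ, F) ∞ T] (L L' : Gerbe.{w} I X F T) : Gerbe.{w} I X F T where
  ι := L.ι × L'.ι
  U i := L.U i.1 ∩ L'.U i.2
  isOpen i := (L.isOpen i.1).inter (L'.isOpen i.2)
  cover x := ⟨((L.cover x).choose, (L'.cover x).choose),
    (L.cover x).choose_spec, (L'.cover x).choose_spec⟩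
  lam i j k x := L.lam i.1 j.1 k.1 x * L'.lam i.2 j.2 k.2 x
  smooth i j k :=
    ((L.smooth i.1 j.1 k.1).mono fun _ hx => ⟨⟨hx.1.1.1, hx.1.2.1⟩, hx.2.1⟩).mul
      ((L'.smooth i.2 j.2 k.2).mono fun _ hx => ⟨⟨hx.1.1.2, hx.1.2.2⟩, hx.2.2⟩)
  cocycle i j k l x hx := by
    rw [mul_mul_mul_comm, mul_mul_mul_comm (L.lam i.1 j.1 l.1 x),
      L.cocycle i.1 j.1 k.1 l.1 x ⟨⟨⟨hx.1.1.1.1, hx.1.1.2.1⟩, hx.1.2.1⟩, hx.2.1⟩,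
      L'.cocycle i.2 j.2 k.2 l.2 x ⟨⟨⟨hx.1.1.1.2, hx.1.1.2.2⟩, hx.1.2.2⟩, hx.2.2⟩]

/-- The 1-forms `A i j` on `U i ∩ U j` are a connective structure on the gerbe. -/
structure IsConnective (L : Gerbe.{w} I X F T) (A : L.ι → L.ι → DForm E X 1 F) : Prop where
  smooth : ∀ i j, SmoothForm I (A i j) (L.U i ∩ L.U j)
  cocycle : ∀ i j k, ∀ x ∈ L.U i ∩ L.U j ∩ L.U k,
    A i j x - A i k x + A j k x = pull I 𝓘(ℝ, F) (L.lam i j k) (thetaL F T) x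

/-- The 2-forms `B i` on `U i` are a curving for the connective structure `A`. -/
structure IsCurving (L : Gerbe.{w} I X F T) (A : L.ι → L.ι → DForm E X 1 F)
    (B : L.ι → DForm E X 2 F) : Prop where
  smooth : ∀ i, SmoothForm I (B i) (L.U i)
  diff : ∀ i j, ∀ x ∈ L.U i ∩ L.U j, B i x - B j x = extD I (A i j) x

/-- The curvature 3-form of a curving `B`: it equals `d (B i)` at each point of `U i`
(computed here for one `i` per point). -/
def curvature (L : Gerbe.{w} I X F T) (B : L.ι → DForm E X 2 F) : DForm E X 3 F :=
  fun x => extD I (B (L.cover x).choose) x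

end Gerbe

/-- The local 1-forms of the tensor product of two connective structures. -/
def tensorConn {ι ι' : Type*} (A : ι → ι → DForm E X 1 F) (A' : ι' → ι' → DForm E X 1 F) :
    ι × ι' → ι × ι' → DForm E X 1 F :=
  fun i j x => A i.1 j.1 x + A' i.2 j.2 x

/-- The local 2-forms of the tensor product of two curvings. -/
def tensorCurv {ι ι' : Type*} (B : ι → DForm E X 2 F) (B' : ι' → DForm E X 2 F) :
    ι × ι' → DForm E X 2 F :=
  fun i x => B i.1 x + B' i.2 x

/-- The pull-back of a connective structure. -/
def pullConn (I : ModelWithCorners ℝ E H) (I' : ModelWithCorners ℝ E' H') (f : X → X')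
    {ι : Type*} (A : ι → ι → DForm E' X' 1 F) : ι → ι → DForm E X 1 F :=
  fun i j => pull I I' f (A i j)

/-- The pull-back of a curving. -/
def pullCurv (I : ModelWithCorners ℝ E H) (I' : ModelWithCorners ℝ E' H') (f : X → X')
    {ι : Type*} (B : ι → DForm E' X' 2 F) : ι → DForm E X 2 F :=
  fun i => pull I I' f (B i)

/-- An isomorphism of gerbes `L₁ → L₂`: functions `s a b` on the overlaps of a common refinement
`V` of the two covers, with refinement maps `src` and `tgt`. -/
structure GerbeIso (L₁ L₂ : Gerbe.{w} I X F T) where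
  κ : Type w
  V : κ → Set X
  isOpen : ∀ a, IsOpen (V a)
  cover : ∀ x, ∃ a, x ∈ V a
  src : κ → L₁.ι
  tgt : κ → L₂.ι
  subset_src : ∀ a, V a ⊆ L₁.U (src a)
  subset_tgt : ∀ a, V a ⊆ L₂.U (tgt a)
  s : κ → κ → X → T
  smooth : ∀ a b, ContMDiffOn I 𝓘(ℝ, F) ∞ (s a b) (V a ∩ V b)
  cocycle : ∀ a b c, ∀ x ∈ V a ∩ V b ∩ V c,
    s a c x * L₁.lam (src a) (src b) (src c) x =
      L₂.lam (tgt a) (tgt b) (tgt c) x * s b c x * s a b x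

namespace GerbeIso

variable {L₁ L₂ : Gerbe.{w} I X F T}

/-- The 1-forms `η a` on `V a` are a connection on the isomorphism `φ`, with respect to the
connective structures `A₁`, `A₂`. -/
structure IsConnection (φ : GerbeIso L₁ L₂) (A₁ : L₁.ι → L₁.ι → DForm E X 1 F)
    (A₂ : L₂.ι → L₂.ι → DForm E X 1 F) (η : φ.κ → DForm E X 1 F) : Prop where
  smooth : ∀ a, SmoothForm I (η a) (φ.V a)
  diff : ∀ a b, ∀ x ∈ φ.V a ∩ φ.V b,
    η a x - η b x = A₁ (φ.src a) (φ.src b) x - A₂ (φ.tgt a) (φ.tgt b) x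
      - pull I 𝓘(ℝ, F) (φ.s a b) (thetaL F T) x

/-- The isomorphism `φ` with connection `η` has curvature `R` with respect to the curvings
`B₁`, `B₂`. -/
def HasCurvature (φ : GerbeIso L₁ L₂) (η : φ.κ → DForm E X 1 F) (B₁ : L₁.ι → DForm E X 2 F)
    (B₂ : L₂.ι → DForm E X 2 F) (R : DForm E X 2 F) : Prop :=
  ∀ a, ∀ x ∈ φ.V a, R x = extD I (η a) x - B₁ (φ.src a) x + B₂ (φ.tgt a) x

end GerbeIso

end Gerbes

/-! ## Multiplicative gerbes with connective structure -/

section MultiplicativeGerbes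

variable {EG : Type*} [NormedAddCommGroup EG] [NormedSpace ℝ EG]
  {G : Type*} [TopologicalSpace G] [ChartedSpace EG G] [Group G]
  {F : Type*} [NormedAddCommGroup F] [NormedSpace ℝ F]
  {T : Type*} [TopologicalSpace T] [ChartedSpace F T] [CommGroup T] [LieGroup 𝓘(ℝ, F) ∞ T]

/-- The face maps `G³ → G²` of the nerve of `G`. -/
def face3 : Fin 4 → G × G × G → G × G
  | 0, (_, h, k) => (h, k)
  | 1, (g, h, k) => (g * h, k)
  | 2, (g, h, k) => (g, h * k)
  | 3, (g, h, _) => (g, h)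

/-- The face maps `G⁴ → G³` of the nerve of `G`. -/
def face4 : Fin 5 → G × G × G × G → G × G × G
  | 0, (_, h, k, l) => (h, k, l)
  | 1, (g, h, k, l) => (g * h, k, l)
  | 2, (g, h, k, l) => (g, h * k, l)
  | 3, (g, h, k, l) => (g, h, k * l)
  | 4, (g, h, k, _) => (g, h, k)

/-- A multiplicative `T`-gerbe over `G`.

The associator is a 2-isomorphism, over `G × G × G`, from
`(g₁g₂, g₃)^* m ∘ ((g₁, g₂)^* m ⊗ id)` to `(g₁, g₂g₃)^* m ∘ (id ⊗ (g₂, g₃)^* m)`. It consists of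
functions `α r` on an open cover `W` of `G³`, together with refinement maps `δ j` to the covers of
the four pull-backs `(face3 j)^* m`; the equations `match_*` say that the two composites are formed
along coinciding refinement maps and that the induced refinement maps to the source and target
gerbes coincide. The pentagon identity is required on a common refinement `Y` of the five
pull-backs of `W` to `G⁴`. -/
structure MultGerbe (EG G F T : Type*) [NormedAddCommGroup EG] [NormedSpace ℝ EG]
    [TopologicalSpace G] [ChartedSpace EG G] [Group G] [LieGroup 𝓘(ℝ, EG) ∞ G]
    [NormedAddCommGroup F] [NormedSpace ℝ F] [TopologicalSpace T] [ChartedSpace F T]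
    [CommGroup T] [LieGroup 𝓘(ℝ, F) ∞ T] where
  /-- the gerbe -/
  gerbe : Gerbe.{w} 𝓘(ℝ, EG) G F T
  /-- the product `g₁^* 𝒢 ⊗ g₂^* 𝒢 → (g₁g₂)^* 𝒢` -/
  m : GerbeIso
    ((gerbe.pullback (I := 𝓘(ℝ, EG).prod 𝓘(ℝ, EG)) (Prod.fst : G × G → G) contMDiff_fst).tensor
      (gerbe.pullback (Prod.snd : G × G → G) contMDiff_snd))
    (gerbe.pullback (fun x : G × G => x.1 * x.2) (contMDiff_mul 𝓘(ℝ, EG) ∞))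
  /-- the associator -/
  ρ₃ : Type w
  W : ρ₃ → Set (G × G × G)
  W_isOpen : ∀ r, IsOpen (W r)
  W_cover : ∀ x, ∃ r, x ∈ W r
  δ : Fin 4 → ρ₃ → m.κ
  W_subset : ∀ r j, ∀ x ∈ W r, face3 j x ∈ m.V (δ j r)
  match_src : ∀ r, m.tgt (δ 3 r) = (m.src (δ 1 r)).1
  match_tgt : ∀ r, m.tgt (δ 0 r) = (m.src (δ 2 r)).2
  match_g₁ : ∀ r, (m.src (δ 3 r)).1 = (m.src (δ 2 r)).1
  match_g₂ : ∀ r, (m.src (δ 3 r)).2 = (m.src (δ 0 r)).1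
  match_g₃ : ∀ r, (m.src (δ 1 r)).2 = (m.src (δ 0 r)).2
  match_g₁g₂g₃ : ∀ r, m.tgt (δ 1 r) = m.tgt (δ 2 r)
  α : ρ₃ → G × G × G → T
  α_smooth : ∀ r, ContMDiffOn (𝓘(ℝ, EG).prod (𝓘(ℝ, EG).prod 𝓘(ℝ, EG))) 𝓘(ℝ, F) ∞ (α r) (W r)
  α_rel : ∀ r r', ∀ x ∈ W r ∩ W r',
    α r x * (m.s (δ 3 r) (δ 3 r') (face3 3 x) * m.s (δ 1 r) (δ 1 r') (face3 1 x)) =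
      (m.s (δ 0 r) (δ 0 r') (face3 0 x) * m.s (δ 2 r) (δ 2 r') (face3 2 x)) * α r' x
  /-- the pentagon identity -/
  ρ₄ : Type w
  Y : ρ₄ → Set (G × G × G × G)
  Y_isOpen : ∀ q, IsOpen (Y q)
  Y_cover : ∀ x, ∃ q, x ∈ Y q
  ε : Fin 5 → ρ₄ → ρ₃
  Y_subset : ∀ q j, ∀ x ∈ Y q, face4 j x ∈ W (ε j q)
  match_faces : ∀ q (i j : Fin 4), i ≤ j → δ i (ε j.succ q) = δ j (ε i.castSucc q)
  pentagon : ∀ q, ∀ x ∈ Y q,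
    α (ε 4 q) (face4 4 x) * α (ε 2 q) (face4 2 x) * α (ε 0 q) (face4 0 x) =
      α (ε 1 q) (face4 1 x) * α (ε 3 q) (face4 3 x)

/-- A connective structure `(∇, ∇_m)` on a multiplicative gerbe: a connective structure `A` on the
gerbe and a connection `M` on the product such that the associator is flat. -/
structure MultConnective [LieGroup 𝓘(ℝ, EG) ∞ G] (𝒢 : MultGerbe.{w} EG G F T) where
  A : 𝒢.gerbe.ι → 𝒢.gerbe.ι → DForm EG G 1 F
  isConnective : 𝒢.gerbe.IsConnective A
  M : 𝒢.m.κ → DForm (EG × EG) (G × G) 1 F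
  isConnection : 𝒢.m.IsConnection
    (tensorConn (pullConn (𝓘(ℝ, EG).prod 𝓘(ℝ, EG)) 𝓘(ℝ, EG) (Prod.fst : G × G → G) A)
      (pullConn (𝓘(ℝ, EG).prod 𝓘(ℝ, EG)) 𝓘(ℝ, EG) (Prod.snd : G × G → G) A))
    (pullConn (𝓘(ℝ, EG).prod 𝓘(ℝ, EG)) 𝓘(ℝ, EG) (fun x : G × G => x.1 * x.2) A) M
  flat : ∀ r, ∀ x ∈ 𝒢.W r,
    (pull (𝓘(ℝ, EG).prod (𝓘(ℝ, EG).prod 𝓘(ℝ, EG))) (𝓘(ℝ, EG).prod 𝓘(ℝ, EG)) (face3 0)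
          (M (𝒢.δ 0 r)) x +
        pull (𝓘(ℝ, EG).prod (𝓘(ℝ, EG).prod 𝓘(ℝ, EG))) (𝓘(ℝ, EG).prod 𝓘(ℝ, EG)) (face3 2)
          (M (𝒢.δ 2 r)) x) -
      (pull (𝓘(ℝ, EG).prod (𝓘(ℝ, EG).prod 𝓘(ℝ, EG))) (𝓘(ℝ, EG).prod 𝓘(ℝ, EG)) (face3 3)
          (M (𝒢.δ 3 r)) x +
        pull (𝓘(ℝ, EG).prod (𝓘(ℝ, EG).prod 𝓘(ℝ, EG))) (𝓘(ℝ, EG).prod 𝓘(ℝ, EG)) (face3 1)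
          (M (𝒢.δ 1 r)) x) +
      pull (𝓘(ℝ, EG).prod (𝓘(ℝ, EG).prod 𝓘(ℝ, EG))) 𝓘(ℝ, F) (𝒢.α r) (thetaL F T) x = 0

theorem update_vec2_zero {Z : Type*} (x y z : Z) : Function.update ![x, y] 0 z = ![z, y] := by
  ext i; fin_cases i <;> rfl

theorem update_vec2_one {Z : Type*} (x y z : Z) : Function.update ![x, y] 1 z = ![x, z] := by
  ext i; fin_cases i <;> rfl

theorem alt2_add_left {Z : Type*} [NormedAddCommGroup Z] [NormedSpace ℝ Z]
    (R : Z [⋀^Fin 2]→L[ℝ] F) (x y z : Z) : R ![x + y, z] = R ![x, z] + R ![y, z] := by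
  have h := R.map_update_add ![x, z] 0 x y
  rwa [update_vec2_zero, update_vec2_zero, update_vec2_zero] at h

theorem alt2_add_right {Z : Type*} [NormedAddCommGroup Z] [NormedSpace ℝ Z]
    (R : Z [⋀^Fin 2]→L[ℝ] F) (x y z : Z) : R ![x, y + z] = R ![x, y] + R ![x, z] := by
  have h := R.map_update_add ![x, z] 1 y z
  rwa [update_vec2_one, update_vec2_one, update_vec2_one] at h

theorem alt2_smul_left {Z : Type*} [NormedAddCommGroup Z] [NormedSpace ℝ Z]
    (R : Z [⋀^Fin 2]→L[ℝ] F) (c : ℝ) (x z : Z) : R ![c • x, z] = c • R ![x, z] := by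
  have h := R.map_update_smul ![x, z] 0 c x
  rwa [update_vec2_zero, update_vec2_zero] at h

theorem alt2_smul_right {Z : Type*} [NormedAddCommGroup Z] [NormedSpace ℝ Z]
    (R : Z [⋀^Fin 2]→L[ℝ] F) (c : ℝ) (x z : Z) : R ![x, c • z] = c • R ![x, z] := by
  have h := R.map_update_smul ![x, z] 1 c z
  rwa [update_vec2_one, update_vec2_one] at h

/-- The symmetric bilinear form
`(u, v) ↦ ½ R((0, u), (v, 0)) + ½ R((0, v), (u, 0))` associated with a 2-form `R` on `EG × EG`. -/
def bottForm [FiniteDimensional ℝ EG] (R : (EG × EG) [⋀^Fin 2]→L[ℝ] F) : EG →L[ℝ] EG →L[ℝ] F :=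
  LinearMap.toContinuousBilinearMap <|
    LinearMap.mk₂ ℝ
      (fun u v => (1 / 2 : ℝ) • R ![(0, u), (v, 0)] + (1 / 2 : ℝ) • R ![(0, v), (u, 0)])
      (fun u u' v => by
        have h1 : ((0 : EG), u + u') = (0, u) + (0, u') := by simp
        have h2 : (u + u', (0 : EG)) = (u, 0) + (u', 0) := by simp
        rw [h1, h2, alt2_add_left, alt2_add_right]; module)
      (fun c u v => by
        have h1 : ((0 : EG), c • u) = c • (0, u) := by simp
        have h2 : (c • u, (0 : EG)) = c • (u, 0) := by simp
        rw [h1, h2, alt2_smul_left, alt2_smul_right]; module)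
      (fun u v v' => by
        have h1 : ((0 : EG), v + v') = (0, v) + (0, v') := by simp
        have h2 : (v + v', (0 : EG)) = (v, 0) + (v', 0) := by simp
        rw [h1, h2, alt2_add_left, alt2_add_right]; module)
      (fun c u v => by
        have h1 : ((0 : EG), c • v) = c • (0, v) := by simp
        have h2 : (c • v, (0 : EG)) = c • (v, 0) := by simp
        rw [h1, h2, alt2_smul_left, alt2_smul_right]; module)

namespace MultConnective

variable [FiniteDimensional ℝ EG] [LieGroup 𝓘(ℝ, EG) ∞ G] {𝒢 : MultGerbe.{w} EG G F T}

/-- The pairing `⟨·,·⟩ : 𝔤 ⊗ 𝔤 → 𝔱` of a multiplicative gerbe with connective structure,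
`⟨u, v⟩ = ½ dM_{(1,1)}(0 + u, v + 0) + ½ dM_{(1,1)}(0 + v, u + 0)`, where `M` is any of the local
1-forms of the connection on the product that are defined at `(1, 1)`. -/
def pairing (c : MultConnective 𝒢) : EG →L[ℝ] EG →L[ℝ] F :=
  bottForm (extD (𝓘(ℝ, EG).prod 𝓘(ℝ, EG)) (c.M (𝒢.m.cover (1, 1)).choose) (1, 1))

/-- `Θ` is the Maurer-Cartan curving `Θ^L`: the curving on the gerbe for which the connection on the
product has curvature `ν = -⟨g₁^* θ^L ∧ g₂^* θ^R⟩`. -/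
structure IsMaurerCartan (c : MultConnective 𝒢) (Θ : 𝒢.gerbe.ι → DForm EG G 2 F) : Prop where
  isCurving : 𝒢.gerbe.IsCurving c.A Θ
  hasCurvature : 𝒢.m.HasCurvature c.M
    (tensorCurv (pullCurv (𝓘(ℝ, EG).prod 𝓘(ℝ, EG)) 𝓘(ℝ, EG) (Prod.fst : G × G → G) Θ)
      (pullCurv (𝓘(ℝ, EG).prod 𝓘(ℝ, EG)) 𝓘(ℝ, EG) (Prod.snd : G × G → G) Θ))
    (pullCurv (𝓘(ℝ, EG).prod 𝓘(ℝ, EG)) 𝓘(ℝ, EG) (fun x : G × G => x.1 * x.2) Θ)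
    (-wedge c.pairing
      (pull (𝓘(ℝ, EG).prod 𝓘(ℝ, EG)) 𝓘(ℝ, EG) (Prod.fst : G × G → G) (thetaL EG G))
      (pull (𝓘(ℝ, EG).prod 𝓘(ℝ, EG)) 𝓘(ℝ, EG) (Prod.snd : G × G → G) (thetaR EG G)))

end MultConnective

end MultiplicativeGerbes

/-! ## Principal bundles of multiplicative gerbes and their connections -/

section Bundles

variable {EM : Type*} [NormedAddCommGroup EM] [NormedSpace ℝ EM]
  {M : Type*} [TopologicalSpace M] [ChartedSpace EM M]
  {EP : Type*} [NormedAddCommGroup EP] [NormedSpace ℝ EP]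
  {P : Type*} [TopologicalSpace P] [ChartedSpace EP P]
  {EG : Type*} [NormedAddCommGroup EG] [NormedSpace ℝ EG]
  {G : Type*} [TopologicalSpace G] [ChartedSpace EG G] [Group G]
  {F : Type*} [NormedAddCommGroup F] [NormedSpace ℝ F]
  {T : Type*} [TopologicalSpace T] [ChartedSpace F T] [CommGroup T]

/-- A smooth principal `G`-bundle `proj : P → M`, with right action `act`. -/
structure PrincipalBundle (EM M EP P EG G : Type*) [NormedAddCommGroup EM] [NormedSpace ℝ EM]
    [TopologicalSpace M] [ChartedSpace EM M] [NormedAddCommGroup EP] [NormedSpace ℝ EP]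
    [TopologicalSpace P] [ChartedSpace EP P] [NormedAddCommGroup EG] [NormedSpace ℝ EG]
    [TopologicalSpace G] [ChartedSpace EG G] [Group G] where
  proj : P → M
  act : P × G → P
  proj_smooth : ContMDiff 𝓘(ℝ, EP) 𝓘(ℝ, EM) ∞ proj
  act_smooth : ContMDiff (𝓘(ℝ, EP).prod 𝓘(ℝ, EG)) 𝓘(ℝ, EP) ∞ act
  act_one : ∀ p, act (p, 1) = p
  act_mul : ∀ p g h, act (p, g * h) = act (act (p, g), h)
  /-- local triviality: equivariant diffeomorphisms `proj⁻¹ U ≅ U × G` over `U` -/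
  locTriv : ∀ x : M, ∃ (U : Set M) (e : OpenPartialHomeomorph P (M × G)),
    IsOpen U ∧ x ∈ U ∧ e.source = proj ⁻¹' U ∧ e.target = U ×ˢ Set.univ ∧
    (∀ p ∈ proj ⁻¹' U, (e p).1 = proj p) ∧
    (∀ p ∈ proj ⁻¹' U, ∀ g, proj (act (p, g)) = proj p ∧ (e (act (p, g))).2 = (e p).2 * g) ∧
    ContMDiffOn 𝓘(ℝ, EP) (𝓘(ℝ, EM).prod 𝓘(ℝ, EG)) ∞ e e.source ∧
    ContMDiffOn (𝓘(ℝ, EM).prod 𝓘(ℝ, EG)) 𝓘(ℝ, EP) ∞ e.symm e.target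

namespace PrincipalBundle

/-- The face maps `P × G² → P × G` of the nerve of the action groupoid. -/
def pface2 (Q : PrincipalBundle EM M EP P EG G) : Fin 3 → P × G × G → P × G
  | 0, (p, g, h) => (Q.act (p, g), h)
  | 1, (p, g, h) => (p, g * h)
  | 2, (p, g, _) => (p, g)

/-- The face maps `P × G³ → P × G²` of the nerve of the action groupoid. -/
def pface3 (Q : PrincipalBundle EM M EP P EG G) : Fin 4 → P × G × G × G → P × G × G
  | 0, (p, g, h, k) => (Q.act (p, g), h, k)
  | 1, (p, g, h, k) => (p, g * h, k)
  | 2, (p, g, h, k) => (p, g, h * k)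
  | 3, (p, g, h, _) => (p, g, h)

/-- `A` is the connection form of a `G`-connection: `act^* A = Ad(g⁻¹) p^* A + g^* θ^L`. -/
structure IsConnection (Q : PrincipalBundle EM M EP P EG G) (A : DForm EP P 1 EG) : Prop where
  smooth : SmoothForm 𝓘(ℝ, EP) A Set.univ
  equivariant : ∀ x : P × G,
    pull (𝓘(ℝ, EP).prod 𝓘(ℝ, EG)) 𝓘(ℝ, EP) Q.act A x =
      (Ad x.2⁻¹).compContinuousAlternatingMap
          (pull (𝓘(ℝ, EP).prod 𝓘(ℝ, EG)) 𝓘(ℝ, EP) Prod.fst A x) +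
        pull (𝓘(ℝ, EP).prod 𝓘(ℝ, EG)) 𝓘(ℝ, EG) Prod.snd (thetaL EG G) x

/-- A `k`-form on `P` with values in `𝔤` is tensorial if it is horizontal and equivariant; smooth
tensorial forms are the same as `ad P`-valued forms on `M`. -/
structure IsTensorial (Q : PrincipalBundle EM M EP P EG G) {k : ℕ} (φ : DForm EP P k EG) :
    Prop where
  smooth : SmoothForm 𝓘(ℝ, EP) φ Set.univ
  horizontal : ∀ p (v : Fin k → EP),
    (∃ i, tderiv 𝓘(ℝ, EP) 𝓘(ℝ, EM) Q.proj p (v i) = 0) → φ p v = 0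
  equivariant : ∀ p (g : G),
    pull 𝓘(ℝ, EP) 𝓘(ℝ, EP) (fun q => Q.act (q, g)) φ p =
      (Ad g⁻¹).compContinuousAlternatingMap (φ p)

end PrincipalBundle

section Curvature

variable [FiniteDimensional ℝ EG] [LieGroup 𝓘(ℝ, EG) ∞ G]

/-- The curvature `F_A = dA + ½ [A ∧ A]`, as a 2-form on the total space. -/
def curvatureForm (G : Type*) [TopologicalSpace G] [ChartedSpace EG G] [Group G]
    [LieGroup 𝓘(ℝ, EG) ∞ G] (A : DForm EP P 1 EG) : DForm EP P 2 EG :=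
  extD 𝓘(ℝ, EP) A + (1 / 2 : ℝ) • wedge (bracket EG G) A A

/-- The covariant exterior derivative `d_A φ = dφ + [A ∧ φ]` of `ad P`-valued forms, seen as
tensorial forms on the total space. -/
def covD (G : Type*) [TopologicalSpace G] [ChartedSpace EG G] [Group G]
    [LieGroup 𝓘(ℝ, EG) ∞ G] (A : DForm EP P 1 EG) (φ : DForm EP P 2 EG) : DForm EP P 3 EG :=
  extD 𝓘(ℝ, EP) φ + (wedge (bracket EG G) A φ : DForm EP P (1 + 2) EG)

/-- The Chern-Simons form `CS(A) = ⟨dA ∧ A⟩ + ⅓ ⟨A ∧ [A ∧ A]⟩` on the total space. -/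
def chernSimons (G : Type*) [TopologicalSpace G] [ChartedSpace EG G] [Group G]
    [LieGroup 𝓘(ℝ, EG) ∞ G] (B : EG →L[ℝ] EG →L[ℝ] F) (A : DForm EP P 1 EG) : DForm EP P 3 F :=
  (wedge B (extD 𝓘(ℝ, EP) A) A : DForm EP P (2 + 1) F) +
    (1 / 3 : ℝ) • (wedge B A (wedge (bracket EG G) A A) : DForm EP P (1 + 2) F)

end Curvature

variable [LieGroup 𝓘(ℝ, EG) ∞ G] [LieGroup 𝓘(ℝ, F) ∞ T]

/-- The remaining data `(𝓟, ρ, α^ρ)` of a principal `𝒢`-bundle with underlying `G`-bundle `Q`.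

The 2-isomorphism `α^ρ`, over `P × G × G`, goes from `(pg₁, g₂)^* ρ ∘ ((p, g₁)^* ρ ⊗ id)` to
`(p, g₁g₂)^* ρ ∘ (id ⊗ (g₁, g₂)^* m)`. It consists of functions `β r` on an open cover `W`, with
refinement maps `δ j` to the covers of `(pface2 j)^* ρ` and `π` to that of `(g₁, g₂)^* m`, with
matching conditions as for the associator of `𝒢`; its coherence is required on a common refinement
`Y` of the covers pulled back to `P × G³`. -/
structure GerbeBundle (𝒢 : MultGerbe.{w} EG G F T) (Q : PrincipalBundle EM M EP P EG G) where
  /-- the gerbe on `P` -/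
  gerbe : Gerbe.{w} 𝓘(ℝ, EP) P F T
  /-- the action `p^* 𝓟 ⊗ g^* 𝒢 → (pg)^* 𝓟` -/
  ρ : GerbeIso
    ((gerbe.pullback (I := 𝓘(ℝ, EP).prod 𝓘(ℝ, EG)) (Prod.fst : P × G → P) contMDiff_fst).tensor
      (𝒢.gerbe.pullback (Prod.snd : P × G → G) contMDiff_snd))
    (gerbe.pullback Q.act Q.act_smooth)
  /-- the 2-isomorphism `α^ρ` -/
  ρ₂ : Type w
  W : ρ₂ → Set (P × G × G)
  W_isOpen : ∀ r, IsOpen (W r)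
  W_cover : ∀ x, ∃ r, x ∈ W r
  δ : Fin 3 → ρ₂ → ρ.κ
  π : ρ₂ → 𝒢.m.κ
  W_subset : ∀ r j, ∀ x ∈ W r, Q.pface2 j x ∈ ρ.V (δ j r)
  W_subset' : ∀ r, ∀ x ∈ W r, x.2 ∈ 𝒢.m.V (π r)
  match_src : ∀ r, ρ.tgt (δ 2 r) = (ρ.src (δ 0 r)).1
  match_tgt : ∀ r, 𝒢.m.tgt (π r) = (ρ.src (δ 1 r)).2
  match_p : ∀ r, (ρ.src (δ 2 r)).1 = (ρ.src (δ 1 r)).1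
  match_g₁ : ∀ r, (ρ.src (δ 2 r)).2 = (𝒢.m.src (π r)).1
  match_g₂ : ∀ r, (ρ.src (δ 0 r)).2 = (𝒢.m.src (π r)).2
  match_pg₁g₂ : ∀ r, ρ.tgt (δ 0 r) = ρ.tgt (δ 1 r)
  β : ρ₂ → P × G × G → T
  β_smooth : ∀ r, ContMDiffOn (𝓘(ℝ, EP).prod (𝓘(ℝ, EG).prod 𝓘(ℝ, EG))) 𝓘(ℝ, F) ∞ (β r) (W r)
  β_rel : ∀ r r', ∀ x ∈ W r ∩ W r',
    β r x * (ρ.s (δ 2 r) (δ 2 r') (Q.pface2 2 x) * ρ.s (δ 0 r) (δ 0 r') (Q.pface2 0 x)) =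
      (𝒢.m.s (π r) (π r') x.2 * ρ.s (δ 1 r) (δ 1 r') (Q.pface2 1 x)) * β r' x
  /-- the coherence of `α^ρ` with the associator -/
  ρ₃ : Type w
  Y : ρ₃ → Set (P × G × G × G)
  Y_isOpen : ∀ q, IsOpen (Y q)
  Y_cover : ∀ x, ∃ q, x ∈ Y q
  ε : Fin 4 → ρ₃ → ρ₂
  χ : ρ₃ → 𝒢.ρ₃
  Y_subset : ∀ q j, ∀ x ∈ Y q, Q.pface3 j x ∈ W (ε j q)
  Y_subset' : ∀ q, ∀ x ∈ Y q, x.2 ∈ 𝒢.W (χ q)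
  match_faces : ∀ q (i j : Fin 3), i ≤ j → δ i (ε j.succ q) = δ j (ε i.castSucc q)
  match_faces' : ∀ q j, π (ε j q) = 𝒢.δ j (χ q)
  coherence : ∀ q, ∀ x ∈ Y q,
    β (ε 3 q) (Q.pface3 3 x) * β (ε 1 q) (Q.pface3 1 x) * 𝒢.α (χ q) x.2 =
      β (ε 0 q) (Q.pface3 0 x) * β (ε 2 q) (Q.pface3 2 x)

/-- A connection on a principal `𝒢`-bundle: a connective structure `(σ, η)` on `𝓟` and on the
action `ρ` for which `α^ρ` is flat, a `G`-connection `A` on `P`, and a curving `B` on `𝓟` such that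
the connection `η` on `ρ` has curvature `-⟨p^* A ∧ g^* θ^R⟩` with respect to `p^* B ⊗ g^* Θ^L` and
`(pg)^* B`. Here `c` is the connective structure of `𝒢` and `Θ` its Maurer-Cartan curving. -/
structure GerbeBundle.Connection [FiniteDimensional ℝ EG] {𝒢 : MultGerbe.{w} EG G F T}
    (c : MultConnective 𝒢) (Θ : 𝒢.gerbe.ι → DForm EG G 2 F)
    {Q : PrincipalBundle EM M EP P EG G} (𝓟 : GerbeBundle 𝒢 Q) where
  σ : 𝓟.gerbe.ι → 𝓟.gerbe.ι → DForm EP P 1 F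
  isConnective : 𝓟.gerbe.IsConnective σ
  η : 𝓟.ρ.κ → DForm (EP × EG) (P × G) 1 F
  isConnection : 𝓟.ρ.IsConnection
    (tensorConn (pullConn (𝓘(ℝ, EP).prod 𝓘(ℝ, EG)) 𝓘(ℝ, EP) (Prod.fst : P × G → P) σ)
      (pullConn (𝓘(ℝ, EP).prod 𝓘(ℝ, EG)) 𝓘(ℝ, EG) (Prod.snd : P × G → G) c.A))
    (pullConn (𝓘(ℝ, EP).prod 𝓘(ℝ, EG)) 𝓘(ℝ, EP) Q.act σ) η
  flat : ∀ r, ∀ x ∈ 𝓟.W r,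
    (pull (𝓘(ℝ, EP).prod (𝓘(ℝ, EG).prod 𝓘(ℝ, EG))) (𝓘(ℝ, EG).prod 𝓘(ℝ, EG)) Prod.snd
          (c.M (𝓟.π r)) x +
        pull (𝓘(ℝ, EP).prod (𝓘(ℝ, EG).prod 𝓘(ℝ, EG))) (𝓘(ℝ, EP).prod 𝓘(ℝ, EG)) (Q.pface2 1)
          (η (𝓟.δ 1 r)) x) -
      (pull (𝓘(ℝ, EP).prod (𝓘(ℝ, EG).prod 𝓘(ℝ, EG))) (𝓘(ℝ, EP).prod 𝓘(ℝ, EG)) (Q.pface2 2)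
          (η (𝓟.δ 2 r)) x +
        pull (𝓘(ℝ, EP).prod (𝓘(ℝ, EG).prod 𝓘(ℝ, EG))) (𝓘(ℝ, EP).prod 𝓘(ℝ, EG)) (Q.pface2 0)
          (η (𝓟.δ 0 r)) x) +
      pull (𝓘(ℝ, EP).prod (𝓘(ℝ, EG).prod 𝓘(ℝ, EG))) 𝓘(ℝ, F) (𝓟.β r) (thetaL F T) x = 0
  A : DForm EP P 1 EG
  isGConnection : Q.IsConnection A
  B : 𝓟.gerbe.ι → DForm EP P 2 F
  isCurving : 𝓟.gerbe.IsCurving σ B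
  hasCurvature : 𝓟.ρ.HasCurvature η
    (tensorCurv (pullCurv (𝓘(ℝ, EP).prod 𝓘(ℝ, EG)) 𝓘(ℝ, EP) (Prod.fst : P × G → P) B)
      (pullCurv (𝓘(ℝ, EP).prod 𝓘(ℝ, EG)) 𝓘(ℝ, EG) (Prod.snd : P × G → G) Θ))
    (pullCurv (𝓘(ℝ, EP).prod 𝓘(ℝ, EG)) 𝓘(ℝ, EP) Q.act B)
    (-wedge c.pairing
      (pull (𝓘(ℝ, EP).prod 𝓘(ℝ, EG)) 𝓘(ℝ, EP) (Prod.fst : P × G → P) A)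
      (pull (𝓘(ℝ, EP).prod 𝓘(ℝ, EG)) 𝓘(ℝ, EG) (Prod.snd : P × G → G) (thetaR EG G)))

/-- `H` is the 3-form component of the curvature of the connection: the smooth form on `M` with
`proj^* H = Ĥ + CS(A)`, where `Ĥ` is the curvature of the curving `B`. -/
structure GerbeBundle.Connection.IsCurvature3 [FiniteDimensional ℝ EG]
    {𝒢 : MultGerbe.{w} EG G F T} {c : MultConnective 𝒢} {Θ : 𝒢.gerbe.ι → DForm EG G 2 F}
    {Q : PrincipalBundle EM M EP P EG G} {𝓟 : GerbeBundle 𝒢 Q} (a : 𝓟.Connection c Θ)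
    (H : DForm EM M 3 F) : Prop where
  smooth : SmoothForm 𝓘(ℝ, EM) H Set.univ
  pull_eq : pull 𝓘(ℝ, EP) 𝓘(ℝ, EM) Q.proj H =
    𝓟.gerbe.curvature a.B + chernSimons G c.pairing a.A

end Bundles

end TwoBundle

end

/-!
The proof transports everything to the total spaces `P`, `P × G`, `G × G` and `G³`, where the
identities between differential forms are checked by evaluating them on tangent vectors.

The calculus of forms rests on three facts: the exterior derivative, which is computed in preferred
charts, commutes with pull-back (`extD_pull`), squares to zero (`extD_extD`), and satisfies the
Leibniz rule (`extD_wedge_one_one` and its analogues in higher degree). On a Lie group one needs the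
Maurer-Cartan equation `extD_thetaL`. Its consequence for the multiplication map of `G` yields the
derivative of the adjoint action (`tderiv_Ad_inv`) and `Ad`-equivariance of the bracket
(`Ad_bracket`).

Let `⟨·,·⟩` be the pairing of the multiplicative gerbe. Flatness of the associator implies that the
2-form `-⟨g₁^* θ^L ∧ g₂^* θ^R⟩` on `G × G` has vanishing alternating sum over the faces of `G³`,
because the curvings cancel there (`pull_face3_prodForm`). Evaluated at `(1, h, 1)` this says that
the pairing is `Ad`-invariant. The exterior derivative of the equation that characterizes the
Maurer-Cartan curving `Θ^L` identifies `dΘ^L` with the Cartan 3-form (`IsMaurerCartan.extD_apply`).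

For the connection `A`, the equation `act^* A = Ad(g⁻¹) p^* A + g^* θ^L` implies
`act^* F_A = Ad(g⁻¹) p^* F_A` on `P × G`. Since a local section composed with the projection is of
the form `p ↦ p · γ(p)`, this gives both horizontality and equivariance of `F_A`, and
`d_A F_A = 0` follows from the Leibniz rule and the Jacobi identity.

In the same way the exterior derivative of the curvature condition on `ρ` gives
`act^* Ĥ = p^* Ĥ + g^* dΘ^L - d⟨act^* A ∧ g^* θ^L⟩`. By the invariance of the pairing the last two
terms are exactly compensated by the change of `CS(A)` (`chernSimons_gauge`), so that `Ĥ + CS(A)` is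
invariant and descends to a unique form `H` on `M` (`existsUnique_pull_proj`). Finally `Ĥ` is locally
exact, so that `dH` pulls back to `d CS(A) = ⟨F_A ∧ F_A⟩` (`extD_chernSimons`).
-/

open scoped Manifold ContDiff

noncomputable section

namespace TwoBundle

open Filter Topology

universe w

section FormsAndLieGroups

open ContinuousAlternatingMap

section FormCalculus

variable {E H E' H' E'' H'' V V₁ V₂ V₃ : Type*}
  [NormedAddCommGroup E] [NormedSpace ℝ E] [TopologicalSpace H]
  [NormedAddCommGroup E'] [NormedSpace ℝ E'] [TopologicalSpace H']
  [NormedAddCommGroup E''] [NormedSpace ℝ E''] [TopologicalSpace H'']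
  [NormedAddCommGroup V] [NormedSpace ℝ V]
  [NormedAddCommGroup V₁] [NormedSpace ℝ V₁]
  [NormedAddCommGroup V₂] [NormedSpace ℝ V₂]
  [NormedAddCommGroup V₃] [NormedSpace ℝ V₃]
  {I : ModelWithCorners ℝ E H} {I' : ModelWithCorners ℝ E' H'} {I'' : ModelWithCorners ℝ E'' H''}
  {X X' X'' : Type*} [TopologicalSpace X] [ChartedSpace H X]
  [TopologicalSpace X'] [ChartedSpace H' X'] [TopologicalSpace X''] [ChartedSpace H'' X'']
  {k l : ℕ}

/-! ### Smoothness of families of alternating maps -/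

theorem two_le_infty : (2 : WithTop ℕ∞) ≤ ∞ :=
  WithTop.coe_le_coe.2 (le_top : (2 : ℕ∞) ≤ ⊤)

/-- Smoothness of a family of alternating maps may be tested on each tuple of vectors. -/
theorem contDiffAt_alternating_iff [FiniteDimensional ℝ E] [FiniteDimensional ℝ V]
    {n : WithTop ℕ∞} {a : E' → E [⋀^Fin k]→L[ℝ] V} {y : E'} :
    ContDiffAt ℝ n a y ↔ ∀ v, ContDiffAt ℝ n (fun z => a z v) y := by
  refine ⟨fun h v => (ContinuousAlternatingMap.apply ℝ E V v).contDiff.contDiffAt.comp y h,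
    fun h => ?_⟩
  let b := Module.finBasis ℝ E
  -- an alternating map is determined by its values on tuples of basis vectors, and a left inverse
  -- of the corresponding injection into a finite-dimensional space is continuous
  let Ψ : (E [⋀^Fin k]→L[ℝ] V) →ₗ[ℝ] ((Fin k → Fin (Module.finrank ℝ E)) → V) :=
    { toFun := fun c i => c fun j => b (i j)
      map_add' := fun _ _ => rfl
      map_smul' := fun _ _ => rfl }
  have hΨ : LinearMap.ker Ψ = ⊥ := by
    rw [LinearMap.ker_eq_bot]
    intro a a' haa'
    apply ContinuousAlternatingMap.toAlternatingMap_injective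
    apply AlternatingMap.coe_multilinearMap_injective
    exact Module.Basis.ext_multilinear (fun _ => b) fun i => congrFun haa' i
  obtain ⟨g, hg⟩ := Ψ.exists_leftInverse_of_injective hΨ
  have : a = fun z => LinearMap.toContinuousLinearMap g (fun i => a z fun j => b (i j)) := by
    ext1 z
    exact (LinearMap.congr_fun hg (a z)).symm
  rw [this]
  exact (LinearMap.toContinuousLinearMap g).contDiff.contDiffAt.comp y
    (contDiffAt_pi.2 fun i => h _)

theorem contDiffAt_compContinuousLinearMap [FiniteDimensional ℝ E] [FiniteDimensional ℝ V]
    {n : WithTop ℕ∞} {a : E'' → E' [⋀^Fin k]→L[ℝ] V} {L : E'' → E →L[ℝ] E'} {y : E''}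
    (ha : ContDiffAt ℝ n a y) (hL : ContDiffAt ℝ n L y) :
    ContDiffAt ℝ n (fun z => (a z).compContinuousLinearMap (L z)) y := by
  rw [contDiffAt_alternating_iff]
  intro v
  have h1 : ContDiffAt ℝ n (fun z =>
      ContinuousMultilinearMap.compContinuousLinearMapContinuousMultilinear ℝ
        (fun _ : Fin k => E) (fun _ : Fin k => E') V (fun _ => L z)) y :=
    (ContinuousMultilinearMap.contDiff _).contDiffAt.comp y (contDiffAt_pi.2 fun _ => hL)
  have h2 : ContDiffAt ℝ n (fun z => (a z).toContinuousMultilinearMap) y :=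
    (toContinuousMultilinearMapCLM (𝕜 := ℝ) (E := E') (F := V)
      (ι := Fin k) ℝ).contDiff.contDiffAt.comp y ha
  exact (ContinuousMultilinearMap.apply ℝ (fun _ : Fin k => E) V v).contDiff.contDiffAt.comp y
    (h1.clm_apply h2)

/-! ### Derivatives and pull-backs -/

theorem tderiv_comp {g : X' → X''} {f : X → X'} {x : X} (hg : MDifferentiableAt I' I'' g (f x))
    (hf : MDifferentiableAt I I' f x) :
    tderiv I I'' (g ∘ f) x = (tderiv I' I'' g (f x)).comp (tderiv I I' f x) :=
  mfderiv_comp x hg hf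

theorem tderiv_congr {f g : X → X'} {x : X} (h : f =ᶠ[𝓝 x] g) :
    tderiv I I' f x = tderiv I I' g x :=
  h.mfderiv_eq

theorem tderiv_eq_fderiv (f : E → E') (x : E) : tderiv 𝓘(ℝ, E) 𝓘(ℝ, E') f x = fderiv ℝ f x :=
  mfderiv_eq_fderiv

theorem tderiv_id (x : X) : tderiv I I (fun z : X => z) x = ContinuousLinearMap.id ℝ E :=
  mfderiv_id

theorem tderiv_extChartAt_self [IsManifold I 1 X] (x : X) :
    tderiv I 𝓘(ℝ, E) (extChartAt I x) x = ContinuousLinearMap.id ℝ E :=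
  mfderiv_extChartAt_self

theorem tderiv_const (c : X') (x : X) : tderiv I I' (fun _ : X => c) x = 0 :=
  mfderiv_const

theorem tderiv_fst (x : X × X') :
    tderiv (I.prod I') I Prod.fst x = ContinuousLinearMap.fst ℝ E E' :=
  mfderiv_fst

theorem tderiv_snd (x : X × X') :
    tderiv (I.prod I') I' Prod.snd x = ContinuousLinearMap.snd ℝ E E' :=
  mfderiv_snd

theorem tderiv_prodMk {f : X → X'} {g : X → X''} {x : X} (hf : MDifferentiableAt I I' f x)
    (hg : MDifferentiableAt I I'' g x) :
    tderiv I (I'.prod I'') (fun z => (f z, g z)) x = (tderiv I I' f x).prod (tderiv I I'' g x) :=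
  mfderiv_prodMk hf hg

theorem pull_apply (f : X → X') (φ : DForm E' X' k V) (x : X) (v : Fin k → E) :
    pull I I' f φ x v = φ (f x) (fun i => tderiv I I' f x (v i)) := rfl

theorem pull_apply_one (f : X → X') (φ : DForm E' X' 1 V) (x : X) (u : E) :
    pull I I' f φ x ![u] = φ (f x) ![tderiv I I' f x u] := by
  rw [pull_apply]; congr 1; ext i; fin_cases i; rfl

theorem pull_apply_two (f : X → X') (φ : DForm E' X' 2 V) (x : X) (u v : E) :
    pull I I' f φ x ![u, v] = φ (f x) ![tderiv I I' f x u, tderiv I I' f x v] := by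
  rw [pull_apply]; congr 1; ext i; fin_cases i <;> rfl

theorem pull_apply_three (f : X → X') (φ : DForm E' X' 3 V) (x : X) (u v w : E) :
    pull I I' f φ x ![u, v, w] =
      φ (f x) ![tderiv I I' f x u, tderiv I I' f x v, tderiv I I' f x w] := by
  rw [pull_apply]; congr 1; ext i; fin_cases i <;> rfl

theorem pull_add (f : X → X') (φ ψ : DForm E' X' k V) :
    pull I I' f (φ + ψ) = pull I I' f φ + pull I I' f ψ := rfl

theorem pull_comp {g : X' → X''} {f : X → X'} {x : X} (φ : DForm E'' X'' k V)
    (hg : MDifferentiableAt I' I'' g (f x)) (hf : MDifferentiableAt I I' f x) :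
    pull I I' f (pull I' I'' g φ) x = pull I I'' (fun z => g (f z)) φ x := by
  have := tderiv_comp hg hf
  ext v
  simp only [pull_apply]
  change _ = φ (g (f x)) fun i => tderiv I I'' (g ∘ f) x (v i)
  rw [this]; rfl

theorem pull_id (φ : DForm E X k V) : pull I I (fun z : X => z) φ = φ := by
  ext x v
  rw [pull_apply, tderiv_id]; rfl

theorem pull_congr {f g : X → X'} {x : X} (h : f =ᶠ[𝓝 x] g) (φ : DForm E' X' k V) :
    pull I I' f φ x = pull I I' g φ x := by
  ext v
  rw [pull_apply, pull_apply, tderiv_congr h, h.eq_of_nhds]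

theorem pull_congr_form {f : X → X'} {x : X} {φ ψ : DForm E' X' k V} (h : φ (f x) = ψ (f x)) :
    pull I I' f φ x = pull I I' f ψ x := by
  unfold pull; rw [h]

/-! ### Forms in charts -/

/-- `φ` is smooth at each point of some neighbourhood of `x`. The expression of `φ` is tested in the
preferred chart at each of these points, as in `SmoothForm`; this makes the notion stable under
pull-back and exterior derivative, where a condition at `x` alone would not be. -/
def SmoothNear (I : ModelWithCorners ℝ E H) (φ : DForm E X k V) (x : X) : Prop :=
  ∀ᶠ z in 𝓝 x, ContDiffAt ℝ ∞ (inChart I z φ) (extChartAt I z z)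

theorem SmoothForm.smoothNear {φ : DForm E X k V} {s : Set X} (h : SmoothForm I φ s)
    (hs : IsOpen s) {x : X} (hx : x ∈ s) : SmoothNear I φ x :=
  (hs.eventually_mem hx).mono h

theorem SmoothNear.contDiffAt {φ : DForm E X k V} {x : X} (h : SmoothNear I φ x) :
    ContDiffAt ℝ ∞ (inChart I x φ) (extChartAt I x x) :=
  h.self_of_nhds

theorem SmoothNear.eventually {φ : DForm E X k V} {x : X} (h : SmoothNear I φ x) :
    ∀ᶠ z in 𝓝 x, SmoothNear I φ z :=
  eventually_eventually_nhds.2 h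

theorem smoothForm_of_smoothNear {φ : DForm E X k V} {s : Set X} (h : ∀ x ∈ s, SmoothNear I φ x) :
    SmoothForm I φ s :=
  fun x hx => (h x hx).contDiffAt

theorem eventually_mem_chart_target [I.Boundaryless] (x : X) :
    ∀ᶠ y in 𝓝 (extChartAt I x x), y ∈ (extChartAt I x).target :=
  (isOpen_extChartAt_target x).eventually_mem (mem_extChartAt_target x)

theorem tendsto_chart_symm (x : X) :
    Tendsto (extChartAt I x).symm (𝓝 (extChartAt I x x)) (𝓝 x) := by
  have := continuousAt_extChartAt_symm (I := I) x
  rwa [ContinuousAt, extChartAt_to_inv] at this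

theorem inChart_congr {φ ψ : DForm E X k V} {x : X} (h : φ =ᶠ[𝓝 x] ψ) :
    inChart I x φ =ᶠ[𝓝 (extChartAt I x x)] inChart I x ψ := by
  filter_upwards [(tendsto_chart_symm x).eventually h] with y hy
  exact pull_congr_form hy

theorem extD_congr {φ ψ : DForm E X k V} {x : X} (h : φ =ᶠ[𝓝 x] ψ) :
    extD I φ x = extD I ψ x := by
  unfold extD
  rw [(inChart_congr h).extDeriv_eq]

theorem SmoothNear.congr {φ ψ : DForm E X k V} {x : X} (hφ : SmoothNear I φ x) (h : φ =ᶠ[𝓝 x] ψ) :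
    SmoothNear I ψ x := by
  filter_upwards [hφ, h.eventually_nhds] with z hz hz'
  exact hz.congr_of_eventuallyEq (inChart_congr hz').symm

theorem SmoothNear.add {φ ψ : DForm E X k V} {x : X} (hφ : SmoothNear I φ x)
    (hψ : SmoothNear I ψ x) : SmoothNear I (φ + ψ) x := by
  filter_upwards [hφ, hψ] with z h1 h2
  exact h1.add h2

theorem SmoothNear.const_smul {φ : DForm E X k V} {x : X} (c : ℝ) (hφ : SmoothNear I φ x) :
    SmoothNear I (c • φ) x := by
  filter_upwards [hφ] with z h1
  exact h1.const_smul c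

theorem SmoothNear.neg {φ : DForm E X k V} {x : X} (hφ : SmoothNear I φ x) :
    SmoothNear I (-φ) x := by
  filter_upwards [hφ] with z h1
  exact h1.neg

theorem extD_add {φ ψ : DForm E X k V} {x : X} (hφ : SmoothNear I φ x)
    (hψ : SmoothNear I ψ x) : extD I (φ + ψ) x = extD I φ x + extD I ψ x := by
  have h : inChart I x (φ + ψ) = inChart I x φ + inChart I x ψ := rfl
  unfold extD
  rw [h, extDeriv_add (hφ.contDiffAt.differentiableAt (by simp))
    (hψ.contDiffAt.differentiableAt (by simp))]
  rfl

theorem extD_smul (c : ℝ) (φ : DForm E X k V) (x : X) : extD I (c • φ) x = c • extD I φ x := by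
  have h : inChart I x (c • φ) = c • inChart I x φ := rfl
  unfold extD
  rw [h, extDeriv_smul]
  rfl

theorem extD_neg (φ : DForm E X k V) (x : X) : extD I (-φ) x = - extD I φ x := by
  have := extD_smul (I := I) (-1) φ x
  simpa using this

theorem extD_sub {φ ψ : DForm E X k V} {x : X} (hφ : SmoothNear I φ x)
    (hψ : SmoothNear I ψ x) : extD I (φ - ψ) x = extD I φ x - extD I ψ x := by
  rw [sub_eq_add_neg, extD_add hφ hψ.neg, extD_neg, sub_eq_add_neg]

variable [IsManifold I ∞ X] [IsManifold I' ∞ X']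

theorem contMDiffAt_chart {x z : X} (hz : z ∈ (extChartAt I x).source) :
    ContMDiffAt I 𝓘(ℝ, E) ∞ (extChartAt I x) z :=
  contMDiffAt_extChartAt' (by rwa [extChartAt_source] at hz)

theorem mdiff_chart {x z : X} (hz : z ∈ (extChartAt I x).source) :
    MDifferentiableAt I 𝓘(ℝ, E) (extChartAt I x) z :=
  (contMDiffAt_chart hz).mdifferentiableAt (by simp)

theorem contMDiffAt_eventually_mdiff {f : X → X'} {x : X} (hf : ContMDiffAt I I' ∞ f x) :
    ∀ᶠ z in 𝓝 x, MDifferentiableAt I I' f z := by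
  have h1 : ContMDiffAt I I' 1 f x := hf.of_le (by simp)
  filter_upwards [(contMDiffAt_iff_contMDiffAt_nhds (by simp)).1 h1] with z hz
  exact hz.mdifferentiableAt (by simp)

theorem contDiffAt_inCharts [I.Boundaryless] {f : X → X'} {x : X} (hf : ContMDiffAt I I' ∞ f x) :
    ContDiffAt ℝ ∞ (fun y => extChartAt I' (f x) (f ((extChartAt I x).symm y)))
      (extChartAt I x x) := by
  rw [← contMDiffAt_iff_contDiffAt]
  have h1 : ContMDiffAt 𝓘(ℝ, E) I ∞ (extChartAt I x).symm (extChartAt I x x) :=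
    (contMDiffOn_extChartAt_symm x).contMDiffAt (extChartAt_target_mem_nhds x)
  have e : (extChartAt I x).symm (extChartAt I x x) = x := extChartAt_to_inv x
  have h2 : ContMDiffAt I I' ∞ f ((extChartAt I x).symm (extChartAt I x x)) := by rwa [e]
  have h3 : ContMDiffAt I' 𝓘(ℝ, E') ∞ (extChartAt I' (f x))
      (f ((extChartAt I x).symm (extChartAt I x x))) :=
    contMDiffAt_chart (by rw [e]; exact mem_extChartAt_source _)
  exact (h3.comp _ h2).comp _ h1

variable [I.Boundaryless] [I'.Boundaryless]

theorem contMDiffAt_chart_symm {x : X} {y : E} (hy : y ∈ (extChartAt I x).target) :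
    ContMDiffAt 𝓘(ℝ, E) I ∞ (extChartAt I x).symm y :=
  (contMDiffOn_extChartAt_symm x).contMDiffAt ((isOpen_extChartAt_target x).mem_nhds hy)

theorem mdiff_chart_symm {x : X} {y : E} (hy : y ∈ (extChartAt I x).target) :
    MDifferentiableAt 𝓘(ℝ, E) I (extChartAt I x).symm y :=
  (contMDiffAt_chart_symm hy).mdifferentiableAt (by simp)

/-- The coordinate expression of a pull-back is the pull-back along the coordinate expression. -/
theorem inChart_pull {f : X → X'} {x : X} (hf : ∀ᶠ z in 𝓝 x, MDifferentiableAt I I' f z)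
    (φ : DForm E' X' k V) :
    inChart I x (pull I I' f φ) =ᶠ[𝓝 (extChartAt I x x)] fun y =>
      (inChart I' (f x) φ
        (extChartAt I' (f x) (f ((extChartAt I x).symm y)))).compContinuousLinearMap
        (fderiv ℝ (fun y => extChartAt I' (f x) (f ((extChartAt I x).symm y))) y) := by
  have hc : ∀ᶠ z in 𝓝 x, f z ∈ (extChartAt I' (f x)).source :=
    hf.self_of_nhds.continuousAt.eventually (extChartAt_source_mem_nhds (I := I') (f x))
  filter_upwards [eventually_mem_chart_target (I := I) x,
    (tendsto_chart_symm (I := I) x).eventually hf,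
    (tendsto_chart_symm (I := I) x).eventually hc.eventually_nhds] with y hy hfy hcy
  have hcy' := hcy.self_of_nhds
  rw [← tderiv_eq_fderiv]
  change pull 𝓘(ℝ, E) I (extChartAt I x).symm (pull I I' f φ) y = pull 𝓘(ℝ, E) 𝓘(ℝ, E')
    (fun y => extChartAt I' (f x) (f ((extChartAt I x).symm y)))
    (pull 𝓘(ℝ, E') I' (extChartAt I' (f x)).symm φ) y
  have hs := mdiff_chart_symm hy
  have hF : MDifferentiableAt 𝓘(ℝ, E) 𝓘(ℝ, E')
      (fun y => extChartAt I' (f x) (f ((extChartAt I x).symm y))) y :=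
    ((mdiff_chart hcy').comp _ hfy).comp _ hs
  rw [pull_comp φ hfy hs,
    pull_comp (f := fun y => extChartAt I' (f x) (f ((extChartAt I x).symm y))) φ
      (mdiff_chart_symm ((extChartAt I' (f x)).map_source hcy')) hF]
  refine pull_congr ?_ φ
  filter_upwards [(hs.continuousAt).eventually hcy] with y' hy'
  exact ((extChartAt I' (f x)).left_inv hy').symm

theorem contDiffAt_inChart_pull [FiniteDimensional ℝ E] [FiniteDimensional ℝ V] {f : X → X'} {x : X}
    (hf : ContMDiffAt I I' ∞ f x) {φ : DForm E' X' k V}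
    (hφ : ContDiffAt ℝ ∞ (inChart I' (f x) φ) (extChartAt I' (f x) (f x))) :
    ContDiffAt ℝ ∞ (inChart I x (pull I I' f φ)) (extChartAt I x x) := by
  refine ContDiffAt.congr_of_eventuallyEq ?_ (inChart_pull (contMDiffAt_eventually_mdiff hf) φ)
  have hF := contDiffAt_inCharts hf
  refine contDiffAt_compContinuousLinearMap (ContDiffAt.comp _ ?_ hF) (hF.fderiv_right (by simp))
  rwa [extChartAt_to_inv]

theorem SmoothNear.pull [FiniteDimensional ℝ E] [FiniteDimensional ℝ V] {f : X → X'} {x : X}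
    (hf : ∀ᶠ z in 𝓝 x, ContMDiffAt I I' ∞ f z) {φ : DForm E' X' k V}
    (hφ : SmoothNear I' φ (f x)) : SmoothNear I (pull I I' f φ) x := by
  filter_upwards [hf, hf.self_of_nhds.continuousAt.eventually hφ] with z hz hz'
  exact contDiffAt_inChart_pull hz hz'

/-- The exterior derivative commutes with pull-back. In particular it does not depend on the chart
that is used to compute it. -/
theorem extD_pull {f : X → X'} {x : X} (hf : ContMDiffAt I I' ∞ f x) {φ : DForm E' X' k V}
    (hφ : ContDiffAt ℝ ∞ (inChart I' (f x) φ) (extChartAt I' (f x) (f x))) :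
    extD I (pull I I' f φ) x = pull I I' f (extD I' φ) x := by
  have hF := contDiffAt_inCharts hf
  have hfx := hf.mdifferentiableAt (by simp)
  unfold extD
  rw [(inChart_pull (contMDiffAt_eventually_mdiff hf) φ).extDeriv_eq,
    extDeriv_pullback (r := ∞) (by
      rw [extChartAt_to_inv]; exact hφ.differentiableAt (by simp)) hF
      (by simpa using two_le_infty), extChartAt_to_inv]
  have key : (fderiv ℝ (fun y => extChartAt I' (f x) (f ((extChartAt I x).symm y)))
        (extChartAt I x x)).comp (tderiv I 𝓘(ℝ, E) (extChartAt I x) x) =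
      (tderiv I' 𝓘(ℝ, E') (extChartAt I' (f x)) (f x)).comp (tderiv I I' f x) := by
    rw [← tderiv_comp (mdiff_chart (mem_extChartAt_source _)) hfx, ← tderiv_eq_fderiv,
      ← tderiv_comp (hF.contMDiffAt.mdifferentiableAt (by simp))
        (mdiff_chart (mem_extChartAt_source _))]
    refine tderiv_congr ?_
    filter_upwards [extChartAt_source_mem_nhds (I := I) x] with z hz
    simp only [Function.comp_apply, (extChartAt I x).left_inv hz]
  ext v
  exact congrArg (extDeriv (inChart I' (f x) φ) (extChartAt I' (f x) (f x)))
    (funext fun i => DFunLike.congr_fun key (v i))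

theorem inChart_self (φ : DForm E E k V) (x : E) : inChart 𝓘(ℝ, E) x φ = φ := by
  have : inChart 𝓘(ℝ, E) x φ = pull 𝓘(ℝ, E) 𝓘(ℝ, E) (fun z : E => z) φ := by
    simp only [inChart]; rfl
  rw [this, pull_id]

theorem extD_self (φ : DForm E E k V) (x : E) : extD 𝓘(ℝ, E) φ x = extDeriv φ x := by
  have h := tderiv_extChartAt_self (I := 𝓘(ℝ, E)) x
  unfold extD
  rw [h, inChart_self]
  rfl

/-- In a chart, the exterior derivative is the usual one. -/
theorem inChart_extD {φ : DForm E X k V} {x : X} (hφ : SmoothNear I φ x) :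
    inChart I x (extD I φ) =ᶠ[𝓝 (extChartAt I x x)] extDeriv (inChart I x φ) := by
  filter_upwards [(tendsto_chart_symm x).eventually hφ, eventually_mem_chart_target (I := I) x]
    with y hy hy'
  rw [← extD_self]
  exact (extD_pull (contMDiffAt_chart_symm hy') hy).symm

theorem contDiffAt_extDeriv {a : E → E [⋀^Fin k]→L[ℝ] V} {y : E} (h : ContDiffAt ℝ ∞ a y) :
    ContDiffAt ℝ ∞ (extDeriv a) y :=
  (alternatizeUncurryFinCLM ℝ E V).contDiff.contDiffAt.comp y
    (h.fderiv_right (by simp))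

theorem SmoothNear.extD {φ : DForm E X k V} {x : X} (hφ : SmoothNear I φ x) :
    SmoothNear I (extD I φ) x := by
  filter_upwards [hφ.eventually] with z hz
  exact (contDiffAt_extDeriv hz.contDiffAt).congr_of_eventuallyEq (inChart_extD hz)

theorem extD_extD {φ : DForm E X k V} {x : X} (hφ : SmoothNear I φ x) :
    TwoBundle.extD I (TwoBundle.extD I φ) x = 0 := by
  conv_lhs => unfold TwoBundle.extD
  have : extDeriv (inChart I x fun x =>
      (extDeriv (inChart I x φ) (extChartAt I x x)).compContinuousLinearMap
        (tderiv I 𝓘(ℝ, E) (extChartAt I x) x)) (extChartAt I x x) = 0 := by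
    rw [← extDeriv_extDeriv_apply hφ.contDiffAt (by simpa using two_le_infty)]
    exact (inChart_extD hφ).extDeriv_eq
  rw [this]
  rfl

end FormCalculus

/-! ### Wedge products in low degrees -/

section Wedge

variable {E E' V V₁ V₂ V₃ : Type*}
  [NormedAddCommGroup E] [NormedSpace ℝ E] [NormedAddCommGroup E'] [NormedSpace ℝ E']
  [NormedAddCommGroup V] [NormedSpace ℝ V]
  [NormedAddCommGroup V₁] [NormedSpace ℝ V₁]
  [NormedAddCommGroup V₂] [NormedSpace ℝ V₂]
  [NormedAddCommGroup V₃] [NormedSpace ℝ V₃]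
  {k l : ℕ} (K : V₁ →L[ℝ] V₂ →L[ℝ] V₃)

theorem wedgeAlt_apply (a : E [⋀^Fin k]→L[ℝ] V₁) (b : E [⋀^Fin l]→L[ℝ] V₂) (v : Fin (k + l) → E) :
    wedgeAlt K a b v = ((k.factorial * l.factorial : ℕ) : ℝ)⁻¹ •
      ∑ σ : Equiv.Perm (Fin (k + l)), Equiv.Perm.sign σ •
        K (a fun i => v (σ (Fin.castAdd l i))) (b fun j => v (σ (Fin.natAdd k j))) := by
  unfold wedgeAlt
  rw [ContinuousAlternatingMap.smul_apply, ContinuousMultilinearMap.alternatization_apply_apply]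
  rfl

theorem wedgeAlt_compContinuousLinearMap (a : E [⋀^Fin k]→L[ℝ] V₁) (b : E [⋀^Fin l]→L[ℝ] V₂)
    (L : E' →L[ℝ] E) :
    (wedgeAlt K a b).compContinuousLinearMap L =
      wedgeAlt K (a.compContinuousLinearMap L) (b.compContinuousLinearMap L) := by
  ext v
  rw [compContinuousLinearMap_apply, wedgeAlt_apply, wedgeAlt_apply]
  rfl

theorem comp_vec1 {Z : Type*} (f : Fin 1 → Z) : f = ![f 0] := by
  ext i; fin_cases i; rfl

theorem comp_vec2 {Z : Type*} (f : Fin 2 → Z) : f = ![f 0, f 1] := by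
  ext i; fin_cases i <;> rfl

theorem comp_vec3 {Z : Type*} (f : Fin 3 → Z) : f = ![f 0, f 1, f 2] := by
  ext i; fin_cases i <;> rfl

theorem comp_vec4 {Z : Type*} (f : Fin 4 → Z) : f = ![f 0, f 1, f 2, f 3] := by
  ext i; fin_cases i <;> rfl

theorem sum_perm_fin_two {Z : Type*} [AddCommMonoid Z] (f : Equiv.Perm (Fin 2) → Z) :
    ∑ σ, f σ = f 1 + f (Equiv.swap 0 1) := by
  have : (Finset.univ : Finset (Equiv.Perm (Fin 2))) = {1, Equiv.swap 0 1} := by decide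
  rw [this, Finset.sum_insert (by decide), Finset.sum_singleton]

/-- A permutation of `Fin (n + 1)` is determined by the image `p` of `0` and a permutation of
`Fin n`, which splits the sums over permutations below according to `p`. -/
theorem sum_perm_fin_succ {Z : Type*} [AddCommMonoid Z] {n : ℕ}
    (f : Equiv.Perm (Fin (n + 1)) → Z) :
    ∑ σ, f σ = ∑ p, ∑ e, f (Equiv.Perm.decomposeFin.symm (p, e)) := by
  rw [← Equiv.Perm.decomposeFin.symm.sum_comp, Fintype.sum_prod_type]

theorem sum_sign_perm_fin_two {Z : Type*} [AddCommGroup Z] (g : Fin 2 → Fin 2 → Z) :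
    ∑ σ : Equiv.Perm (Fin 2), Equiv.Perm.sign σ • g (σ 0) (σ 1) = g 0 1 - g 1 0 := by
  rw [sum_perm_fin_two]
  simp [sub_eq_add_neg]

theorem sum_sign_perm_fin_three {Z : Type*} [AddCommGroup Z] (g : Fin 3 → Fin 3 → Fin 3 → Z) :
    ∑ σ : Equiv.Perm (Fin 3), Equiv.Perm.sign σ • g (σ 0) (σ 1) (σ 2) =
      g 0 1 2 - g 0 2 1 - (g 1 0 2 - g 1 2 0) - (g 2 1 0 - g 2 0 1) := by
  have h : ∀ p : Fin 3, ∑ e : Equiv.Perm (Fin 2),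
      Equiv.Perm.sign (Equiv.Perm.decomposeFin.symm (p, e)) •
        g (Equiv.Perm.decomposeFin.symm (p, e) 0) (Equiv.Perm.decomposeFin.symm (p, e) 1)
          (Equiv.Perm.decomposeFin.symm (p, e) 2) =
      (if p = 0 then (1 : ℤˣ) else -1) •
        (g p (Equiv.swap 0 p 1) (Equiv.swap 0 p 2) -
          g p (Equiv.swap 0 p 2) (Equiv.swap 0 p 1)) := by
    intro p
    have := sum_sign_perm_fin_two fun i j => g p (Equiv.swap 0 p i.succ) (Equiv.swap 0 p j.succ)
    rw [show Equiv.swap (0 : Fin 3) p 1 = Equiv.swap 0 p (Fin.succ 0) from rfl,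
      show Equiv.swap (0 : Fin 3) p 2 = Equiv.swap 0 p (Fin.succ 1) from rfl, ← this,
      Finset.smul_sum]
    refine Finset.sum_congr rfl fun e _ => ?_
    rw [Equiv.Perm.decomposeFin.symm_sign, mul_smul,
      show (1 : Fin 3) = Fin.succ 0 from rfl, show (2 : Fin 3) = Fin.succ 1 from rfl,
      Equiv.Perm.decomposeFin_symm_apply_zero, Equiv.Perm.decomposeFin_symm_apply_succ,
      Equiv.Perm.decomposeFin_symm_apply_succ]
  rw [sum_perm_fin_succ, Finset.sum_congr rfl fun p _ => h p, Fin.sum_univ_three]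
  have e1 : Equiv.swap (0 : Fin 3) 1 2 = 2 := by decide
  have e2 : Equiv.swap (0 : Fin 3) 2 1 = 1 := by decide
  simp only [e1, e2, Equiv.swap_self, Equiv.refl_apply, Equiv.swap_apply_right, if_true, one_smul,
    Units.neg_smul, if_neg (show ¬ (1 : Fin 3) = 0 by decide),
    if_neg (show ¬ (2 : Fin 3) = 0 by decide), ← sub_eq_add_neg]

theorem sum_sign_perm_fin_four {Z : Type*} [AddCommGroup Z]
    (g : Fin 4 → Fin 4 → Fin 4 → Fin 4 → Z) :
    ∑ σ : Equiv.Perm (Fin 4), Equiv.Perm.sign σ • g (σ 0) (σ 1) (σ 2) (σ 3) =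
      (g 0 1 2 3 - g 0 1 3 2 - (g 0 2 1 3 - g 0 2 3 1) - (g 0 3 2 1 - g 0 3 1 2)) -
      (g 1 0 2 3 - g 1 0 3 2 - (g 1 2 0 3 - g 1 2 3 0) - (g 1 3 2 0 - g 1 3 0 2)) -
      (g 2 1 0 3 - g 2 1 3 0 - (g 2 0 1 3 - g 2 0 3 1) - (g 2 3 0 1 - g 2 3 1 0)) -
      (g 3 1 2 0 - g 3 1 0 2 - (g 3 2 1 0 - g 3 2 0 1) - (g 3 0 2 1 - g 3 0 1 2)) := by
  have h : ∀ p : Fin 4, ∑ e : Equiv.Perm (Fin 3),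
      Equiv.Perm.sign (Equiv.Perm.decomposeFin.symm (p, e)) •
        g (Equiv.Perm.decomposeFin.symm (p, e) 0) (Equiv.Perm.decomposeFin.symm (p, e) 1)
          (Equiv.Perm.decomposeFin.symm (p, e) 2) (Equiv.Perm.decomposeFin.symm (p, e) 3) =
      (if p = 0 then (1 : ℤˣ) else -1) • ∑ e : Equiv.Perm (Fin 3), Equiv.Perm.sign e •
        (fun i j k : Fin 3 => g p (Equiv.swap 0 p i.succ) (Equiv.swap 0 p j.succ)
          (Equiv.swap 0 p k.succ)) (e 0) (e 1) (e 2) := by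
    intro p
    rw [Finset.smul_sum]
    refine Finset.sum_congr rfl fun e _ => ?_
    rw [Equiv.Perm.decomposeFin.symm_sign, mul_smul,
      show (1 : Fin 4) = Fin.succ 0 from rfl, show (2 : Fin 4) = Fin.succ 1 from rfl,
      show (3 : Fin 4) = Fin.succ 2 from rfl,
      Equiv.Perm.decomposeFin_symm_apply_zero, Equiv.Perm.decomposeFin_symm_apply_succ,
      Equiv.Perm.decomposeFin_symm_apply_succ, Equiv.Perm.decomposeFin_symm_apply_succ]
  rw [sum_perm_fin_succ, Finset.sum_congr rfl fun p _ => (h p).trans (congrArg _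
      (sum_sign_perm_fin_three fun i j k =>
        g p (Equiv.swap 0 p i.succ) (Equiv.swap 0 p j.succ) (Equiv.swap 0 p k.succ))),
    Fin.sum_univ_four]
  have s1 : Fin.succ (0 : Fin 3) = 1 := rfl
  have s2 : Fin.succ (1 : Fin 3) = 2 := rfl
  have s3 : Fin.succ (2 : Fin 3) = 3 := rfl
  have e1 : Equiv.swap (0 : Fin 4) 1 2 = 2 := by decide
  have e2 : Equiv.swap (0 : Fin 4) 1 3 = 3 := by decide
  have e3 : Equiv.swap (0 : Fin 4) 2 1 = 1 := by decide
  have e4 : Equiv.swap (0 : Fin 4) 2 3 = 3 := by decide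
  have e5 : Equiv.swap (0 : Fin 4) 3 1 = 1 := by decide
  have e6 : Equiv.swap (0 : Fin 4) 3 2 = 2 := by decide
  simp only [s1, s2, s3, e1, e2, e3, e4, e5, e6, Equiv.swap_self, Equiv.refl_apply,
    Equiv.swap_apply_right, if_true, one_smul, Units.neg_smul,
    if_neg (show ¬ (1 : Fin 4) = 0 by decide), if_neg (show ¬ (2 : Fin 4) = 0 by decide),
    if_neg (show ¬ (3 : Fin 4) = 0 by decide), ← sub_eq_add_neg]

theorem alt2_swap (a : E [⋀^Fin 2]→L[ℝ] V) (u v : E) : a ![u, v] = - a ![v, u] := by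
  have : a ![u, v] = a (![v, u] ∘ Equiv.swap 0 1) := by
    congr 1; ext i; fin_cases i <;> rfl
  rw [this, ← coe_toAlternatingMap, a.toAlternatingMap.map_swap _ (by decide)]

theorem wedgeAlt_one_one (a : E [⋀^Fin 1]→L[ℝ] V₁) (b : E [⋀^Fin 1]→L[ℝ] V₂) (u v : E) :
    wedgeAlt K a b ![u, v] = K (a ![u]) (b ![v]) - K (a ![v]) (b ![u]) := by
  have h := sum_sign_perm_fin_two fun i j => K (a ![![u, v] i]) (b ![![u, v] j])
  rw [wedgeAlt_apply]
  have h2 := fun f : Fin 1 → E => congrArg a (comp_vec1 f)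
  have h1 := fun f : Fin 1 → E => congrArg b (comp_vec1 f)
  refine (congrArg _ (Finset.sum_congr rfl fun σ _ => ?_)).trans ((congrArg _ h).trans ?_)
  · rw [h2, h1]; rfl
  simp

theorem wedgeAlt_two_one (a : E [⋀^Fin 2]→L[ℝ] V₁) (b : E [⋀^Fin 1]→L[ℝ] V₂) (u v w : E) :
    wedgeAlt K a b ![u, v, w] =
      K (a ![u, v]) (b ![w]) - K (a ![u, w]) (b ![v]) + K (a ![v, w]) (b ![u]) := by
  have h := sum_sign_perm_fin_three fun i j k =>
    K (a ![![u, v, w] i, ![u, v, w] j]) (b ![![u, v, w] k])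
  rw [wedgeAlt_apply]
  have h2 := fun f : Fin 2 → E => congrArg a (comp_vec2 f)
  have h1 := fun f : Fin 1 → E => congrArg b (comp_vec1 f)
  refine (congrArg _ (Finset.sum_congr rfl fun σ _ => ?_)).trans ((congrArg _ h).trans ?_)
  · rw [h2, h1]; rfl
  simp [alt2_swap a v u, alt2_swap a w u, alt2_swap a w v]
  module

theorem wedgeAlt_one_two (a : E [⋀^Fin 1]→L[ℝ] V₁) (b : E [⋀^Fin 2]→L[ℝ] V₂) (u v w : E) :
    wedgeAlt K a b ![u, v, w] =
      K (a ![u]) (b ![v, w]) - K (a ![v]) (b ![u, w]) + K (a ![w]) (b ![u, v]) := by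
  have h := sum_sign_perm_fin_three fun i j k =>
    K (a ![![u, v, w] i]) (b ![![u, v, w] j, ![u, v, w] k])
  rw [wedgeAlt_apply]
  have h2 := fun f : Fin 2 → E => congrArg b (comp_vec2 f)
  have h1 := fun f : Fin 1 → E => congrArg a (comp_vec1 f)
  refine (congrArg _ (Finset.sum_congr rfl fun σ _ => ?_)).trans ((congrArg _ h).trans ?_)
  · rw [h2, h1]; rfl
  simp [alt2_swap b v u, alt2_swap b w u, alt2_swap b w v]
  module

theorem wedgeAlt_two_two (a : E [⋀^Fin 2]→L[ℝ] V₁) (b : E [⋀^Fin 2]→L[ℝ] V₂) (t u v w : E) :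
    wedgeAlt K a b ![t, u, v, w] =
      K (a ![t, u]) (b ![v, w]) - K (a ![t, v]) (b ![u, w]) + K (a ![t, w]) (b ![u, v]) +
      K (a ![u, v]) (b ![t, w]) - K (a ![u, w]) (b ![t, v]) + K (a ![v, w]) (b ![t, u]) := by
  have h := sum_sign_perm_fin_four fun i j k l =>
    K (a ![![t, u, v, w] i, ![t, u, v, w] j]) (b ![![t, u, v, w] k, ![t, u, v, w] l])
  rw [wedgeAlt_apply]
  have h2 := fun f : Fin 2 → E => congrArg a (comp_vec2 f)
  have h1 := fun f : Fin 2 → E => congrArg b (comp_vec2 f)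
  refine (congrArg _ (Finset.sum_congr rfl fun σ _ => ?_)).trans ((congrArg _ h).trans ?_)
  · rw [h2, h1]; rfl
  simp [alt2_swap a u t, alt2_swap a v t, alt2_swap a v u, alt2_swap a w t, alt2_swap a w u,
    alt2_swap a w v, alt2_swap b u t, alt2_swap b v t, alt2_swap b v u, alt2_swap b w t,
    alt2_swap b w u, alt2_swap b w v]
  module

theorem contDiffAt_wedgeAlt [FiniteDimensional ℝ E] [FiniteDimensional ℝ V₃] {n : WithTop ℕ∞}
    {a : E' → E [⋀^Fin k]→L[ℝ] V₁} {b : E' → E [⋀^Fin l]→L[ℝ] V₂} {y : E'}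
    (ha : ContDiffAt ℝ n a y) (hb : ContDiffAt ℝ n b y) :
    ContDiffAt ℝ n (fun z => wedgeAlt K (a z) (b z)) y := by
  rw [contDiffAt_alternating_iff]
  intro v
  simp only [wedgeAlt_apply]
  refine ContDiffAt.const_smul _ (ContDiffAt.sum fun σ _ => ?_)
  have h1 := (ContinuousAlternatingMap.apply ℝ E V₁
    fun i => v (σ (Fin.castAdd l i))).contDiff.contDiffAt.comp y ha
  have h2 := (ContinuousAlternatingMap.apply ℝ E V₂
    fun i => v (σ (Fin.natAdd k i))).contDiff.contDiffAt.comp y hb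
  have h3 := (K.contDiff.contDiffAt.comp y h1).clm_apply h2
  exact h3.const_smul (((Equiv.Perm.sign σ : ℤˣ) : ℤ) : ℝ) |>.congr_of_eventuallyEq
    (Eventually.of_forall fun z => by
      simpa [Units.smul_def] using (Int.cast_smul_eq_zsmul ℝ _ _).symm)

end Wedge

/-! ### The Leibniz rule in low degrees -/

section FlatLeibniz

variable {E E' V V₁ V₂ V₃ : Type*}
  [NormedAddCommGroup E] [NormedSpace ℝ E] [NormedAddCommGroup E'] [NormedSpace ℝ E']
  [NormedAddCommGroup V] [NormedSpace ℝ V]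
  [NormedAddCommGroup V₁] [NormedSpace ℝ V₁]
  [NormedAddCommGroup V₂] [NormedSpace ℝ V₂]
  [NormedAddCommGroup V₃] [NormedSpace ℝ V₃]
  {k l : ℕ} (K : V₁ →L[ℝ] V₂ →L[ℝ] V₃)

theorem fderiv_wedgeAlt [FiniteDimensional ℝ E] [FiniteDimensional ℝ V₃]
    {a : E' → E [⋀^Fin k]→L[ℝ] V₁} {b : E' → E [⋀^Fin l]→L[ℝ] V₂} {y : E'}
    (ha : ContDiffAt ℝ ∞ a y) (hb : ContDiffAt ℝ ∞ b y) (t : E') :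
    fderiv ℝ (fun z => wedgeAlt K (a z) (b z)) y t =
      wedgeAlt K (fderiv ℝ a y t) (b y) + wedgeAlt K (a y) (fderiv ℝ b y t) := by
  ext v
  have hd := (contDiffAt_wedgeAlt K ha hb).differentiableAt (by simp)
  rw [← fderiv_continuousAlternatingMap_apply_const_apply hd]
  have h : ∀ σ : Equiv.Perm (Fin (k + l)), HasFDerivAt
      (fun z => Equiv.Perm.sign σ • K (a z fun i => v (σ (Fin.castAdd l i)))
        (b z fun j => v (σ (Fin.natAdd k j)))) _ y := fun σ => by
    have h1 := (ContinuousAlternatingMap.apply ℝ E V₁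
      fun i => v (σ (Fin.castAdd l i))).hasFDerivAt.comp y
        (ha.differentiableAt (by simp)).hasFDerivAt
    have h2 := (ContinuousAlternatingMap.apply ℝ E V₂
      fun i => v (σ (Fin.natAdd k i))).hasFDerivAt.comp y
        (hb.differentiableAt (by simp)).hasFDerivAt
    refine ((K.hasFDerivAt_of_bilinear h1 h2).const_smul
      (((Equiv.Perm.sign σ : ℤˣ) : ℤ) : ℝ)).congr_of_eventuallyEq
      (Eventually.of_forall fun z => ?_)
    simpa [Units.smul_def] using (Int.cast_smul_eq_zsmul ℝ _ _).symm
  have h' := (HasFDerivAt.fun_sum fun σ (_ : σ ∈ Finset.univ) => h σ).const_smul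
    ((k.factorial * l.factorial : ℕ) : ℝ)⁻¹
  have e : (fun z => wedgeAlt K (a z) (b z) v) = fun z =>
      ((k.factorial * l.factorial : ℕ) : ℝ)⁻¹ • ∑ σ : Equiv.Perm (Fin (k + l)),
        Equiv.Perm.sign σ • K (a z fun i => v (σ (Fin.castAdd l i)))
        (b z fun j => v (σ (Fin.natAdd k j))) := funext fun z => wedgeAlt_apply _ _ _ _
  rw [e]
  refine (DFunLike.congr_fun (HasFDerivAt.fderiv h') t).trans ?_
  simp only [ContinuousAlternatingMap.add_apply, wedgeAlt_apply, ← smul_add,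
    ← Finset.sum_add_distrib, _root_.smul_apply, _root_.sum_apply]
  congr 1
  refine Finset.sum_congr rfl fun σ _ => ?_
  simp [Units.smul_def, Int.cast_smul_eq_zsmul, add_comm]

theorem extDeriv_apply_two (a : E → E [⋀^Fin 1]→L[ℝ] V) (y u v : E) :
    extDeriv a y ![u, v] = fderiv ℝ a y u ![v] - fderiv ℝ a y v ![u] := by
  rw [extDeriv, alternatizeUncurryFin_apply, Fin.sum_univ_two,
    comp_vec1 (Fin.removeNth (0 : Fin 2) ![u, v]), comp_vec1 (Fin.removeNth (1 : Fin 2) ![u, v])]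
  simp [Fin.removeNth, sub_eq_add_neg]

theorem extDeriv_apply_three (a : E → E [⋀^Fin 2]→L[ℝ] V) (y u v w : E) :
    extDeriv a y ![u, v, w] =
      fderiv ℝ a y u ![v, w] - fderiv ℝ a y v ![u, w] + fderiv ℝ a y w ![u, v] := by
  have e0 : Fin.removeNth (0 : Fin 3) ![u, v, w] = ![v, w] := by ext i; fin_cases i <;> rfl
  have e1 : Fin.removeNth (1 : Fin 3) ![u, v, w] = ![u, w] := by ext i; fin_cases i <;> rfl
  have e2 : Fin.removeNth (2 : Fin 3) ![u, v, w] = ![u, v] := by ext i; fin_cases i <;> rfl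
  rw [extDeriv, alternatizeUncurryFin_apply, Fin.sum_univ_three, e0, e1, e2]
  simp [sub_eq_add_neg]

theorem extDeriv_apply_four (a : E → E [⋀^Fin 3]→L[ℝ] V) (y t u v w : E) :
    extDeriv a y ![t, u, v, w] =
      fderiv ℝ a y t ![u, v, w] - fderiv ℝ a y u ![t, v, w] + fderiv ℝ a y v ![t, u, w] -
        fderiv ℝ a y w ![t, u, v] := by
  have e0 : Fin.removeNth (0 : Fin 4) ![t, u, v, w] = ![u, v, w] := by
    ext i; fin_cases i <;> rfl
  have e1 : Fin.removeNth (1 : Fin 4) ![t, u, v, w] = ![t, v, w] := by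
    ext i; fin_cases i <;> rfl
  have e2 : Fin.removeNth (2 : Fin 4) ![t, u, v, w] = ![t, u, w] := by
    ext i; fin_cases i <;> rfl
  have e3 : Fin.removeNth (3 : Fin 4) ![t, u, v, w] = ![t, u, v] := by
    ext i; fin_cases i <;> rfl
  rw [extDeriv, alternatizeUncurryFin_apply, Fin.sum_univ_four, e0, e1, e2, e3]
  simp [sub_eq_add_neg, pow_succ]

end FlatLeibniz

section Leibniz

variable {E H V V₁ V₂ V₃ : Type*}
  [NormedAddCommGroup E] [NormedSpace ℝ E] [TopologicalSpace H]
  [NormedAddCommGroup V] [NormedSpace ℝ V]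
  [NormedAddCommGroup V₁] [NormedSpace ℝ V₁]
  [NormedAddCommGroup V₂] [NormedSpace ℝ V₂]
  [NormedAddCommGroup V₃] [NormedSpace ℝ V₃]
  {I : ModelWithCorners ℝ E H} {X : Type*} [TopologicalSpace X] [ChartedSpace H X]
  {k l : ℕ} (K : V₁ →L[ℝ] V₂ →L[ℝ] V₃)

theorem pull_wedge {E' H' X' : Type*} [NormedAddCommGroup E'] [NormedSpace ℝ E']
    [TopologicalSpace H'] {I' : ModelWithCorners ℝ E' H'} [TopologicalSpace X']
    [ChartedSpace H' X'] (f : X → X') (α : DForm E' X' k V₁) (β : DForm E' X' l V₂) :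
    pull I I' f (wedge K α β) = wedge K (pull I I' f α) (pull I I' f β) :=
  funext fun _ => wedgeAlt_compContinuousLinearMap K _ _ _

theorem inChart_wedge (x : X) (α : DForm E X k V₁) (β : DForm E X l V₂) :
    inChart I x (wedge K α β) = fun y => wedgeAlt K (inChart I x α y) (inChart I x β y) :=
  pull_wedge K _ α β

theorem SmoothNear.wedge [FiniteDimensional ℝ E] [FiniteDimensional ℝ V₃] {α : DForm E X k V₁}
    {β : DForm E X l V₂} {x : X} (hα : SmoothNear I α x) (hβ : SmoothNear I β x) :
    SmoothNear I (wedge K α β) x := by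
  filter_upwards [hα, hβ] with z h1 h2
  rw [inChart_wedge]
  exact contDiffAt_wedgeAlt K h1 h2

variable [IsManifold I ∞ X]

theorem extD_apply_self (φ : DForm E X k V) (x : X) :
    extD I φ x = extDeriv (inChart I x φ) (extChartAt I x x) := by
  have : IsManifold I 1 X := IsManifold.of_le (n := ∞) (by simp)
  unfold extD
  rw [tderiv_extChartAt_self]
  rfl

variable [I.Boundaryless]

/-- The tangent space at `x` is identified with `E` by the preferred chart at `x`, so that chart has
the identity as its derivative there. -/
theorem tderiv_chart_symm_self (x : X) :
    tderiv 𝓘(ℝ, E) I (extChartAt I x).symm (extChartAt I x x) = ContinuousLinearMap.id ℝ E := by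
  have : IsManifold I 1 X := IsManifold.of_le (n := ∞) (by simp)
  have h := mfderivWithin_range_extChartAt_symm (I := I) (x := x)
  rwa [I.range_eq_univ, mfderivWithin_univ] at h

theorem inChart_apply_self (φ : DForm E X k V) (x : X) :
    inChart I x φ (extChartAt I x x) = φ x := by
  unfold inChart pull
  rw [tderiv_chart_symm_self, extChartAt_to_inv]
  rfl

variable [FiniteDimensional ℝ E] [FiniteDimensional ℝ V₃]

theorem extD_wedge_one_one {α : DForm E X 1 V₁} {β : DForm E X 1 V₂} {x : X}
    (hα : SmoothNear I α x) (hβ : SmoothNear I β x) (u v w : E) :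
    (extD I (wedge K α β) x : E [⋀^Fin 3]→L[ℝ] V₃) ![u, v, w] =
      K (extD I α x ![u, v]) (β x ![w]) - K (extD I α x ![u, w]) (β x ![v]) +
        K (extD I α x ![v, w]) (β x ![u]) -
      (K (α x ![u]) (extD I β x ![v, w]) - K (α x ![v]) (extD I β x ![u, w]) +
        K (α x ![w]) (extD I β x ![u, v])) := by
  simp only [extD_apply_self, ← inChart_apply_self (I := I) α x,
    ← inChart_apply_self (I := I) β x, inChart_wedge]
  rw [extDeriv_apply_three]
  simp only [extDeriv_apply_two, fderiv_wedgeAlt K hα.contDiffAt hβ.contDiffAt,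
    ContinuousAlternatingMap.add_apply, wedgeAlt_one_one, map_sub, _root_.sub_apply]
  abel

theorem extD_wedge_two_one {α : DForm E X 2 V₁} {β : DForm E X 1 V₂} {x : X}
    (hα : SmoothNear I α x) (hβ : SmoothNear I β x) (t u v w : E) :
    (extD I (wedge K α β) x : E [⋀^Fin 4]→L[ℝ] V₃) ![t, u, v, w] =
      K (extD I α x ![t, u, v]) (β x ![w]) - K (extD I α x ![t, u, w]) (β x ![v]) +
        K (extD I α x ![t, v, w]) (β x ![u]) - K (extD I α x ![u, v, w]) (β x ![t]) +
      (K (α x ![t, u]) (extD I β x ![v, w]) - K (α x ![t, v]) (extD I β x ![u, w]) +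
        K (α x ![t, w]) (extD I β x ![u, v]) + K (α x ![u, v]) (extD I β x ![t, w]) -
        K (α x ![u, w]) (extD I β x ![t, v]) + K (α x ![v, w]) (extD I β x ![t, u])) := by
  simp only [extD_apply_self, ← inChart_apply_self (I := I) α x,
    ← inChart_apply_self (I := I) β x, inChart_wedge]
  rw [extDeriv_apply_four]
  simp only [extDeriv_apply_two, extDeriv_apply_three,
    fderiv_wedgeAlt K hα.contDiffAt hβ.contDiffAt,
    ContinuousAlternatingMap.add_apply, wedgeAlt_two_one, map_sub, map_add, _root_.sub_apply,
    _root_.add_apply]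
  abel

theorem extD_wedge_one_two {α : DForm E X 1 V₁} {β : DForm E X 2 V₂} {x : X}
    (hα : SmoothNear I α x) (hβ : SmoothNear I β x) (t u v w : E) :
    (extD I (wedge K α β) x : E [⋀^Fin 4]→L[ℝ] V₃) ![t, u, v, w] =
      (K (extD I α x ![t, u]) (β x ![v, w]) - K (extD I α x ![t, v]) (β x ![u, w]) +
        K (extD I α x ![t, w]) (β x ![u, v]) + K (extD I α x ![u, v]) (β x ![t, w]) -
        K (extD I α x ![u, w]) (β x ![t, v]) + K (extD I α x ![v, w]) (β x ![t, u])) -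
      (K (α x ![t]) (extD I β x ![u, v, w]) - K (α x ![u]) (extD I β x ![t, v, w]) +
        K (α x ![v]) (extD I β x ![t, u, w]) - K (α x ![w]) (extD I β x ![t, u, v])) := by
  simp only [extD_apply_self, ← inChart_apply_self (I := I) α x,
    ← inChart_apply_self (I := I) β x, inChart_wedge]
  rw [extDeriv_apply_four]
  simp only [extDeriv_apply_two, extDeriv_apply_three,
    fderiv_wedgeAlt K hα.contDiffAt hβ.contDiffAt,
    ContinuousAlternatingMap.add_apply, wedgeAlt_one_two, map_sub, map_add, _root_.sub_apply]
  abel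

/-- The Leibniz rule for the product of an operator-valued function and a 1-form. -/
theorem extD_clm_comp {f : X → V₁ →L[ℝ] V₃} {α : DForm E X 1 V₁} {x : X}
    (hf : ContMDiffAt I 𝓘(ℝ, V₁ →L[ℝ] V₃) ∞ f x) (hα : SmoothNear I α x) (u v : E) :
    (extD I (fun z => (f z).compContinuousAlternatingMap (α z)) x : E [⋀^Fin 2]→L[ℝ] V₃) ![u, v] =
      f x (extD I α x ![u, v]) + tderiv I 𝓘(ℝ, V₁ →L[ℝ] V₃) f x u (α x ![v]) -
        tderiv I 𝓘(ℝ, V₁ →L[ℝ] V₃) f x v (α x ![u]) := by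
  set g : E → V₁ →L[ℝ] V₃ := fun y => f ((extChartAt I x).symm y)
  have hx : (extChartAt I x).symm (extChartAt I x x) = x := extChartAt_to_inv x
  have hg : ContDiffAt ℝ ∞ g (extChartAt I x x) := by
    rw [← contMDiffAt_iff_contDiffAt]
    exact ContMDiffAt.comp _ (by rwa [hx]) (contMDiffAt_chart_symm (mem_extChartAt_target x))
  have hg' : fderiv ℝ g (extChartAt I x x) = tderiv I 𝓘(ℝ, V₁ →L[ℝ] V₃) f x := by
    have := tderiv_comp (I := 𝓘(ℝ, E)) (I' := I) (I'' := 𝓘(ℝ, V₁ →L[ℝ] V₃)) (g := f)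
      (f := (extChartAt I x).symm) (x := extChartAt I x x)
      (by rw [hx]; exact hf.mdifferentiableAt (by simp))
      (mdiff_chart_symm (mem_extChartAt_target x))
    rw [tderiv_eq_fderiv, tderiv_chart_symm_self, hx] at this
    exact this
  have e : inChart I x (fun z => (f z).compContinuousAlternatingMap (α z)) =
      fun y => (g y).compContinuousAlternatingMap (inChart I x α y) := rfl
  have hfd : ∀ s m : E, fderiv ℝ (fun y => (g y).compContinuousAlternatingMap (inChart I x α y))
      (extChartAt I x x) s ![m] = g (extChartAt I x x)
        (fderiv ℝ (inChart I x α) (extChartAt I x x) s ![m]) +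
      fderiv ℝ g (extChartAt I x x) s (inChart I x α (extChartAt I x x) ![m]) := by
    intro s m
    have hc : ∀ m, ContDiffAt ℝ ∞ (fun y => g y (inChart I x α y m)) (extChartAt I x x) :=
      fun m => hg.clm_apply ((ContinuousAlternatingMap.apply ℝ E V₁ m).contDiff.contDiffAt.comp _
        hα.contDiffAt)
    have hd : DifferentiableAt ℝ (fun y => (g y).compContinuousAlternatingMap (inChart I x α y))
        (extChartAt I x x) :=
      (contDiffAt_alternating_iff.2 hc).differentiableAt (by simp)
    have ha := hα.contDiffAt.differentiableAt (by simp)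
    rw [← fderiv_continuousAlternatingMap_apply_const_apply hd,
      ← fderiv_continuousAlternatingMap_apply_const_apply ha]
    have h2 := (ContinuousAlternatingMap.apply ℝ E V₁ ![m]).differentiableAt.comp _ ha
    change fderiv ℝ (fun y => g y (inChart I x α y ![m])) _ s = _
    have := fderiv_clm_apply (hg.differentiableAt (by simp)) h2
    refine (DFunLike.congr_fun this s).trans ?_
    simp
    rfl
  simp only [extD_apply_self, ← inChart_apply_self (I := I) α x]
  rw [e, extDeriv_apply_two, hfd, hfd, extDeriv_apply_two, hg', map_sub,
    show g (extChartAt I x x) = f x from congrArg f hx]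
  abel

end Leibniz

/-! ### Maurer-Cartan forms and the adjoint action -/

theorem tderiv_prod_apply {E' H' E'' H'' X X' X'' H : Type*} {E₀ : Type*}
    [NormedAddCommGroup E₀] [NormedSpace ℝ E₀] [TopologicalSpace H]
    [NormedAddCommGroup E'] [NormedSpace ℝ E'] [TopologicalSpace H']
    [NormedAddCommGroup E''] [NormedSpace ℝ E''] [TopologicalSpace H'']
    {I : ModelWithCorners ℝ E₀ H} {I' : ModelWithCorners ℝ E' H'}
    {I'' : ModelWithCorners ℝ E'' H''}
    [TopologicalSpace X] [ChartedSpace H X] [TopologicalSpace X'] [ChartedSpace H' X']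
    [TopologicalSpace X''] [ChartedSpace H'' X'']
    {f : X × X' → X''} {p : X × X'} (hf : MDifferentiableAt (I.prod I') I'' f p) (v : E₀ × E') :
    tderiv (I.prod I') I'' f p v =
      tderiv I I'' (fun z => f (z, p.2)) p.1 v.1 + tderiv I' I'' (fun z => f (p.1, z)) p.2 v.2 :=
  mfderiv_prod_eq_add_apply (v := v) hf

section LieGroupForms

variable {E : Type*} [NormedAddCommGroup E] [NormedSpace ℝ E]
  {G : Type*} [TopologicalSpace G] [ChartedSpace E G] [Group G]

theorem thetaL_apply (g : G) (v : Fin 1 → E) :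
    thetaL E G g v = tderiv 𝓘(ℝ, E) 𝓘(ℝ, E) (fun h : G => g⁻¹ * h) g (v 0) := rfl

theorem thetaR_apply (g : G) (v : Fin 1 → E) :
    thetaR E G g v = tderiv 𝓘(ℝ, E) 𝓘(ℝ, E) (fun h : G => h * g⁻¹) g (v 0) := rfl

theorem Ad_one : (Ad (1 : G) : E →L[ℝ] E) = ContinuousLinearMap.id ℝ E := by
  unfold Ad
  simp only [one_mul, inv_one, mul_one]
  exact tderiv_id 1

theorem thetaL_one (v : E) : thetaL E G 1 ![v] = v := by
  rw [thetaL_apply]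
  simp only [inv_one, one_mul]
  rw [tderiv_id]
  rfl

variable [LieGroup 𝓘(ℝ, E) ∞ G]

theorem mdiff_mul_left (g x : G) : MDifferentiableAt 𝓘(ℝ, E) 𝓘(ℝ, E) (fun h : G => g * h) x :=
  (contMDiff_mul_left (n := ∞)).mdifferentiable (by simp) x

theorem mdiff_mul_right (g x : G) : MDifferentiableAt 𝓘(ℝ, E) 𝓘(ℝ, E) (fun h : G => h * g) x :=
  (contMDiff_mul_right (n := ∞)).mdifferentiable (by simp) x

theorem mdiff_conj (g x : G) :
    MDifferentiableAt 𝓘(ℝ, E) 𝓘(ℝ, E) (fun h : G => g * h * g⁻¹) x :=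
  (mdiff_mul_right g⁻¹ (g * x)).comp x (mdiff_mul_left g x)

theorem Ad_mul (g h : G) : (Ad (g * h) : E →L[ℝ] E) = (Ad g).comp (Ad h) := by
  unfold Ad
  have h1 := tderiv_comp (x := (1 : G)) (g := fun x : G => g * x * g⁻¹)
    (f := fun x : G => h * x * h⁻¹) (mdiff_conj (E := E) g _) (mdiff_conj h 1)
  rw [mul_one, mul_inv_cancel] at h1
  rw [← h1]
  congr 1
  ext x
  simp [mul_assoc]

theorem Ad_inv_Ad (g : G) (v : E) : Ad g⁻¹ (Ad g v) = v := by
  have := DFunLike.congr_fun (Ad_mul (E := E) g⁻¹ g) v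
  rw [inv_mul_cancel, Ad_one] at this
  exact this.symm

theorem Ad_Ad_inv (g : G) (v : E) : Ad g (Ad g⁻¹ v) = v := by
  have := DFunLike.congr_fun (Ad_mul (E := E) g g⁻¹) v
  rw [mul_inv_cancel, Ad_one] at this
  exact this.symm

theorem thetaR_eq (g : G) (v : E) : thetaR E G g ![v] = Ad g (thetaL E G g ![v]) := by
  rw [thetaL_apply, thetaR_apply]
  have h1 := tderiv_comp (x := g) (g := fun x : G => g * x * g⁻¹)
    (f := fun x : G => g⁻¹ * x) (mdiff_conj (E := E) g _) (mdiff_mul_left g⁻¹ g)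
  rw [inv_mul_cancel] at h1
  have e : (fun x : G => g * x * g⁻¹) ∘ (fun x : G => g⁻¹ * x) = fun x => x * g⁻¹ := by
    ext x; simp
  rw [e] at h1
  rw [h1]
  rfl

/-- Left translation from `1` to `g` is inverse to `θ^L`. -/
theorem thetaL_mul_left (g : G) (v : E) :
    thetaL E G g ![tderiv 𝓘(ℝ, E) 𝓘(ℝ, E) (fun h : G => g * h) 1 v] = v := by
  rw [thetaL_apply]
  have h1 := tderiv_comp (x := (1 : G)) (g := fun x : G => g⁻¹ * x)
    (f := fun x : G => g * x) (mdiff_mul_left (E := E) g⁻¹ _) (mdiff_mul_left g 1)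
  have e : (fun x : G => g⁻¹ * x) ∘ (fun x : G => g * x) = fun x => x := by
    ext x; simp
  rw [e, tderiv_id, mul_one] at h1
  exact (DFunLike.congr_fun h1 v).symm

theorem contMDiff_mul_prod :
    ContMDiff (𝓘(ℝ, E).prod 𝓘(ℝ, E)) 𝓘(ℝ, E) ∞ (fun x : G × G => x.1 * x.2) :=
  contMDiff_mul 𝓘(ℝ, E) ∞

/-- The Maurer-Cartan form is equivariant like a connection form:
`mult^* θ^L = Ad(h⁻¹) g^* θ^L + h^* θ^L` on `G × G`. -/
theorem pull_mul_thetaL (x : G × G) :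
    pull (𝓘(ℝ, E).prod 𝓘(ℝ, E)) 𝓘(ℝ, E) (fun x : G × G => x.1 * x.2) (thetaL E G) x =
      (Ad x.2⁻¹).compContinuousAlternatingMap
        (pull (𝓘(ℝ, E).prod 𝓘(ℝ, E)) 𝓘(ℝ, E) Prod.fst (thetaL E G) x) +
      pull (𝓘(ℝ, E).prod 𝓘(ℝ, E)) 𝓘(ℝ, E) Prod.snd (thetaL E G) x := by
  obtain ⟨g, h⟩ := x
  ext v
  rw [comp_vec1 v, ContinuousAlternatingMap.add_apply,
    ContinuousLinearMap.compContinuousAlternatingMap_coe, Function.comp_apply, pull_apply_one,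
    pull_apply_one, pull_apply_one, tderiv_prod_apply
      (contMDiff_mul_prod.mdifferentiable (by simp) _), tderiv_fst, tderiv_snd]
  simp only [thetaL_apply, Matrix.cons_val_fin_one, map_add]
  set u := v 0
  congr 1
  · have h1 := tderiv_comp (x := g) (g := fun x : G => (g * h)⁻¹ * x)
      (f := fun x : G => x * h) (mdiff_mul_left (E := E) _ _) (mdiff_mul_right h g)
    have h2 := tderiv_comp (x := g) (g := fun x : G => h⁻¹ * x * h⁻¹⁻¹)
      (f := fun x : G => g⁻¹ * x) (mdiff_conj (E := E) _ _) (mdiff_mul_left _ g)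
    have e : (fun x : G => (g * h)⁻¹ * x) ∘ (fun x : G => x * h) =
        (fun x : G => h⁻¹ * x * h⁻¹⁻¹) ∘ (fun x : G => g⁻¹ * x) := by
      ext x; simp [mul_assoc]
    rw [e, h2, inv_mul_cancel] at h1
    exact (DFunLike.congr_fun h1 u.1).symm
  · have h1 := tderiv_comp (x := h) (g := fun x : G => (g * h)⁻¹ * x)
      (f := fun x : G => g * x) (mdiff_mul_left (E := E) _ _) (mdiff_mul_left g h)
    have e : (fun x : G => (g * h)⁻¹ * x) ∘ (fun x : G => g * x) = fun x : G => h⁻¹ * x := by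
      ext x; simp [mul_assoc]
    rw [e] at h1
    exact (DFunLike.congr_fun h1 u.2).symm

theorem pull_mul_left_thetaL (a : G) :
    pull 𝓘(ℝ, E) 𝓘(ℝ, E) (fun h : G => a * h) (thetaL E G) = thetaL E G := by
  ext g v
  rw [pull_apply, thetaL_apply, thetaL_apply]
  have h1 := tderiv_comp (x := g) (g := fun x : G => (a * g)⁻¹ * x)
    (f := fun x : G => a * x) (mdiff_mul_left (E := E) _ _) (mdiff_mul_left a g)
  have e : (fun x : G => (a * g)⁻¹ * x) ∘ (fun x : G => a * x) = fun x : G => g⁻¹ * x := by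
    ext x; simp [mul_assoc]
  rw [e] at h1
  exact (DFunLike.congr_fun h1 (v 0)).symm

/-- The derivative of a map into a manifold is the derivative of its expression in the preferred
chart at the image point. -/
theorem fderiv_chart_comp {E' : Type*} [NormedAddCommGroup E'] [NormedSpace ℝ E'] {f : E' → G}
    {y : E'} (hf : MDifferentiableAt 𝓘(ℝ, E') 𝓘(ℝ, E) f y) {c : G} (hc : f y = c) :
    fderiv ℝ (fun z => extChartAt 𝓘(ℝ, E) c (f z)) y = tderiv 𝓘(ℝ, E') 𝓘(ℝ, E) f y := by
  subst hc
  have : IsManifold 𝓘(ℝ, E) 1 G := IsManifold.of_le (n := ∞) (by simp)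
  have h := tderiv_comp (g := extChartAt 𝓘(ℝ, E) (f y)) (f := f) (x := y)
    (mdiff_chart (mem_extChartAt_source _)) hf
  rw [tderiv_extChartAt_self, tderiv_eq_fderiv] at h
  exact h

theorem contMDiff_Ad : ContMDiff 𝓘(ℝ, E) 𝓘(ℝ, E →L[ℝ] E) ∞ (Ad : G → E →L[ℝ] E) := by
  intro g
  set e := extChartAt 𝓘(ℝ, E) g
  set c := extChartAt 𝓘(ℝ, E) (1 : G)
  have hs := contMDiffAt_chart_symm (mem_extChartAt_target (I := 𝓘(ℝ, E)) g)
  have hs1 := contMDiffAt_chart_symm (mem_extChartAt_target (I := 𝓘(ℝ, E)) (1 : G))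
  have hc1 : c.symm (c 1) = 1 := extChartAt_to_inv _
  have h1 : ContDiffAt ℝ ∞ (Function.uncurry fun y z : E =>
      c (e.symm y * c.symm z * (e.symm y)⁻¹)) (e g, c 1) := by
    rw [← contMDiffAt_iff_contDiffAt]
    have h2 : ContMDiffAt 𝓘(ℝ, E × E) 𝓘(ℝ, E) ∞
        (fun p : E × E => e.symm p.1 * c.symm p.2 * (e.symm p.1)⁻¹) (e g, c 1) := by
      have ha : ContMDiffAt 𝓘(ℝ, E × E) 𝓘(ℝ, E) ∞ (fun p : E × E => e.symm p.1) (e g, c 1) :=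
        ContMDiffAt.comp (e g, c 1) (f := fun p : E × E => p.1) hs
          contDiff_fst.contDiffAt.contMDiffAt
      have hb : ContMDiffAt 𝓘(ℝ, E × E) 𝓘(ℝ, E) ∞ (fun p : E × E => c.symm p.2) (e g, c 1) :=
        ContMDiffAt.comp (e g, c 1) (f := fun p : E × E => p.2) hs1
          contDiff_snd.contDiffAt.contMDiffAt
      exact (ha.mul hb).mul ha.inv
    refine ContMDiffAt.comp (e g, c 1) (contMDiffAt_chart ?_) h2
    change e.symm (e g) * c.symm (c 1) * (e.symm (e g))⁻¹ ∈ _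
    rw [hc1, mul_one, mul_inv_cancel]
    exact mem_extChartAt_source _
  have h3 : ContDiffAt ℝ ∞ (fun y => fderiv ℝ (fun z : E =>
      c (e.symm y * c.symm z * (e.symm y)⁻¹)) (c 1)) (e g) :=
    ContDiffAt.fderiv (g := fun _ => c 1) h1 contDiffAt_const (by simp)
  have h4 : ∀ a : G, fderiv ℝ (fun z : E => c (a * c.symm z * a⁻¹)) (c 1) = Ad a := by
    intro a
    have hm0 : MDifferentiableAt 𝓘(ℝ, E) 𝓘(ℝ, E) (fun h : G => a * h * a⁻¹) (c.symm (c 1)) :=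
      mdiff_conj a _
    have hm := hm0.comp (c 1) (mdiff_chart_symm (mem_extChartAt_target (1 : G)))
    have h := (fderiv_chart_comp hm (c := 1) (by simp [hc1])).trans
      (tderiv_comp hm0 (mdiff_chart_symm (mem_extChartAt_target (1 : G))))
    rw [tderiv_chart_symm_self, hc1] at h
    exact h
  have h5 : ContMDiffAt 𝓘(ℝ, E) 𝓘(ℝ, E →L[ℝ] E) ∞ (fun y => (Ad (e.symm y) : E →L[ℝ] E)) (e g) := by
    simp only [h4] at h3
    exact h3.contMDiffAt
  refine (ContMDiffAt.comp g h5 (contMDiffAt_chart (mem_extChartAt_source g))).congr_of_eventuallyEq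
    ?_
  filter_upwards [extChartAt_source_mem_nhds (I := 𝓘(ℝ, E)) g] with a ha
  exact congrArg Ad (e.left_inv ha).symm

variable [FiniteDimensional ℝ E]

theorem smoothNear_thetaL (g : G) : SmoothNear 𝓘(ℝ, E) (thetaL E G) g := by
  refine Eventually.of_forall fun g => ?_
  set e := extChartAt 𝓘(ℝ, E) g
  rw [contDiffAt_alternating_iff]
  intro v
  have h1 : ContDiffAt ℝ ∞ (Function.uncurry fun y z : E =>
      extChartAt 𝓘(ℝ, E) (1 : G) ((e.symm y)⁻¹ * e.symm z)) (e g, e g) := by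
    rw [← contMDiffAt_iff_contDiffAt]
    have hs := contMDiffAt_chart_symm (mem_extChartAt_target (I := 𝓘(ℝ, E)) g)
    have h2 : ContMDiffAt 𝓘(ℝ, E × E) 𝓘(ℝ, E) ∞
        (fun p : E × E => (e.symm p.1)⁻¹ * e.symm p.2) (e g, e g) := by
      refine ContMDiffAt.mul (ContMDiffAt.inv ?_) ?_
      · exact ContMDiffAt.comp (e g, e g) (f := fun p : E × E => p.1) hs
          contDiff_fst.contDiffAt.contMDiffAt
      · exact ContMDiffAt.comp (e g, e g) (f := fun p : E × E => p.2) hs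
          contDiff_snd.contDiffAt.contMDiffAt
    refine ContMDiffAt.comp (e g, e g) (contMDiffAt_chart ?_) h2
    change (e.symm (e g))⁻¹ * e.symm (e g) ∈ _
    rw [inv_mul_cancel]
    exact mem_extChartAt_source _
  have h3 : ContDiffAt ℝ ∞ (fun y => fderiv ℝ (fun z : E =>
      extChartAt 𝓘(ℝ, E) (1 : G) ((e.symm y)⁻¹ * e.symm z)) y) (e g) :=
    ContDiffAt.fderiv (g := fun y => y) h1 contDiffAt_id (by simp)
  refine (h3.clm_apply (contDiffAt_const (c := v 0))).congr_of_eventuallyEq ?_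
  filter_upwards [eventually_mem_chart_target (I := 𝓘(ℝ, E)) g] with y hy
  have hm := (mdiff_mul_left (E := E) (e.symm y)⁻¹ (e.symm y)).comp y (mdiff_chart_symm hy)
  have h4 := (fderiv_chart_comp hm (c := 1) (by simp)).trans
    (tderiv_comp (mdiff_mul_left (E := E) (e.symm y)⁻¹ (e.symm y)) (mdiff_chart_symm hy))
  exact (DFunLike.congr_fun h4 (v 0)).symm

end LieGroupForms

end FormsAndLieGroups

/-! ### The Maurer-Cartan equation and the derivative of the adjoint action -/

section MaurerCartan

variable {E : Type*} [NormedAddCommGroup E] [NormedSpace ℝ E]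
  {G : Type*} [TopologicalSpace G] [ChartedSpace E G] [Group G] [LieGroup 𝓘(ℝ, E) ∞ G]

theorem lieGroup_minSmoothness : LieGroup 𝓘(ℝ, E) (minSmoothness ℝ 3) G := by
  rw [minSmoothness_of_isRCLikeNormedField]; infer_instance

theorem chart_symm_inverse {y : E} {g : G} (hy : y ∈ (extChartAt 𝓘(ℝ, E) g).target) :
    (tderiv 𝓘(ℝ, E) 𝓘(ℝ, E) (extChartAt 𝓘(ℝ, E) g).symm y).comp
        (tderiv 𝓘(ℝ, E) 𝓘(ℝ, E) (extChartAt 𝓘(ℝ, E) g) ((extChartAt 𝓘(ℝ, E) g).symm y)) =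
      ContinuousLinearMap.id ℝ E ∧
    (tderiv 𝓘(ℝ, E) 𝓘(ℝ, E) (extChartAt 𝓘(ℝ, E) g).symm y).inverse =
      tderiv 𝓘(ℝ, E) 𝓘(ℝ, E) (extChartAt 𝓘(ℝ, E) g) ((extChartAt 𝓘(ℝ, E) g).symm y) := by
  set e := extChartAt 𝓘(ℝ, E) g
  have hs := mdiff_chart_symm hy
  have hc : MDifferentiableAt 𝓘(ℝ, E) 𝓘(ℝ, E) e (e.symm y) := mdiff_chart (e.map_target hy)
  have h1 := tderiv_comp hc hs
  have e1 : tderiv 𝓘(ℝ, E) 𝓘(ℝ, E) (e ∘ e.symm) y = ContinuousLinearMap.id ℝ E := by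
    rw [tderiv_congr (g := fun z => z), tderiv_id]
    filter_upwards [(isOpen_extChartAt_target g).mem_nhds hy] with z hz
    exact e.right_inv hz
  have h2 := tderiv_comp (g := e.symm) (f := e) (x := e.symm y)
    (by rw [e.right_inv hy]; exact hs) hc
  have e2 : tderiv 𝓘(ℝ, E) 𝓘(ℝ, E) (e.symm ∘ e) (e.symm y) = ContinuousLinearMap.id ℝ E := by
    rw [tderiv_congr (g := fun z => z), tderiv_id]
    filter_upwards [extChartAt_source_mem_nhds' (e.map_target hy)] with z hz
    exact e.left_inv hz
  rw [e1] at h1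
  rw [e2, e.right_inv hy] at h2
  exact ⟨h2.symm, ContinuousLinearMap.inverse_eq h2.symm h1.symm⟩

theorem contMDiff_Ad_inv_snd {E' H' X : Type*} [NormedAddCommGroup E'] [NormedSpace ℝ E']
    [TopologicalSpace H'] {I' : ModelWithCorners ℝ E' H'} [TopologicalSpace X]
    [ChartedSpace H' X] :
    ContMDiff (I'.prod 𝓘(ℝ, E)) 𝓘(ℝ, E →L[ℝ] E) ∞ (fun x : X × G => (Ad x.2⁻¹ : E →L[ℝ] E)) :=
  contMDiff_Ad.comp ((contMDiff_inv 𝓘(ℝ, E) ∞).comp contMDiff_snd)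

theorem tderiv_Ad_inv_snd {E' H' X : Type*} [NormedAddCommGroup E'] [NormedSpace ℝ E']
    [TopologicalSpace H'] {I' : ModelWithCorners ℝ E' H'} [TopologicalSpace X]
    [ChartedSpace H' X] (x : X × G) (U : E' × E) :
    tderiv (I'.prod 𝓘(ℝ, E)) 𝓘(ℝ, E →L[ℝ] E) (fun x : X × G => (Ad x.2⁻¹ : E →L[ℝ] E)) x U =
      tderiv 𝓘(ℝ, E) 𝓘(ℝ, E →L[ℝ] E) (fun h : G => (Ad h⁻¹ : E →L[ℝ] E)) x.2 U.2 := by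
  have hc : ContMDiff 𝓘(ℝ, E) 𝓘(ℝ, E →L[ℝ] E) ∞ (fun h : G => (Ad h⁻¹ : E →L[ℝ] E)) :=
    contMDiff_Ad.comp (contMDiff_inv 𝓘(ℝ, E) ∞)
  have h := tderiv_comp (I := I'.prod 𝓘(ℝ, E)) (x := x)
    (hc.mdifferentiable (by simp) (Prod.snd x)) mdifferentiableAt_snd
  rw [tderiv_snd] at h
  exact DFunLike.congr_fun h U

variable [FiniteDimensional ℝ E]

theorem bracket_swap (u v : E) : bracket E G u v = - bracket E G v u := by
  have : LieGroup 𝓘(ℝ, E) (minSmoothness ℝ 3) G := lieGroup_minSmoothness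
  have : CompleteSpace E := FiniteDimensional.complete ℝ E
  exact (lie_skew (L := GroupLieAlgebra 𝓘(ℝ, E) G) u v).symm

theorem bracket_jacobi (u v w : E) :
    bracket E G u (bracket E G v w) + bracket E G v (bracket E G w u) +
      bracket E G w (bracket E G u v) = 0 := by
  have : LieGroup 𝓘(ℝ, E) (minSmoothness ℝ 3) G := lieGroup_minSmoothness
  have : CompleteSpace E := FiniteDimensional.complete ℝ E
  exact lie_jacobi (L := GroupLieAlgebra 𝓘(ℝ, E) G) u v w

/-- The bracket is that of the left-invariant vector fields, read in the chart at the identity. -/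
theorem bracket_eq_lieBracket (u v : E) :
    bracket E G u v = VectorField.lieBracket ℝ
      (fun y => (tderiv 𝓘(ℝ, E) 𝓘(ℝ, E) (extChartAt 𝓘(ℝ, E) (1 : G)).symm y).inverse
        (tderiv 𝓘(ℝ, E) 𝓘(ℝ, E) (fun h : G => (extChartAt 𝓘(ℝ, E) (1 : G)).symm y * h) 1 u))
      (fun y => (tderiv 𝓘(ℝ, E) 𝓘(ℝ, E) (extChartAt 𝓘(ℝ, E) (1 : G)).symm y).inverse
        (tderiv 𝓘(ℝ, E) 𝓘(ℝ, E) (fun h : G => (extChartAt 𝓘(ℝ, E) (1 : G)).symm y * h) 1 v))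
      (extChartAt 𝓘(ℝ, E) (1 : G) 1) := by
  have : LieGroup 𝓘(ℝ, E) (minSmoothness ℝ 3) G := lieGroup_minSmoothness
  have h1 : IsManifold 𝓘(ℝ, E) 1 G := IsManifold.of_le (n := ∞) (by simp)
  have h : bracket E G u v = (tderiv 𝓘(ℝ, E) 𝓘(ℝ, E) (extChartAt 𝓘(ℝ, E) (1 : G)) 1).inverse
    (VectorField.lieBracketWithin ℝ
      (fun y => (id (mfderivWithin 𝓘(ℝ, E) 𝓘(ℝ, E) (extChartAt 𝓘(ℝ, E) (1 : G)).symm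
        (Set.range 𝓘(ℝ, E)) y) : E →L[ℝ] E).inverse
        (tderiv 𝓘(ℝ, E) 𝓘(ℝ, E) (fun h : G => (extChartAt 𝓘(ℝ, E) (1 : G)).symm y * h) 1 u))
      (fun y => (id (mfderivWithin 𝓘(ℝ, E) 𝓘(ℝ, E) (extChartAt 𝓘(ℝ, E) (1 : G)).symm
        (Set.range 𝓘(ℝ, E)) y) : E →L[ℝ] E).inverse
        (tderiv 𝓘(ℝ, E) 𝓘(ℝ, E) (fun h : G => (extChartAt 𝓘(ℝ, E) (1 : G)).symm y * h) 1 v))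
      ((extChartAt 𝓘(ℝ, E) (1 : G)).symm ⁻¹' Set.univ ∩ Set.range 𝓘(ℝ, E))
      (extChartAt 𝓘(ℝ, E) (1 : G) 1)) := rfl
  have hd : ∀ y, (id (mfderivWithin 𝓘(ℝ, E) 𝓘(ℝ, E) (extChartAt 𝓘(ℝ, E) (1 : G)).symm
      (Set.range 𝓘(ℝ, E)) y) : E →L[ℝ] E) =
      tderiv 𝓘(ℝ, E) 𝓘(ℝ, E) (extChartAt 𝓘(ℝ, E) (1 : G)).symm y := fun y => by
    have := mfderivWithin_univ (I := 𝓘(ℝ, E)) (I' := 𝓘(ℝ, E))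
      (f := (extChartAt 𝓘(ℝ, E) (1 : G)).symm)
    rw [ModelWithCorners.range_eq_univ]
    exact congrFun this y
  rw [h]
  simp only [hd]
  rw [tderiv_extChartAt_self, ContinuousLinearMap.inverse_id, ModelWithCorners.range_eq_univ,
    Set.preimage_univ, Set.inter_univ, VectorField.lieBracketWithin_univ]
  rfl

/-- The Maurer-Cartan equation at the identity: `θ^L` is constant on left-invariant vector fields,
so that only the bracket term is left in the invariant formula for `dθ^L`. -/
theorem extD_thetaL_one (u v : E) :
    (extD 𝓘(ℝ, E) (thetaL E G) 1 : E [⋀^Fin 2]→L[ℝ] E) ![u, v] = - bracket E G u v := by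
  set e := extChartAt 𝓘(ℝ, E) (1 : G)
  -- the left-invariant vector field with value `w` at the identity, in the chart `e`
  set W : E → E → E := fun w y => (tderiv 𝓘(ℝ, E) 𝓘(ℝ, E) e.symm y).inverse
        (tderiv 𝓘(ℝ, E) 𝓘(ℝ, E) (fun h : G => e.symm y * h) 1 w) with hW
  have he : e.symm (e 1) = 1 := extChartAt_to_inv _
  have hs := contMDiffAt_chart_symm (mem_extChartAt_target (I := 𝓘(ℝ, E)) (1 : G))
  have hdiff : ∀ w, DifferentiableAt ℝ (W w) (e 1) := by
    intro w
    have h1 : ContDiffAt ℝ ∞ (Function.uncurry fun y z : E => e (e.symm y * e.symm z))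
        (e 1, e 1) := by
      rw [← contMDiffAt_iff_contDiffAt]
      have h2 : ContMDiffAt 𝓘(ℝ, E × E) 𝓘(ℝ, E) ∞
          (fun p : E × E => e.symm p.1 * e.symm p.2) (e 1, e 1) := by
        refine ContMDiffAt.mul ?_ ?_
        · exact ContMDiffAt.comp (e 1, e 1) (f := fun p : E × E => p.1) hs
            contDiff_fst.contDiffAt.contMDiffAt
        · exact ContMDiffAt.comp (e 1, e 1) (f := fun p : E × E => p.2) hs
            contDiff_snd.contDiffAt.contMDiffAt
      refine ContMDiffAt.comp (e 1, e 1) (contMDiffAt_chart ?_) h2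
      change e.symm (e 1) * e.symm (e 1) ∈ _
      rw [he, mul_one]
      exact mem_extChartAt_source _
    have h3 : ContDiffAt ℝ ∞
        (fun y => fderiv ℝ (fun z : E => e (e.symm y * e.symm z)) (e 1)) (e 1) :=
      ContDiffAt.fderiv (g := fun _ => e 1) h1 contDiffAt_const (by simp)
    refine ((h3.clm_apply (contDiffAt_const (c := w))).congr_of_eventuallyEq ?_).differentiableAt
      (by simp)
    filter_upwards [eventually_mem_chart_target (I := 𝓘(ℝ, E)) (1 : G)] with y hy
    have hm0 := mdiff_mul_left (E := E) (e.symm y) (e.symm (e 1))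
    have hs' := mdiff_chart_symm (mem_extChartAt_target (I := 𝓘(ℝ, E)) (1 : G))
    have hm := hm0.comp _ hs'
    have hy1 : e.symm y * e.symm (e 1) = e.symm y := by rw [he, mul_one]
    have hc : MDifferentiableAt 𝓘(ℝ, E) 𝓘(ℝ, E) e (e.symm y * e.symm (e 1)) := by
      rw [hy1]; exact mdiff_chart (e.map_target hy)
    have h4 := tderiv_comp (g := e) (f := (fun h => e.symm y * h) ∘ e.symm) hc hm
    rw [tderiv_eq_fderiv, tderiv_comp hm0 hs', tderiv_chart_symm_self, Function.comp_apply, hy1, he]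
      at h4
    have hinv : (tderiv 𝓘(ℝ, E) 𝓘(ℝ, E) e.symm y).inverse =
      tderiv 𝓘(ℝ, E) 𝓘(ℝ, E) e (e.symm y) := (chart_symm_inverse hy).2
    simp only [hW]
    rw [hinv]
    exact (DFunLike.congr_fun h4 w).symm
  -- `θ^L` is constant on left-invariant vector fields
  have hconst : ∀ w, (fun y => inChart 𝓘(ℝ, E) (1 : G) (thetaL E G) y ![W w y]) =ᶠ[𝓝 (e 1)]
      fun _ => w := by
    intro w
    filter_upwards [eventually_mem_chart_target (I := 𝓘(ℝ, E)) (1 : G)] with y hy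
    have h5 := DFunLike.congr_fun (chart_symm_inverse hy).1
      (tderiv 𝓘(ℝ, E) 𝓘(ℝ, E) (fun h : G => e.symm y * h) 1 w)
    rw [inChart, pull_apply_one]
    have hinv : (tderiv 𝓘(ℝ, E) 𝓘(ℝ, E) e.symm y).inverse =
      tderiv 𝓘(ℝ, E) 𝓘(ℝ, E) e (e.symm y) := (chart_symm_inverse hy).2
    simp only [hW]
    rw [hinv]
    refine Eq.trans ?_ (thetaL_mul_left (e.symm y) w)
    congr 2

  have hval : ∀ w, W w (e 1) = w := by
    intro w
    simp only [hW]
    rw [tderiv_chart_symm_self, ContinuousLinearMap.inverse_id, he]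
    simp only [one_mul]
    rw [tderiv_id]
    rfl
  have hd := (smoothNear_thetaL (E := E) (1 : G)).contDiffAt.differentiableAt (by simp)
  have := extDeriv_apply_vectorField (V := ![W u, W v]) hd (by
    intro i; fin_cases i
    · exact hdiff u
    · exact hdiff v)
  rw [extD_apply_self]
  have e1 : (fun i => ![W u, W v] i (e 1)) = ![u, v] := by
    ext i; fin_cases i
    · exact hval u
    · exact hval v
  rw [e1] at this
  rw [this, bracket_eq_lieBracket]
  have t0 : ∀ y, Fin.removeNth (0 : Fin 2) (fun i => ![W u, W v] i y) = ![W v y] := by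
    intro y; ext i; fin_cases i; rfl
  have t1 : ∀ y, Fin.removeNth (1 : Fin 2) (fun i => ![W u, W v] i y) = ![W u y] := by
    intro y; ext i; fin_cases i; rfl
  simp only [Nat.reduceAdd, Fin.sum_univ_two, Fin.isValue, t0, t1]
  rw [(hconst v).fderiv_eq, (hconst u).fderiv_eq]
  have hsum : ∀ f : Fin 1 → Fin 1 → E, ∑ i, ∑ j ≥ i, f i j = f 0 0 := by
    intro f; simp
  simp only [fderiv_fun_const, Pi.zero_apply, zero_apply, smul_zero, add_zero, zero_sub]
  refine congrArg Neg.neg ((hsum _).trans ?_)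
  rw [inChart_apply_self]
  simp only [Fin.val_zero, add_zero, pow_zero, one_smul]
  refine Eq.trans (congrArg _ ?_) (thetaL_one _)
  ext i; fin_cases i; rfl

/-- The Maurer-Cartan equation `dθ^L = -½ [θ^L ∧ θ^L]`, by left invariance from the identity. -/
theorem extD_thetaL (g : G) (u v : E) :
    (extD 𝓘(ℝ, E) (thetaL E G) g : E [⋀^Fin 2]→L[ℝ] E) ![u, v] =
      - bracket E G (thetaL E G g ![u]) (thetaL E G g ![v]) := by
  have h := extD_pull (f := fun h : G => g⁻¹ * h) (x := g) (I := 𝓘(ℝ, E)) (I' := 𝓘(ℝ, E))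
    (contMDiff_mul_left (I := 𝓘(ℝ, E)) (n := ∞) g)
    (smoothNear_thetaL (E := E) (g⁻¹ * g)).contDiffAt
  rw [pull_mul_left_thetaL] at h
  rw [h, pull_apply_two, inv_mul_cancel, extD_thetaL_one]
  rfl

theorem smoothNear_pull_fst {E' H' X V : Type*} [NormedAddCommGroup E'] [NormedSpace ℝ E']
    [FiniteDimensional ℝ E'] [NormedAddCommGroup V] [NormedSpace ℝ V] [FiniteDimensional ℝ V]
    [TopologicalSpace H'] {I' : ModelWithCorners ℝ E' H'} [I'.Boundaryless] [TopologicalSpace X]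
    [ChartedSpace H' X] [IsManifold I' ∞ X] {k : ℕ} {φ : DForm E' X k V} {x : X × G}
    (hφ : SmoothNear I' φ x.1) :
    SmoothNear (I'.prod 𝓘(ℝ, E)) (pull (I'.prod 𝓘(ℝ, E)) I' Prod.fst φ) x :=
  SmoothNear.pull (Eventually.of_forall fun _ => contMDiffAt_fst) hφ

theorem smoothNear_pull_snd {E' H' X V : Type*} [NormedAddCommGroup E'] [NormedSpace ℝ E']
    [FiniteDimensional ℝ E'] [NormedAddCommGroup V] [NormedSpace ℝ V] [FiniteDimensional ℝ V]
    [TopologicalSpace H'] {I' : ModelWithCorners ℝ E' H'} [I'.Boundaryless] [TopologicalSpace X]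
    [ChartedSpace H' X] [IsManifold I' ∞ X] {k : ℕ} {φ : DForm E G k V} {x : X × G}
    (hφ : SmoothNear 𝓘(ℝ, E) φ x.2) :
    SmoothNear (I'.prod 𝓘(ℝ, E)) (pull (I'.prod 𝓘(ℝ, E)) 𝓘(ℝ, E) Prod.snd φ) x :=
  SmoothNear.pull (Eventually.of_forall fun _ => contMDiffAt_snd) hφ

theorem SmoothNear.clm_comp {E' H' X V₁ V₃ : Type*} [NormedAddCommGroup E'] [NormedSpace ℝ E']
    [FiniteDimensional ℝ E'] [NormedAddCommGroup V₁] [NormedSpace ℝ V₁] [FiniteDimensional ℝ V₁]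
    [NormedAddCommGroup V₃] [NormedSpace ℝ V₃] [FiniteDimensional ℝ V₃]
    [TopologicalSpace H'] {I' : ModelWithCorners ℝ E' H'} [I'.Boundaryless] [TopologicalSpace X]
    [ChartedSpace H' X] [IsManifold I' ∞ X] {k : ℕ} {α : DForm E' X k V₁} {x : X}
    (hα : SmoothNear I' α x) {f : X → V₁ →L[ℝ] V₃} (hf : ContMDiff I' 𝓘(ℝ, V₁ →L[ℝ] V₃) ∞ f) :
    SmoothNear I' (fun z => (f z).compContinuousAlternatingMap (α z)) x := by
  filter_upwards [hα] with z hz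
  refine contDiffAt_alternating_iff.2 fun m => ?_
  have hg : ContDiffAt ℝ ∞ (fun y => f ((extChartAt I' z).symm y)) (extChartAt I' z z) := by
    rw [← contMDiffAt_iff_contDiffAt]
    exact ContMDiffAt.comp _ (hf _) (contMDiffAt_chart_symm (mem_extChartAt_target z))
  exact hg.clm_apply (contDiffAt_alternating_iff.1 hz m)

/-- The exterior derivative of `Ad(h⁻¹) α` on `X × G`, in terms of the derivative of `Ad`. -/
theorem extD_Ad_comp_aux {E' H' X : Type*} [NormedAddCommGroup E'] [NormedSpace ℝ E']
    [FiniteDimensional ℝ E'] [TopologicalSpace H'] {I' : ModelWithCorners ℝ E' H'}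
    [I'.Boundaryless] [TopologicalSpace X] [ChartedSpace H' X] [IsManifold I' ∞ X]
    {α : DForm (E' × E) (X × G) 1 E} {x : X × G} (hα : SmoothNear (I'.prod 𝓘(ℝ, E)) α x)
    (U W : E' × E) :
    (extD (I'.prod 𝓘(ℝ, E))
        (fun z : X × G => (Ad z.2⁻¹ : E →L[ℝ] E).compContinuousAlternatingMap (α z)) x :
        (E' × E) [⋀^Fin 2]→L[ℝ] E) ![U, W] =
      Ad x.2⁻¹ (extD (I'.prod 𝓘(ℝ, E)) α x ![U, W]) +
        tderiv 𝓘(ℝ, E) 𝓘(ℝ, E →L[ℝ] E) (fun h : G => (Ad h⁻¹ : E →L[ℝ] E)) x.2 U.2 (α x ![W]) -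
        tderiv 𝓘(ℝ, E) 𝓘(ℝ, E →L[ℝ] E) (fun h : G => (Ad h⁻¹ : E →L[ℝ] E)) x.2 W.2
          (α x ![U]) := by
  rw [extD_clm_comp (contMDiff_Ad_inv_snd (I' := I') x) hα, tderiv_Ad_inv_snd, tderiv_Ad_inv_snd]

/-- The exterior derivative of the equivariance `mult^* θ^L = Ad(h⁻¹) g^* θ^L + h^* θ^L`. Its
components of type `(1, 1)` and `(2, 0)` give the derivative of `Ad` and its compatibility with the
bracket. -/
theorem extD_pull_mul_thetaL (x : G × G) (U W : E × E) :
    - bracket E G (Ad x.2⁻¹ (thetaL E G x.1 ![U.1]) + thetaL E G x.2 ![U.2])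
        (Ad x.2⁻¹ (thetaL E G x.1 ![W.1]) + thetaL E G x.2 ![W.2]) =
      - Ad x.2⁻¹ (bracket E G (thetaL E G x.1 ![U.1]) (thetaL E G x.1 ![W.1])) +
        tderiv 𝓘(ℝ, E) 𝓘(ℝ, E →L[ℝ] E) (fun h : G => (Ad h⁻¹ : E →L[ℝ] E)) x.2 U.2
          (thetaL E G x.1 ![W.1]) -
        tderiv 𝓘(ℝ, E) 𝓘(ℝ, E →L[ℝ] E) (fun h : G => (Ad h⁻¹ : E →L[ℝ] E)) x.2 W.2
          (thetaL E G x.1 ![U.1]) -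
        bracket E G (thetaL E G x.2 ![U.2]) (thetaL E G x.2 ![W.2]) := by
  have hm := contMDiff_mul_prod (E := E) (G := G)
  have h := extD_pull (hm x) (smoothNear_thetaL (E := E) (x.1 * x.2)).contDiffAt
  rw [funext pull_mul_thetaL] at h
  have h1 := smoothNear_pull_fst (E := E) (I' := 𝓘(ℝ, E)) (x := x) (smoothNear_thetaL (E := E) x.1)
  have h2 := smoothNear_pull_snd (E := E) (I' := 𝓘(ℝ, E)) (x := x) (smoothNear_thetaL (E := E) x.2)
  have h3 := extD_add (h1.clm_comp (contMDiff_Ad_inv_snd (I' := 𝓘(ℝ, E)))) h2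
  have h4 := h.symm.trans h3
  have h5 := DFunLike.congr_fun h4 ![U, W]
  rw [ContinuousAlternatingMap.add_apply, extD_Ad_comp_aux (I' := 𝓘(ℝ, E)) h1,
    extD_pull contMDiffAt_fst (smoothNear_thetaL (E := E) x.1).contDiffAt,
    extD_pull contMDiffAt_snd (smoothNear_thetaL (E := E) x.2).contDiffAt,
    pull_apply_two, pull_apply_two, pull_apply_two, extD_thetaL, extD_thetaL, extD_thetaL] at h5
  have h6 : ∀ Z : E × E, thetaL E G (x.1 * x.2) ![tderiv (𝓘(ℝ, E).prod 𝓘(ℝ, E)) 𝓘(ℝ, E)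
      (fun x : G × G => x.1 * x.2) x Z] =
        Ad x.2⁻¹ (thetaL E G x.1 ![Z.1]) + thetaL E G x.2 ![Z.2] := by
    intro Z
    have := DFunLike.congr_fun (pull_mul_thetaL (E := E) x) ![Z]
    rw [ContinuousAlternatingMap.add_apply,
      ContinuousLinearMap.compContinuousAlternatingMap_coe, Function.comp_apply, pull_apply_one,
      pull_apply_one, pull_apply_one, tderiv_fst, tderiv_snd] at this
    exact this
  rw [h6, h6, pull_apply_one, pull_apply_one, tderiv_fst, tderiv_snd] at h5
  simp only [map_neg, ContinuousLinearMap.coe_fst', ContinuousLinearMap.coe_snd'] at h5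
  rw [h5]
  abel

theorem tderiv_Ad_inv (h : G) (v ξ : E) :
    tderiv 𝓘(ℝ, E) 𝓘(ℝ, E →L[ℝ] E) (fun h : G => (Ad h⁻¹ : E →L[ℝ] E)) h v ξ =
      bracket E G (Ad h⁻¹ ξ) (thetaL E G h ![v]) := by
  have z : ∀ g : G, thetaL E G g ![0] = 0 := fun g => (thetaL E G g).map_coord_zero 0 rfl
  have := extD_pull_mul_thetaL (1, h) (0, v) (ξ, 0)
  simp only [z, map_zero, zero_apply, zero_add, add_zero, neg_zero, sub_zero,
    thetaL_one] at this
  rw [← this, bracket_swap, neg_neg]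

theorem Ad_bracket (g : G) (u v : E) :
    Ad g (bracket E G u v) = bracket E G (Ad g u) (Ad g v) := by
  have z : ∀ g : G, thetaL E G g ![0] = 0 := fun g => (thetaL E G g).map_coord_zero 0 rfl
  have := extD_pull_mul_thetaL ((1 : G), g⁻¹) (u, 0) (v, 0)
  simp only [z, map_zero, zero_apply, add_zero, sub_zero, inv_inv, thetaL_one] at this
  exact (neg_injective this).symm

/-- The exterior derivative of `Ad(h⁻¹) α` on `X × G`: `d(Ad(h⁻¹) α) = Ad(h⁻¹) dα - [θ ∧ Ad(h⁻¹) α]`,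
where `θ` is the pull-back of `θ^L` to `X × G`. -/
theorem extD_Ad_comp {E' H' X : Type*} [NormedAddCommGroup E'] [NormedSpace ℝ E']
    [FiniteDimensional ℝ E'] [TopologicalSpace H'] {I' : ModelWithCorners ℝ E' H'}
    [I'.Boundaryless] [TopologicalSpace X] [ChartedSpace H' X] [IsManifold I' ∞ X]
    {α : DForm (E' × E) (X × G) 1 E} {x : X × G} (hα : SmoothNear (I'.prod 𝓘(ℝ, E)) α x)
    (U W : E' × E) :
    (extD (I'.prod 𝓘(ℝ, E))
        (fun z : X × G => (Ad z.2⁻¹ : E →L[ℝ] E).compContinuousAlternatingMap (α z)) x :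
        (E' × E) [⋀^Fin 2]→L[ℝ] E) ![U, W] =
      Ad x.2⁻¹ (extD (I'.prod 𝓘(ℝ, E)) α x ![U, W]) +
        bracket E G (Ad x.2⁻¹ (α x ![W])) (thetaL E G x.2 ![U.2]) -
        bracket E G (Ad x.2⁻¹ (α x ![U])) (thetaL E G x.2 ![W.2]) := by
  rw [extD_Ad_comp_aux hα, tderiv_Ad_inv, tderiv_Ad_inv]

end MaurerCartan

section Abelian

variable {F : Type*} [NormedAddCommGroup F] [NormedSpace ℝ F]
  {T : Type*} [TopologicalSpace T] [ChartedSpace F T] [CommGroup T]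

theorem Ad_of_comm (t : T) : (Ad t : F →L[ℝ] F) = ContinuousLinearMap.id ℝ F := by
  unfold Ad
  simp only [mul_comm t, mul_inv_cancel_right]
  exact tderiv_id 1

variable [FiniteDimensional ℝ F] [LieGroup 𝓘(ℝ, F) ∞ T]

theorem bracket_of_comm (u v : F) : bracket F T u v = 0 := by
  have h := tderiv_Ad_inv (1 : T) v u
  simp only [Ad_of_comm, thetaL_one, tderiv_const] at h
  exact h.symm

theorem extD_thetaL_of_comm (t : T) : extD 𝓘(ℝ, F) (thetaL F T) t = 0 := by
  ext v
  rw [comp_vec2 v]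
  exact (extD_thetaL t _ _).trans (by rw [bracket_of_comm, neg_zero]; rfl)

end Abelian

/-! ### The pairing and the Maurer-Cartan curving of a multiplicative gerbe -/

section Gerbes

variable {E H F : Type*} [NormedAddCommGroup E] [NormedSpace ℝ E] [TopologicalSpace H]
  [NormedAddCommGroup F] [NormedSpace ℝ F] {I : ModelWithCorners ℝ E H}
  {X : Type*} [TopologicalSpace X] [ChartedSpace H X]
  {T : Type*} [TopologicalSpace T] [ChartedSpace F T] [CommGroup T]

theorem pull_extD_apply_two {E' H' X' V : Type*} [NormedAddCommGroup E'] [NormedSpace ℝ E']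
    [TopologicalSpace H'] {I' : ModelWithCorners ℝ E' H'} [TopologicalSpace X']
    [ChartedSpace H' X'] [NormedAddCommGroup V] [NormedSpace ℝ V] (f : X → X')
    (φ : DForm E' X' 1 V) (x : X) (u v : E) :
    pull I I' f (extD I' φ) x ![u, v] =
      extD I' φ (f x) ![tderiv I I' f x u, tderiv I I' f x v] :=
  pull_apply_two f _ x u v

theorem pull_extD_apply_three {E' H' X' V : Type*} [NormedAddCommGroup E'] [NormedSpace ℝ E']
    [TopologicalSpace H'] {I' : ModelWithCorners ℝ E' H'} [TopologicalSpace X']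
    [ChartedSpace H' X'] [NormedAddCommGroup V] [NormedSpace ℝ V] (f : X → X')
    (φ : DForm E' X' 2 V) (x : X) (u v w : E) :
    pull I I' f (extD I' φ) x ![u, v, w] =
      extD I' φ (f x) ![tderiv I I' f x u, tderiv I I' f x v, tderiv I I' f x w] :=
  pull_apply_three f _ x u v w

theorem pull_eq_zero {E' H' X' V : Type*} [NormedAddCommGroup E'] [NormedSpace ℝ E']
    [TopologicalSpace H'] {I' : ModelWithCorners ℝ E' H'} [TopologicalSpace X']
    [ChartedSpace H' X'] [NormedAddCommGroup V] [NormedSpace ℝ V] {k : ℕ} {f : X → X'}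
    {φ : DForm E' X' k V} {x : X} (h : φ (f x) = 0) : pull I I' f φ x = 0 := by
  ext v
  exact DFunLike.congr_fun h _

variable [I.Boundaryless] [IsManifold I ∞ X]

/-- The forms `d (B i)` agree on overlaps, since `B i - B j` is exact. -/
theorem Gerbe.IsCurving.extD_eq {L : Gerbe.{w} I X F T} {A : L.ι → L.ι → DForm E X 1 F}
    {B : L.ι → DForm E X 2 F} (hB : L.IsCurving A B) (hA : L.IsConnective A) {i j : L.ι} {x : X}
    (hi : x ∈ L.U i) (hj : x ∈ L.U j) : extD I (B i) x = extD I (B j) x := by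
  have ho := (L.isOpen i).inter (L.isOpen j)
  have h1 := extD_sub ((hB.smooth i).smoothNear (L.isOpen i) hi)
    ((hB.smooth j).smoothNear (L.isOpen j) hj)
  have h2 : B i - B j =ᶠ[𝓝 x] extD I (A i j) := by
    filter_upwards [ho.mem_nhds ⟨hi, hj⟩] with y hy using hB.diff i j y hy
  rw [extD_congr h2, extD_extD ((hA.smooth i j).smoothNear ho ⟨hi, hj⟩)] at h1
  exact sub_eq_zero.1 h1.symm

/-- The curvature of a curving is `d (B i)` on all of `U i`, whatever the indices chosen in its
definition. -/
theorem Gerbe.IsCurving.curvature_eq {L : Gerbe.{w} I X F T} {A : L.ι → L.ι → DForm E X 1 F}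
    {B : L.ι → DForm E X 2 F} (hB : L.IsCurving A B) (hA : L.IsConnective A) {i : L.ι} {x : X}
    (hi : x ∈ L.U i) : L.curvature B x = extD I (B i) x :=
  hB.extD_eq hA (L.cover x).choose_spec hi

end Gerbes

theorem thetaL_zero {E G : Type*} [NormedAddCommGroup E] [NormedSpace ℝ E] [TopologicalSpace G]
    [ChartedSpace E G] [Group G] (g : G) : thetaL E G g ![0] = 0 :=
  (thetaL E G g).map_coord_zero 0 rfl

theorem thetaR_zero {E G : Type*} [NormedAddCommGroup E] [NormedSpace ℝ E] [TopologicalSpace G]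
    [ChartedSpace E G] [Group G] (g : G) : thetaR E G g ![0] = 0 :=
  (thetaR E G g).map_coord_zero 0 rfl

section MultGerbes

variable {EG G F T : Type*}
    [NormedAddCommGroup EG] [NormedSpace ℝ EG]
    [TopologicalSpace G] [ChartedSpace EG G] [Group G] [LieGroup 𝓘(ℝ, EG) ∞ G]
    [NormedAddCommGroup F] [NormedSpace ℝ F]
    [TopologicalSpace T] [ChartedSpace F T] [CommGroup T] [LieGroup 𝓘(ℝ, F) ∞ T]

local notation "I₂" => ModelWithCorners.prod 𝓘(ℝ, EG) 𝓘(ℝ, EG)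

local notation "I₃" => ModelWithCorners.prod 𝓘(ℝ, EG) (ModelWithCorners.prod 𝓘(ℝ, EG) 𝓘(ℝ, EG))

theorem contMDiff_face3 (j : Fin 4) :
    ContMDiff I₃ I₂ ∞
      (face3 j : G × G × G → G × G) := by
  have h1 : ContMDiff I₃ 𝓘(ℝ, EG) ∞
    (fun x : G × G × G => x.1) := contMDiff_fst
  have h2 : ContMDiff I₃ 𝓘(ℝ, EG) ∞
    (fun x : G × G × G => x.2.1) := contMDiff_fst.comp contMDiff_snd
  have h3 : ContMDiff I₃ 𝓘(ℝ, EG) ∞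
    (fun x : G × G × G => x.2.2) := contMDiff_snd.comp contMDiff_snd
  fin_cases j
  · exact h2.prodMk h3
  · exact (h1.mul h2).prodMk h3
  · exact h1.prodMk (h2.mul h3)
  · exact h1.prodMk h2

variable [FiniteDimensional ℝ EG]
    {𝒢 : MultGerbe.{w} EG G F T} (c : MultConnective 𝒢)
    {Θ : 𝒢.gerbe.ι → DForm EG G 2 F}

theorem smoothNear_thetaR (g : G) : SmoothNear 𝓘(ℝ, EG) (thetaR EG G) g := by
  have h : thetaR EG G = fun g => (Ad g : EG →L[ℝ] EG).compContinuousAlternatingMap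
      (thetaL EG G g) := by
    ext g v
    rw [comp_vec1 v]
    exact thetaR_eq g _
  rw [h]
  exact (smoothNear_thetaL g).clm_comp contMDiff_Ad

namespace MultConnective

theorem pairing_symm (u v : EG) : c.pairing u v = c.pairing v u :=
  add_comm _ _

/-- The 2-form `-⟨g₁^* θ^L ∧ g₂^* θ^R⟩` on `G × G`. -/
def prodForm : DForm (EG × EG) (G × G) 2 F :=
  -wedge c.pairing
      (pull I₂ 𝓘(ℝ, EG) (Prod.fst : G × G → G) (thetaL EG G))
      (pull I₂ 𝓘(ℝ, EG) (Prod.snd : G × G → G) (thetaR EG G))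

theorem prodForm_apply (x : G × G) (U W : EG × EG) :
    c.prodForm x ![U, W] = -(c.pairing (thetaL EG G x.1 ![U.1]) (thetaR EG G x.2 ![W.2]) -
      c.pairing (thetaL EG G x.1 ![W.1]) (thetaR EG G x.2 ![U.2])) := by
  refine congrArg Neg.neg ((wedgeAlt_one_one _ _ _ _ _).trans ?_)
  simp only [pull_apply_one, tderiv_fst, tderiv_snd]
  rfl

variable {c}

/-- The flatness of the associator makes the 2-form `-⟨g₁^* θ^L ∧ g₂^* θ^R⟩` simplicially closed:
the contributions of the curvings cancel in the alternating sum over the faces. -/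
theorem IsMaurerCartan.pull_face3_prodForm [FiniteDimensional ℝ F] (hΘ : c.IsMaurerCartan Θ)
    (x : G × G × G) :
    (pull I₃ I₂ (face3 0)
        c.prodForm x +
      pull I₃ I₂ (face3 2)
        c.prodForm x) -
    (pull I₃ I₂ (face3 3)
        c.prodForm x +
      pull I₃ I₂ (face3 1)
        c.prodForm x) = 0 := by
  obtain ⟨r, hr⟩ := 𝒢.W_cover x
  have hM : ∀ j, SmoothNear I₂ (c.M (𝒢.δ j r)) (face3 j x) := fun j =>
    (c.isConnection.smooth (𝒢.δ j r)).smoothNear (𝒢.m.isOpen _) (𝒢.W_subset r j x hr)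
  have hM' : ∀ j, SmoothNear I₃
      (pull I₃ I₂ (face3 j)
        (c.M (𝒢.δ j r))) x := fun j =>
    SmoothNear.pull (Eventually.of_forall (contMDiff_face3 j)) (hM j)
  have key : ∀ j,
      pull I₃ I₂ (face3 j)
        c.prodForm x =
      extD I₃
        (pull I₃ I₂ (face3 j)
          (c.M (𝒢.δ j r))) x -
      (pull I₃ 𝓘(ℝ, EG) (fun z => (face3 j z).1)
          (Θ (𝒢.m.src (𝒢.δ j r)).1) x +
        pull I₃ 𝓘(ℝ, EG) (fun z => (face3 j z).2)
          (Θ (𝒢.m.src (𝒢.δ j r)).2) x) +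
      pull I₃ 𝓘(ℝ, EG)
        (fun z => (face3 j z).1 * (face3 j z).2) (Θ (𝒢.m.tgt (𝒢.δ j r))) x := by
    intro j
    have hf := (contMDiff_face3 (EG := EG) (G := G) j).mdifferentiable (by simp) x
    rw [extD_pull (contMDiff_face3 j x) (hM j).contDiffAt,
      ← pull_comp (I' := I₂) (g := Prod.fst) (f := face3 j) _ mdifferentiableAt_fst hf,
      ← pull_comp (I' := I₂) (g := Prod.snd) (f := face3 j) _ mdifferentiableAt_snd hf,
      ← pull_comp (I' := I₂) (g := fun y : G × G => y.1 * y.2) (f := face3 j) _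
        ((contMDiff_mul_prod (E := EG) (G := G)).mdifferentiable (by simp) _) hf]
    exact congrArg (fun z : (EG × EG) [⋀^Fin 2]→L[ℝ] F =>
      z.compContinuousLinearMap (tderiv I₃ I₂ (face3 j) x))
      (hΘ.hasCurvature _ _ (𝒢.W_subset r j x hr))
  -- the matching conditions identify the pulled back curvings along the common vertices
  have e1 : pull I₃ 𝓘(ℝ, EG) (fun z => (face3 3 z).1 * (face3 3 z).2) (Θ (𝒢.m.tgt (𝒢.δ 3 r))) x =
      pull I₃ 𝓘(ℝ, EG) (fun z => (face3 1 z).1) (Θ (𝒢.m.src (𝒢.δ 1 r)).1) x :=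
    congrArg (fun i => pull I₃ 𝓘(ℝ, EG) (fun z => z.1 * z.2.1) (Θ i) x) (𝒢.match_src r)
  have e2 : pull I₃ 𝓘(ℝ, EG) (fun z => (face3 0 z).1 * (face3 0 z).2) (Θ (𝒢.m.tgt (𝒢.δ 0 r))) x =
      pull I₃ 𝓘(ℝ, EG) (fun z => (face3 2 z).2) (Θ (𝒢.m.src (𝒢.δ 2 r)).2) x :=
    congrArg (fun i => pull I₃ 𝓘(ℝ, EG) (fun z => z.2.1 * z.2.2) (Θ i) x) (𝒢.match_tgt r)
  have e3 : pull I₃ 𝓘(ℝ, EG) (fun z => (face3 3 z).1) (Θ (𝒢.m.src (𝒢.δ 3 r)).1) x =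
      pull I₃ 𝓘(ℝ, EG) (fun z => (face3 2 z).1) (Θ (𝒢.m.src (𝒢.δ 2 r)).1) x :=
    congrArg (fun i => pull I₃ 𝓘(ℝ, EG) (fun z => z.1) (Θ i) x) (𝒢.match_g₁ r)
  have e4 : pull I₃ 𝓘(ℝ, EG) (fun z => (face3 3 z).2) (Θ (𝒢.m.src (𝒢.δ 3 r)).2) x =
      pull I₃ 𝓘(ℝ, EG) (fun z => (face3 0 z).1) (Θ (𝒢.m.src (𝒢.δ 0 r)).1) x :=
    congrArg (fun i => pull I₃ 𝓘(ℝ, EG) (fun z => z.2.1) (Θ i) x) (𝒢.match_g₂ r)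
  have e5 : pull I₃ 𝓘(ℝ, EG) (fun z => (face3 1 z).2) (Θ (𝒢.m.src (𝒢.δ 1 r)).2) x =
      pull I₃ 𝓘(ℝ, EG) (fun z => (face3 0 z).2) (Θ (𝒢.m.src (𝒢.δ 0 r)).2) x :=
    congrArg (fun i => pull I₃ 𝓘(ℝ, EG) (fun z => z.2.2) (Θ i) x) (𝒢.match_g₃ r)
  have e6 : pull I₃ 𝓘(ℝ, EG) (fun z => (face3 1 z).1 * (face3 1 z).2) (Θ (𝒢.m.tgt (𝒢.δ 1 r))) x =
      pull I₃ 𝓘(ℝ, EG) (fun z => (face3 2 z).1 * (face3 2 z).2) (Θ (𝒢.m.tgt (𝒢.δ 2 r))) x := by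
    have h : (fun z : G × G × G => (face3 1 z).1 * (face3 1 z).2) =
      fun z => (face3 2 z).1 * (face3 2 z).2 := funext fun z => mul_assoc _ _ _
    rw [h, 𝒢.match_g₁g₂g₃ r]
  have hα : ContMDiffAt I₃ 𝓘(ℝ, F) ∞ (𝒢.α r) x :=
    (𝒢.α_smooth r).contMDiffAt ((𝒢.W_isOpen r).mem_nhds hr)
  have hflat : ((pull I₃ I₂ (face3 0)
          (c.M (𝒢.δ 0 r)) +
        pull I₃ I₂ (face3 2)
          (c.M (𝒢.δ 2 r))) -
      (pull I₃ I₂ (face3 3)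
          (c.M (𝒢.δ 3 r)) +
        pull I₃ I₂ (face3 1)
          (c.M (𝒢.δ 1 r)))) =ᶠ[𝓝 x]
      -pull I₃ 𝓘(ℝ, F) (𝒢.α r) (thetaL F T) := by
    filter_upwards [(𝒢.W_isOpen r).mem_nhds hr] with y hy
    exact eq_neg_of_add_eq_zero_left (c.flat r y hy)
  have hd := extD_congr (I := 𝓘(ℝ, EG).prod I₂) hflat
  rw [extD_neg, extD_pull hα (smoothNear_thetaL _).contDiffAt, pull_eq_zero (extD_thetaL_of_comm _),
    neg_zero, extD_sub ((hM' 0).add (hM' 2)) ((hM' 3).add (hM' 1)), extD_add (hM' 0) (hM' 2),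
    extD_add (hM' 3) (hM' 1)] at hd
  rw [key 0, key 1, key 2, key 3]
  refine Eq.trans ?_ hd
  rw [e1, e2, e3, e4, e5, e6]
  abel

/-- The pairing of a multiplicative gerbe is `Ad`-invariant. This is the component of
`pull_face3_prodForm` at `(1, h, 1)` along the first and the last factor of `G³`, where only the two
inner faces contribute. -/
theorem IsMaurerCartan.pairing_Ad_left [FiniteDimensional ℝ F] (hΘ : c.IsMaurerCartan Θ) (h : G)
    (u v : EG) : c.pairing (Ad h⁻¹ u) v = c.pairing u (Ad h v) := by
  -- restrict the cocycle identity to the submanifold `{(g, h, k)}` with `h` fixed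
  have hι : ContMDiff I₂ I₃ ∞ (fun x : G × G => (x.1, h, x.2)) :=
    contMDiff_fst.prodMk (contMDiff_const.prodMk contMDiff_snd)
  have hp : ∀ j, pull I₂ I₃ (fun x : G × G => (x.1, h, x.2)) (pull I₃ I₂ (face3 j) c.prodForm)
      (1, 1) = pull I₂ I₂ (fun x : G × G => face3 j (x.1, h, x.2)) c.prodForm (1, 1) := fun j =>
    pull_comp (I' := I₃) _ ((contMDiff_face3 (EG := EG) (G := G) j).mdifferentiable (by simp) _)
      (hι.mdifferentiable (by simp) _)
  have key := congrArg (fun z => z.compContinuousLinearMap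
    (tderiv I₂ I₃ (fun x : G × G => (x.1, h, x.2)) (1, 1))) (hΘ.pull_face3_prodForm (1, h, 1))
  have key' : (pull I₂ I₂ (fun x : G × G => face3 0 (x.1, h, x.2)) c.prodForm (1, 1) +
      pull I₂ I₂ (fun x : G × G => face3 2 (x.1, h, x.2)) c.prodForm (1, 1)) -
      (pull I₂ I₂ (fun x : G × G => face3 3 (x.1, h, x.2)) c.prodForm (1, 1) +
      pull I₂ I₂ (fun x : G × G => face3 1 (x.1, h, x.2)) c.prodForm (1, 1)) = 0 := by
    simp only [← hp]
    exact key
  have hr : MDifferentiableAt I₂ 𝓘(ℝ, EG) (fun x : G × G => x.1 * h) (1, 1) :=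
    (contMDiff_fst.mul contMDiff_const).mdifferentiable (n := ∞) (by simp) _
  have hl : MDifferentiableAt I₂ 𝓘(ℝ, EG) (fun x : G × G => h * x.2) (1, 1) :=
    (contMDiff_const.mul contMDiff_snd).mdifferentiable (n := ∞) (by simp) _
  have d0 : tderiv I₂ I₂ (fun x : G × G => (h, x.2)) (1, 1) =
      (0 : EG × EG →L[ℝ] EG).prod (ContinuousLinearMap.snd ℝ EG EG) := by
    rw [tderiv_prodMk mdifferentiableAt_const mdifferentiableAt_snd, tderiv_const]
    exact congrArg _ (tderiv_snd _)
  have d1 : tderiv I₂ I₂ (fun x : G × G => (x.1 * h, x.2)) (1, 1) =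
      ((tderiv 𝓘(ℝ, EG) 𝓘(ℝ, EG) (fun x : G => x * h) 1).comp
        (ContinuousLinearMap.fst ℝ EG EG)).prod (ContinuousLinearMap.snd ℝ EG EG) := by
    rw [tderiv_prodMk hr mdifferentiableAt_snd]
    have := tderiv_comp (I := I₂) (g := fun x : G => x * h) (f := Prod.fst)
      (x := ((1 : G), (1 : G)))
      (mdiff_mul_right (E := EG) h 1) mdifferentiableAt_fst
    rw [tderiv_fst] at this
    exact congrArg₂ _ this (tderiv_snd _)
  have d2 : tderiv I₂ I₂ (fun x : G × G => (x.1, h * x.2)) (1, 1) =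
      (ContinuousLinearMap.fst ℝ EG EG).prod
        ((tderiv 𝓘(ℝ, EG) 𝓘(ℝ, EG) (fun x : G => h * x) 1).comp
          (ContinuousLinearMap.snd ℝ EG EG)) := by
    rw [tderiv_prodMk mdifferentiableAt_fst hl]
    have := tderiv_comp (I := I₂) (g := fun x : G => h * x) (f := Prod.snd)
      (x := ((1 : G), (1 : G)))
      (mdiff_mul_left (E := EG) h 1) mdifferentiableAt_snd
    rw [tderiv_snd] at this
    exact congrArg₂ _ (tderiv_fst _) this
  have d3 : tderiv I₂ I₂ (fun x : G × G => (x.1, h)) (1, 1) =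
      (ContinuousLinearMap.fst ℝ EG EG).prod (0 : EG × EG →L[ℝ] EG) := by
    rw [tderiv_prodMk mdifferentiableAt_fst mdifferentiableAt_const, tderiv_const]
    exact congrArg (fun z => ContinuousLinearMap.prod z _) (tderiv_fst _)
  have k := DFunLike.congr_fun key' ![(u, 0), (0, v)]
  simp only [face3, ContinuousAlternatingMap.sub_apply, ContinuousAlternatingMap.add_apply,
    pull_apply_two, d0, d1, d2, d3, prodForm_apply, ContinuousLinearMap.prod_apply,
    ContinuousLinearMap.comp_apply, ContinuousLinearMap.coe_fst', ContinuousLinearMap.coe_snd',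
    zero_apply, map_zero, thetaL_zero, thetaR_zero, sub_zero, neg_zero, zero_add,
    one_mul, mul_one] at k
  have r1 : thetaL EG G h ![tderiv 𝓘(ℝ, EG) 𝓘(ℝ, EG) (fun x : G => x * h) 1 u] = Ad h⁻¹ u := by
    have h1 := congrArg (Ad h⁻¹) (thetaR_eq (E := EG) h
      (tderiv 𝓘(ℝ, EG) 𝓘(ℝ, EG) (fun x : G => x * h) 1 u))
    rw [Ad_inv_Ad] at h1
    rw [← h1, thetaR_apply]
    have h2 := tderiv_comp (x := (1 : G)) (g := fun x : G => x * h⁻¹) (f := fun x : G => x * h)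
      (mdiff_mul_right (E := EG) _ _) (mdiff_mul_right (E := EG) h 1)
    have h3 : (fun x : G => x * h⁻¹) ∘ (fun x : G => x * h) = fun x => x := by ext; simp
    rw [h3, tderiv_id, one_mul] at h2
    exact congrArg _ (DFunLike.congr_fun h2 u).symm
  have r2 : ∀ w : EG, thetaR EG G 1 ![w] = w := by
    intro w; rw [thetaR_eq, thetaL_one, Ad_one]; rfl
  rw [r1, r2, thetaR_eq, thetaL_one, thetaL_mul_left] at k
  have k' : -c.pairing u (Ad h v) - -c.pairing (Ad h⁻¹ u) v = 0 := k
  rw [sub_neg_eq_add, neg_add_eq_zero] at k'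
  exact k'.symm

theorem IsMaurerCartan.pairing_Ad_Ad [FiniteDimensional ℝ F] (hΘ : c.IsMaurerCartan Θ) (h : G)
    (u v : EG) : c.pairing (Ad h⁻¹ u) (Ad h⁻¹ v) = c.pairing u v := by
  rw [hΘ.pairing_Ad_left, Ad_Ad_inv]

/-- Invariance of the pairing under the Lie algebra, by differentiating `pairing_Ad_Ad` at `1`. -/
theorem IsMaurerCartan.pairing_bracket [FiniteDimensional ℝ F] (hΘ : c.IsMaurerCartan Θ)
    (u v w : EG) :
    c.pairing (bracket EG G u w) v + c.pairing u (bracket EG G v w) = 0 := by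
  set Qf : (EG →L[ℝ] EG) → F := fun S => c.pairing (S u) (S v)
  have hQ : HasFDerivAt Qf ((c.pairing.precompR (EG →L[ℝ] EG)
      (ContinuousLinearMap.id ℝ EG u) (ContinuousLinearMap.apply ℝ EG v)) +
      (c.pairing.precompL (EG →L[ℝ] EG) (ContinuousLinearMap.apply ℝ EG u)
      (ContinuousLinearMap.id ℝ EG v))) (ContinuousLinearMap.id ℝ EG) :=
    ContinuousLinearMap.hasFDerivAt_of_bilinear c.pairing
      (ContinuousLinearMap.apply ℝ EG u).hasFDerivAt (ContinuousLinearMap.apply ℝ EG v).hasFDerivAt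
  have hf : ContMDiff 𝓘(ℝ, EG) 𝓘(ℝ, EG →L[ℝ] EG) ∞ (fun h : G => (Ad h⁻¹ : EG →L[ℝ] EG)) :=
    contMDiff_Ad.comp (contMDiff_inv 𝓘(ℝ, EG) ∞)
  have h1 : (Ad (1 : G)⁻¹ : EG →L[ℝ] EG) = ContinuousLinearMap.id ℝ EG := by rw [inv_one, Ad_one]
  have hd := tderiv_comp (I := 𝓘(ℝ, EG)) (I'' := 𝓘(ℝ, F)) (g := Qf)
    (f := fun h : G => (Ad h⁻¹ : EG →L[ℝ] EG)) (x := 1)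
    (by rw [h1]; exact hQ.differentiableAt.mdifferentiableAt) (hf.mdifferentiable (by simp) _)
  have hc : Qf ∘ (fun h : G => (Ad h⁻¹ : EG →L[ℝ] EG)) = fun _ => c.pairing u v :=
    funext fun h => hΘ.pairing_Ad_Ad h u v
  rw [hc, tderiv_const, h1, tderiv_eq_fderiv, hQ.fderiv] at hd
  have := (DFunLike.congr_fun hd w).symm
  have e : c.pairing u (tderiv 𝓘(ℝ, EG) 𝓘(ℝ, EG →L[ℝ] EG)
        (fun h : G => (Ad h⁻¹ : EG →L[ℝ] EG)) 1 w v) +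
      c.pairing (tderiv 𝓘(ℝ, EG) 𝓘(ℝ, EG →L[ℝ] EG)
        (fun h : G => (Ad h⁻¹ : EG →L[ℝ] EG)) 1 w u) v = 0 := this
  rw [tderiv_Ad_inv, tderiv_Ad_inv, h1, thetaL_one] at e
  rw [add_comm]
  exact e

/-- The curvature of the Maurer-Cartan curving is the Cartan 3-form
`(u, v, w) ↦ ⟨[θ^L u, θ^L v], θ^L w⟩`. It is found by evaluating the exterior derivative of the
curvature condition of `∇_m` at `(g, 1)` on two vectors of the first and one of the second factor. -/
theorem IsMaurerCartan.extD_apply [FiniteDimensional ℝ F] (hΘ : c.IsMaurerCartan Θ)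
    {i : 𝒢.gerbe.ι} {g : G} (hg : g ∈ 𝒢.gerbe.U i) (u v w : EG) :
    (extD 𝓘(ℝ, EG) (Θ i) g : EG [⋀^Fin 3]→L[ℝ] F) ![u, v, w] =
      c.pairing (bracket EG G (thetaL EG G g ![u]) (thetaL EG G g ![v])) (thetaL EG G g ![w]) := by
  obtain ⟨a, ha⟩ := 𝒢.m.cover (g, 1)
  obtain ⟨hs1, hs2⟩ := 𝒢.m.subset_src a ha
  have ht : g ∈ 𝒢.gerbe.U (𝒢.m.tgt a) := by
    have : g * 1 ∈ 𝒢.gerbe.U (𝒢.m.tgt a) := 𝒢.m.subset_tgt a ha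
    rwa [mul_one] at this
  have hV := 𝒢.m.isOpen a
  have hΘs : ∀ {j : 𝒢.gerbe.ι} {y : G}, y ∈ 𝒢.gerbe.U j → SmoothNear 𝓘(ℝ, EG) (Θ j) y :=
    fun {j y} hy => (hΘ.isCurving.smooth j).smoothNear (𝒢.gerbe.isOpen j) hy
  have hm := contMDiff_mul_prod (E := EG) (G := G)
  have ht' : (fun x : G × G => x.1 * x.2) (g, 1) ∈ 𝒢.gerbe.U (𝒢.m.tgt a) := 𝒢.m.subset_tgt a ha
  have hM := (c.isConnection.smooth a).smoothNear hV ha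
  have s1 := smoothNear_pull_fst (E := EG) (I' := 𝓘(ℝ, EG)) (x := (g, (1 : G))) (hΘs hs1)
  have s2 := smoothNear_pull_snd (E := EG) (I' := 𝓘(ℝ, EG)) (x := (g, (1 : G))) (hΘs hs2)
  have s3 : SmoothNear I₂ (pull I₂ 𝓘(ℝ, EG) (fun x : G × G => x.1 * x.2) (Θ (𝒢.m.tgt a))) (g, 1) :=
    SmoothNear.pull (Eventually.of_forall fun z => hm z) (hΘs ht')
  have he : c.prodForm =ᶠ[𝓝 (g, 1)] (extD I₂ (c.M a) +
      -(pull I₂ 𝓘(ℝ, EG) Prod.fst (Θ (𝒢.m.src a).1) +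
        pull I₂ 𝓘(ℝ, EG) Prod.snd (Θ (𝒢.m.src a).2))) +
      pull I₂ 𝓘(ℝ, EG) (fun x : G × G => x.1 * x.2) (Θ (𝒢.m.tgt a)) := by
    filter_upwards [hV.mem_nhds ha] with y hy
    refine (hΘ.hasCurvature a y hy).trans ?_
    rw [sub_eq_add_neg]
    rfl
  have hd := extD_congr (I := I₂) he
  rw [extD_add (hM.extD.add (s1.add s2).neg) s3, extD_add hM.extD (s1.add s2).neg, extD_extD hM,
    extD_neg, extD_add s1 s2, extD_pull contMDiffAt_fst (hΘs hs1).contDiffAt,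
    extD_pull contMDiffAt_snd (hΘs hs2).contDiffAt, extD_pull (hm _) (hΘs ht').contDiffAt,
    zero_add] at hd
  obtain ⟨z, rfl⟩ : ∃ z, tderiv 𝓘(ℝ, EG) 𝓘(ℝ, EG) (fun h : G => g * h) 1 z = w := by
    have h2 := tderiv_comp (x := g) (g := fun h : G => g * h) (f := fun h : G => g⁻¹ * h)
      (mdiff_mul_left (E := EG) _ _) (mdiff_mul_left (E := EG) _ _)
    have h3 : (fun h : G => g * h) ∘ (fun h : G => g⁻¹ * h) = fun h => h := by ext; simp
    rw [h3, tderiv_id, inv_mul_cancel] at h2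
    exact ⟨_, (DFunLike.congr_fun h2 w).symm⟩
  have hv := DFunLike.congr_fun hd ![(u, 0), (v, 0), (0, z)]
  have t1 := smoothNear_pull_fst (E := EG) (I' := 𝓘(ℝ, EG)) (x := (g, (1 : G)))
    (smoothNear_thetaL (E := EG) g)
  have t2 := smoothNear_pull_snd (E := EG) (I' := 𝓘(ℝ, EG)) (x := (g, (1 : G)))
    (smoothNear_thetaR (EG := EG) (1 : G))
  have r2 : ∀ w : EG, thetaR EG G 1 ![w] = w := by
    intro w; rw [thetaR_eq, thetaL_one, Ad_one]; rfl
  -- the components of `dθ^R` and `dΘ` that have a vanishing argument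
  have z2 : ∀ y : EG, (extD 𝓘(ℝ, EG) (thetaR EG G) 1 : EG [⋀^Fin 2]→L[ℝ] EG) ![0, y] = 0 :=
    fun y => ContinuousAlternatingMap.map_coord_zero _ 0 rfl
  have z3 : ∀ (ψ : EG [⋀^Fin (2 + 1)]→L[ℝ] F) (y y' : EG), ψ ![y, y', 0] = 0 :=
    fun ψ y y' => ψ.map_coord_zero 2 rfl
  have z3' : ∀ (ψ : EG [⋀^Fin (2 + 1)]→L[ℝ] F) (y y' : EG), ψ ![0, y, y'] = 0 :=
    fun ψ y y' => ψ.map_coord_zero 0 rfl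
  have hL : extD I₂ c.prodForm (g, 1) ![(u, 0), (v, 0), (0, z)] =
      c.pairing (bracket EG G (thetaL EG G g ![u]) (thetaL EG G g ![v])) z := by
    unfold prodForm
    rw [extD_neg, ContinuousAlternatingMap.neg_apply]
    refine (congrArg Neg.neg (extD_wedge_one_one c.pairing t1 t2 _ _ _)).trans ?_
    rw [extD_pull contMDiffAt_fst (smoothNear_thetaL (E := EG) _).contDiffAt,
      extD_pull contMDiffAt_snd (smoothNear_thetaR (EG := EG) _).contDiffAt]
    simp only [pull_extD_apply_two, pull_apply_one, tderiv_fst, tderiv_snd,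
      ContinuousLinearMap.coe_fst', ContinuousLinearMap.coe_snd', extD_thetaL, z2, r2,
      thetaL_zero, map_zero, map_neg, neg_apply,
      sub_zero, add_zero, neg_neg]
  rw [hL] at hv
  rw [hΘ.isCurving.extD_eq c.isConnective hg ht, thetaL_mul_left, hv]
  simp only [ContinuousAlternatingMap.add_apply, ContinuousAlternatingMap.neg_apply,
    pull_extD_apply_three, tderiv_fst, tderiv_snd, ContinuousLinearMap.coe_fst',
    ContinuousLinearMap.coe_snd', z3, z3', neg_zero, add_zero, zero_add,
    tderiv_prod_apply (hm.mdifferentiable (by simp) _), map_zero, mul_one]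
  rw [tderiv_id]
  rfl

end MultConnective

end MultGerbes

/-! ### Algebra of invariant pairings on a Lie algebra -/

section InvariantForms

variable {E F : Type*} [NormedAddCommGroup E] [NormedSpace ℝ E] [NormedAddCommGroup F]
  [NormedSpace ℝ F] {K : E →L[ℝ] E →L[ℝ] F} {b : E →L[ℝ] E →L[ℝ] E}

/-- For a symmetric invariant pairing, the trilinear form `⟨u, [v, w]⟩` is cyclically symmetric (and
hence alternating). -/
theorem cyclic_of_invariant (hsymm : ∀ u v, K u v = K v u) (hb : ∀ u v, b u v = -b v u)
    (hK : ∀ u v w, K (b u w) v + K u (b v w) = 0) (u v w : E) : K u (b v w) = K v (b w u) := by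
  rw [hb w u, map_neg, hsymm v, eq_neg_iff_add_eq_zero, add_comm]
  exact hK u v w

/-- The algebra behind the invariance of `Ĥ + CS(A)` under the action: the change of the
Chern-Simons form when `(a, da)` with values `x, y, z` and `dxy, …` is replaced by
`(a + τ, da - [a ∧ τ] - ½ [τ ∧ τ])`, where `τ` has the values `p, q, r`. -/
theorem chernSimons_gauge (hsymm : ∀ u v, K u v = K v u) (hb : ∀ u v, b u v = -b v u)
    (hK : ∀ u v w, K (b u w) v + K u (b v w) = 0) {x y z p q r dxy dxz dyz Dxy Dxz Dyz : E}
    (h1 : Dxy = dxy + b y p - b x q - b p q) (h2 : Dxz = dxz + b z p - b x r - b p r)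
    (h3 : Dyz = dyz + b z q - b y r - b q r) :
    (K (b p q) r - (K Dxy r - K Dxz q + K Dyz p -
        (K (x + p) (-b q r) - K (y + q) (-b p r) + K (z + r) (-b p q)))) +
      ((K Dxy (z + r) - K Dxz (y + q) + K Dyz (x + p)) +
        (2 : ℝ) • K (x + p) (b (y + q) (z + r))) =
      (K dxy z - K dxz y + K dyz x) + (2 : ℝ) • K x (b y z) := by
  have hc := cyclic_of_invariant hsymm hb hK
  have hX : ∀ X Y Z, K Y (b X Z) = -K X (b Y Z) := fun X Y Z => by
    rw [hc, hb Z Y, map_neg]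
  have hZ : ∀ X Z Y, K Z (b X Y) = K X (b Y Z) := fun X Z Y => hc _ _ _
  have hs : ∀ w u v, K (b u v) w = K w (b u v) := fun w u v => hsymm _ _
  subst h1 h2 h3
  -- every cubic term becomes a multiple of one with its arguments in the order of their slots
  simp only [map_add, map_sub, map_neg, add_apply, sub_apply, neg_apply,
    hb y p, hb z p, hb z q, hX x y, hX x q, hX p y, hX p q,
    hZ x z, hZ x r, hZ p z, hZ p r, hs x, hs p, hs y, hs q, hs z, hs r]
  module

/-- The algebra behind `d CS(A) = ⟨F_A ∧ F_A⟩`: the variables `xᵢ` are the values of `A` on four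
vectors, and `dᵢⱼ` those of `dA`. -/
theorem chernSimons_differential (hsymm : ∀ u v, K u v = K v u) (hb : ∀ u v, b u v = -b v u)
    (hK : ∀ u v w, K (b u w) v + K u (b v w) = 0)
    (hJ : ∀ u v w, b u (b v w) + b v (b w u) + b w (b u v) = 0)
    (x0 x1 x2 x3 d01 d02 d03 d12 d13 d23 : E) :
    (K d01 d23 - K d02 d13 + K d03 d12 + K d12 d03 - K d13 d02 + K d23 d01) +
      (1 / 3 : ℝ) • ((K d01 (b x2 x3 - b x3 x2) - K d02 (b x1 x3 - b x3 x1) +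
          K d03 (b x1 x2 - b x2 x1) + K d12 (b x0 x3 - b x3 x0) - K d13 (b x0 x2 - b x2 x0) +
          K d23 (b x0 x1 - b x1 x0)) -
        (K x0 (b d12 x3 - b d13 x2 + b d23 x1 - (b x1 d23 - b x2 d13 + b x3 d12)) -
          K x1 (b d02 x3 - b d03 x2 + b d23 x0 - (b x0 d23 - b x2 d03 + b x3 d02)) +
          K x2 (b d01 x3 - b d03 x1 + b d13 x0 - (b x0 d13 - b x1 d03 + b x3 d01)) -
          K x3 (b d01 x2 - b d02 x1 + b d12 x0 - (b x0 d12 - b x1 d02 + b x2 d01)))) =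
    K (d01 + b x0 x1) (d23 + b x2 x3) - K (d02 + b x0 x2) (d13 + b x1 x3) +
      K (d03 + b x0 x3) (d12 + b x1 x2) + K (d12 + b x1 x2) (d03 + b x0 x3) -
      K (d13 + b x1 x3) (d02 + b x0 x2) + K (d23 + b x2 x3) (d01 + b x0 x1) := by
  have hc := cyclic_of_invariant hsymm hb hK
  have hd : ∀ d u v, K u (b d v) = K d (b v u) := fun d u v => hc _ _ _
  have hs : ∀ w u v, K (b u v) w = K w (b u v) := fun w u v => hsymm _ _
  -- the quartic terms cancel by the Jacobi identity
  have hq : K (b x0 x1) (b x2 x3) - K (b x0 x2) (b x1 x3) + K (b x0 x3) (b x1 x2) = 0 := by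
    have h : ∀ u v w, K (b x0 u) (b v w) = K x0 (b u (b v w)) := fun u v w => by
      rw [hsymm, hc]
    rw [h, h, h, ← map_sub, ← map_add, hb x1 x3, map_neg, sub_neg_eq_add, hJ, map_zero]
  have hq' : K (b x2 x3) (b x0 x1) - K (b x1 x3) (b x0 x2) + K (b x1 x2) (b x0 x3) = 0 := by
    rw [hsymm, hsymm (b x1 x3), hsymm (b x1 x2), hq]
  have hexp : ∀ d e u v w z, K (d + b u v) (e + b w z) =
      K d e + K d (b w z) + K e (b u v) + K (b u v) (b w z) := fun d e u v w z => by
    simp only [map_add, add_apply, hsymm (b u v) e]; abel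
  simp only [hexp]
  -- the remaining terms `⟨dᵢⱼ, [xₖ, xₗ]⟩` are brought to the form with `k < l`
  have hR := congrArg₂ (· + ·) hq hq'
  simp only [map_add, map_sub, map_neg, hb x2 d01, hb x3 d01, hb x1 d02, hb x3 d02, hb x1 d03,
    hb x2 d03, hb x0 d12, hb x3 d12, hb x0 d13, hb x2 d13, hb x0 d23, hb x1 d23, hd d01, hd d02,
    hd d03, hd d12, hd d13, hd d23, hb x1 x0, hb x2 x0, hb x3 x0, hb x2 x1, hb x3 x1, hb x3 x2]
  rw [add_zero] at hR
  linear_combination (norm := module) (-1 : ℝ) • hR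

end InvariantForms

/-! ### Connections on principal bundles -/

section PrincipalConnections

variable {EG G EM M EP P V : Type*}
    [NormedAddCommGroup EG] [NormedSpace ℝ EG]
    [TopologicalSpace G] [ChartedSpace EG G] [Group G]
    [NormedAddCommGroup EM] [NormedSpace ℝ EM]
    [TopologicalSpace M] [ChartedSpace EM M]
    [NormedAddCommGroup EP] [NormedSpace ℝ EP]
    [TopologicalSpace P] [ChartedSpace EP P]
    [NormedAddCommGroup V] [NormedSpace ℝ V]
    (Q : PrincipalBundle EM M EP P EG G)

local notation "Iₚ" => ModelWithCorners.prod 𝓘(ℝ, EP) 𝓘(ℝ, EG)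

namespace PrincipalBundle

/-- A local section `s` over an open set `U`, together with the smooth function `γ` on its preimage
such that `s (proj p) = p · γ p`. Both are total functions whose values elsewhere are irrelevant. -/
structure LocalSection where
  U : Set M
  isOpen : IsOpen U
  s : M → P
  smooth : ContMDiffOn 𝓘(ℝ, EM) 𝓘(ℝ, EP) ∞ s U
  proj_s : ∀ x ∈ U, Q.proj (s x) = x
  γ : P → G
  γ_smooth : ContMDiffOn 𝓘(ℝ, EP) 𝓘(ℝ, EG) ∞ γ (Q.proj ⁻¹' U)
  s_proj : ∀ p ∈ Q.proj ⁻¹' U, s (Q.proj p) = Q.act (p, γ p)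

theorem exists_localSection [LieGroup 𝓘(ℝ, EG) ∞ G] (x : M) : ∃ S : Q.LocalSection, x ∈ S.U := by
  obtain ⟨U, e, hU, hx, hs, ht, h1, h2, he, he'⟩ := Q.locTriv x
  refine ⟨⟨U, hU, fun y => e.symm (y, 1), ?_, ?_, fun p => (e p).2⁻¹, ?_, ?_⟩, hx⟩
  · refine he'.comp (contMDiff_id.prodMk contMDiff_const).contMDiffOn fun y hy => ?_
    rw [ht]
    exact ⟨hy, trivial⟩
  · intro y hy
    have hy' : (y, (1 : G)) ∈ e.target := by rw [ht]; exact ⟨hy, trivial⟩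
    have hy2 : e.symm (y, 1) ∈ Q.proj ⁻¹' U := by rw [← hs]; exact e.map_target hy'
    rw [← h1 _ hy2, e.right_inv hy']
  · rw [← hs]
    exact (contMDiff_inv 𝓘(ℝ, EG) ∞).comp_contMDiffOn (contMDiff_snd.comp_contMDiffOn he)
  · intro p hp
    obtain ⟨h3, h4⟩ := h2 p hp (e p).2⁻¹
    have hp' : Q.act (p, (e p).2⁻¹) ∈ Q.proj ⁻¹' U := by
      change Q.proj _ ∈ U
      rw [h3]; exact hp
    have h5 : e (Q.act (p, (e p).2⁻¹)) = (Q.proj p, 1) :=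
      Prod.ext ((h1 _ hp').trans h3) (by rw [h4, mul_inv_cancel])
    rw [← h5, e.left_inv (by rw [hs]; exact hp')]

variable {Q} (S : Q.LocalSection) {k : ℕ}

theorem LocalSection.contMDiffAt {x : M} (hx : x ∈ S.U) :
    ContMDiffAt 𝓘(ℝ, EM) 𝓘(ℝ, EP) ∞ S.s x :=
  S.smooth.contMDiffAt (S.isOpen.mem_nhds hx)

theorem LocalSection.isOpen_preimage : IsOpen (Q.proj ⁻¹' S.U) :=
  S.isOpen.preimage Q.proj_smooth.continuous

theorem LocalSection.contMDiffAt_γ {p : P} (hp : Q.proj p ∈ S.U) :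
    ContMDiffAt 𝓘(ℝ, EP) Iₚ ∞ (fun p => (p, S.γ p)) p :=
  contMDiffAt_id.prodMk (S.γ_smooth.contMDiffAt (S.isOpen_preimage.mem_nhds hp))

theorem LocalSection.pull_proj_pull_s {p : P} (hp : Q.proj p ∈ S.U) (φ : DForm EP P k V) :
    pull 𝓘(ℝ, EP) 𝓘(ℝ, EM) Q.proj (pull 𝓘(ℝ, EM) 𝓘(ℝ, EP) S.s φ) p =
      pull 𝓘(ℝ, EP) Iₚ (fun p => (p, S.γ p)) (pull Iₚ 𝓘(ℝ, EP) Q.act φ) p := by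
  rw [pull_comp _ ((S.contMDiffAt hp).mdifferentiableAt (by simp))
      (Q.proj_smooth.mdifferentiable (by simp) p),
    pull_comp (I' := Iₚ) _ (Q.act_smooth.mdifferentiable (by simp) _)
      ((S.contMDiffAt_γ hp).mdifferentiableAt (by simp))]
  refine pull_congr ?_ φ
  filter_upwards [S.isOpen_preimage.mem_nhds hp] with q hq using S.s_proj q hq

theorem LocalSection.pull_γ_pull_fst {p : P} (hp : Q.proj p ∈ S.U) (φ : DForm EP P k V) :
    pull 𝓘(ℝ, EP) Iₚ (fun p => (p, S.γ p)) (pull Iₚ 𝓘(ℝ, EP) Prod.fst φ) p = φ p := by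
  rw [pull_comp (I' := Iₚ) (g := Prod.fst) _ mdifferentiableAt_fst
    ((S.contMDiffAt_γ hp).mdifferentiableAt (by simp))]
  exact congrFun (pull_id φ) p

/-- A form on the total space with `act^* φ = p^* φ` is basic: it is the pull-back of its
restriction along any local section. -/
theorem LocalSection.pull_proj_pull_s_eq {φ : DForm EP P k V}
    (hφ : ∀ x, pull Iₚ 𝓘(ℝ, EP) Q.act φ x = pull Iₚ 𝓘(ℝ, EP) Prod.fst φ x) {p : P}
    (hp : Q.proj p ∈ S.U) :
    pull 𝓘(ℝ, EP) 𝓘(ℝ, EM) Q.proj (pull 𝓘(ℝ, EM) 𝓘(ℝ, EP) S.s φ) p = φ p := by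
  rw [S.pull_proj_pull_s hp, funext hφ, S.pull_γ_pull_fst hp]

theorem LocalSection.pull_s_pull_proj {x : M} (hx : x ∈ S.U) (H : DForm EM M k V) :
    pull 𝓘(ℝ, EM) 𝓘(ℝ, EP) S.s (pull 𝓘(ℝ, EP) 𝓘(ℝ, EM) Q.proj H) x = H x := by
  rw [pull_comp _ (Q.proj_smooth.mdifferentiable (by simp) _)
    ((S.contMDiffAt hx).mdifferentiableAt (by simp)), pull_congr (g := fun z => z), pull_id]
  filter_upwards [S.isOpen.mem_nhds hx] with y hy using S.proj_s y hy

/-- Basic smooth forms on the total space descend, uniquely, to the base: the form on the base is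
the pull-back along local sections, whose choice does not matter. -/
theorem existsUnique_pull_proj (Q : PrincipalBundle EM M EP P EG G)
    [LieGroup 𝓘(ℝ, EG) ∞ G] [FiniteDimensional ℝ EM] [FiniteDimensional ℝ V]
    [IsManifold 𝓘(ℝ, EM) ∞ M] [IsManifold 𝓘(ℝ, EP) ∞ P]
    {φ : DForm EP P k V} (hs : ∀ p, SmoothNear 𝓘(ℝ, EP) φ p)
    (hφ : ∀ x, pull Iₚ 𝓘(ℝ, EP) Q.act φ x = pull Iₚ 𝓘(ℝ, EP) Prod.fst φ x) :
    ∃! H : DForm EM M k V, SmoothForm 𝓘(ℝ, EM) H Set.univ ∧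
      pull 𝓘(ℝ, EP) 𝓘(ℝ, EM) Q.proj H = φ := by
  choose S hS using Q.exists_localSection
  have huniq : ∀ H, pull 𝓘(ℝ, EP) 𝓘(ℝ, EM) Q.proj H = φ → ∀ (S : Q.LocalSection) x, x ∈ S.U →
      H x = pull 𝓘(ℝ, EM) 𝓘(ℝ, EP) S.s φ x := by
    rintro H rfl S x hx
    exact (S.pull_s_pull_proj hx H).symm
  set H : DForm EM M k V := fun x => pull 𝓘(ℝ, EM) 𝓘(ℝ, EP) (S x).s φ x with hH
  have hp : pull 𝓘(ℝ, EP) 𝓘(ℝ, EM) Q.proj H = φ := by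
    funext p
    exact (pull_congr_form rfl).trans ((S (Q.proj p)).pull_proj_pull_s_eq hφ (hS _))
  refine ⟨H, ⟨smoothForm_of_smoothNear fun x _ => ?_, hp⟩, ?_⟩
  · refine SmoothNear.congr (φ := pull 𝓘(ℝ, EM) 𝓘(ℝ, EP) (S x).s φ) (SmoothNear.pull ?_ (hs _)) ?_
    · filter_upwards [(S x).isOpen.mem_nhds (hS x)] with y hy using (S x).contMDiffAt hy
    · filter_upwards [(S x).isOpen.mem_nhds (hS x)] with y hy using (huniq H hp _ y hy).symm
  · rintro H' ⟨-, h'⟩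
    funext x
    exact huniq H' h' _ x (hS x)

variable {A : DForm EP P 1 EG}

theorem IsConnection.smoothNear (hA : Q.IsConnection A) (p : P) : SmoothNear 𝓘(ℝ, EP) A p :=
  hA.smooth.smoothNear isOpen_univ trivial

theorem IsConnection.pull_act_apply (hA : Q.IsConnection A) (x : P × G) (X : EP × EG) :
    pull Iₚ 𝓘(ℝ, EP) Q.act A x ![X] =
      Ad x.2⁻¹ (A x.1 ![X.1]) + thetaL EG G x.2 ![X.2] := by
  rw [hA.equivariant, ContinuousAlternatingMap.add_apply,
    ContinuousLinearMap.compContinuousAlternatingMap_coe, Function.comp_apply, pull_apply_one,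
    pull_apply_one, tderiv_fst, tderiv_snd]
  rfl

variable [FiniteDimensional ℝ EG] [LieGroup 𝓘(ℝ, EG) ∞ G]

theorem curvatureForm_apply (A : DForm EP P 1 EG) (p : P) (u v : EP) :
    curvatureForm G A p ![u, v] =
      extD 𝓘(ℝ, EP) A p ![u, v] + bracket EG G (A p ![u]) (A p ![v]) := by
  refine congrArg (fun z => extD 𝓘(ℝ, EP) A p ![u, v] + (1 / 2 : ℝ) • z)
    (wedgeAlt_one_one (bracket EG G) (A p) (A p) u v) |>.trans ?_
  rw [bracket_swap (A p ![v])]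
  module

variable [FiniteDimensional ℝ EP] [IsManifold 𝓘(ℝ, EP) ∞ P]

theorem IsConnection.smoothNear_curvatureForm (hA : Q.IsConnection A) (p : P) :
    SmoothNear 𝓘(ℝ, EP) (curvatureForm G A) p :=
  (hA.smoothNear p).extD.add (((hA.smoothNear p).wedge _ (hA.smoothNear p)).const_smul _)

/-- The exterior derivative of `act^* A = Ad(g⁻¹) p^* A + g^* θ^L`. -/
theorem IsConnection.pull_act_extD_apply (hA : Q.IsConnection A) (x : P × G) (X Y : EP × EG) :
    pull Iₚ 𝓘(ℝ, EP) Q.act (extD 𝓘(ℝ, EP) A) x ![X, Y] =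
      Ad x.2⁻¹ (extD 𝓘(ℝ, EP) A x.1 ![X.1, Y.1]) +
        bracket EG G (Ad x.2⁻¹ (A x.1 ![Y.1])) (thetaL EG G x.2 ![X.2]) -
        bracket EG G (Ad x.2⁻¹ (A x.1 ![X.1])) (thetaL EG G x.2 ![Y.2]) -
        bracket EG G (thetaL EG G x.2 ![X.2]) (thetaL EG G x.2 ![Y.2]) := by
  have h1 := smoothNear_pull_fst (E := EG) (x := x) (hA.smoothNear x.1)
  have h2 := smoothNear_pull_snd (E := EG) (I' := 𝓘(ℝ, EP)) (x := x)
    (smoothNear_thetaL (E := EG) x.2)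
  have h3 := extD_add (h1.clm_comp (contMDiff_Ad_inv_snd (I' := 𝓘(ℝ, EP)))) h2
  have h := extD_pull (Q.act_smooth x) (hA.smoothNear (Q.act x)).contDiffAt
  rw [funext hA.equivariant] at h
  rw [← h]
  refine (DFunLike.congr_fun h3 ![X, Y]).trans ?_
  rw [ContinuousAlternatingMap.add_apply, extD_Ad_comp (I' := 𝓘(ℝ, EP)) h1,
    extD_pull contMDiffAt_fst (hA.smoothNear x.1).contDiffAt,
    extD_pull contMDiffAt_snd (smoothNear_thetaL (E := EG) x.2).contDiffAt]
  simp only [pull_extD_apply_two, pull_apply_one, tderiv_fst, tderiv_snd, extD_thetaL,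
    ContinuousLinearMap.coe_fst', ContinuousLinearMap.coe_snd']
  abel

/-- The curvature is equivariant, and its pull-back to `P × G` has no component along `G`. -/
theorem IsConnection.pull_act_curvatureForm (hA : Q.IsConnection A) (x : P × G) :
    pull Iₚ 𝓘(ℝ, EP) Q.act (curvatureForm G A) x =
      (Ad x.2⁻¹).compContinuousAlternatingMap
        (pull Iₚ 𝓘(ℝ, EP) Prod.fst (curvatureForm G A) x) := by
  ext v
  rw [comp_vec2 v, ContinuousLinearMap.compContinuousAlternatingMap_coe, Function.comp_apply,
    pull_apply_two, pull_apply_two, curvatureForm_apply, curvatureForm_apply, tderiv_fst,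
    ← pull_extD_apply_two, hA.pull_act_extD_apply, ← pull_apply_one, ← pull_apply_one,
    hA.pull_act_apply, hA.pull_act_apply]
  simp only [map_add, add_apply, Ad_bracket, ContinuousLinearMap.coe_fst']
  rw [bracket_swap (thetaL EG G x.2 ![(v 0).2]) (Ad x.2⁻¹ _)]
  abel

theorem IsConnection.isTensorial_curvatureForm (hA : Q.IsConnection A) :
    Q.IsTensorial (curvatureForm G A) := by
  refine ⟨smoothForm_of_smoothNear fun p _ => hA.smoothNear_curvatureForm p, ?_, ?_⟩
  · rintro p v ⟨i, hi⟩
    obtain ⟨S, hS⟩ := Q.exists_localSection (Q.proj p)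
    -- `F_A` agrees up to `Ad` with a form pulled back from the base
    have h1 := S.pull_proj_pull_s hS (curvatureForm G A)
    have h2 : pull 𝓘(ℝ, EP) Iₚ (fun p => (p, S.γ p))
        (pull Iₚ 𝓘(ℝ, EP) Q.act (curvatureForm G A)) p =
        (Ad (S.γ p)⁻¹).compContinuousAlternatingMap (curvatureForm G A p) := by
      rw [← S.pull_γ_pull_fst hS (curvatureForm G A), funext hA.pull_act_curvatureForm]
      rfl
    have h3 := DFunLike.congr_fun (h1.trans h2) v
    have h4 : pull 𝓘(ℝ, EP) 𝓘(ℝ, EM) Q.proj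
        (pull 𝓘(ℝ, EM) 𝓘(ℝ, EP) S.s (curvatureForm G A)) p v = 0 :=
      (pull 𝓘(ℝ, EM) 𝓘(ℝ, EP) S.s (curvatureForm G A) (Q.proj p)).map_coord_zero i hi
    rw [h4] at h3
    have h5 := congrArg (Ad (S.γ p)) h3
    rw [map_zero] at h5
    exact (h5.trans (Ad_Ad_inv _ _)).symm
  · intro p g
    have hi : ContMDiff 𝓘(ℝ, EP) Iₚ ∞ (fun q : P => (q, g)) := contMDiff_id.prodMk contMDiff_const
    have h1 := pull_comp (I' := Iₚ) (g := Q.act) (f := fun q : P => (q, g)) (x := p)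
      (curvatureForm G A) (Q.act_smooth.mdifferentiable (by simp) _)
      (hi.mdifferentiable (by simp) _)
    have h2 := pull_comp (I' := Iₚ) (g := Prod.fst) (f := fun q : P => (q, g)) (x := p)
      (curvatureForm G A) mdifferentiableAt_fst (hi.mdifferentiable (by simp) _)
    rw [← h1, funext hA.pull_act_curvatureForm,
      ← congrFun (pull_id (I := 𝓘(ℝ, EP)) (curvatureForm G A)) p]
    exact congrArg (Ad g⁻¹ : EG →L[ℝ] EG).compContinuousAlternatingMap h2

theorem IsConnection.extD_wedge_bracket_apply (hA : Q.IsConnection A) (p : P) (u v w : EP) :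
    extD 𝓘(ℝ, EP) (wedge (bracket EG G) A A) p ![u, v, w] =
      bracket EG G (extD 𝓘(ℝ, EP) A p ![u, v]) (A p ![w]) -
        bracket EG G (extD 𝓘(ℝ, EP) A p ![u, w]) (A p ![v]) +
        bracket EG G (extD 𝓘(ℝ, EP) A p ![v, w]) (A p ![u]) -
      (bracket EG G (A p ![u]) (extD 𝓘(ℝ, EP) A p ![v, w]) -
        bracket EG G (A p ![v]) (extD 𝓘(ℝ, EP) A p ![u, w]) +
        bracket EG G (A p ![w]) (extD 𝓘(ℝ, EP) A p ![u, v])) :=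
  extD_wedge_one_one _ (hA.smoothNear p) (hA.smoothNear p) u v w

/-- The Bianchi identity for `F_A`: `d ½ [A ∧ A]` cancels `[A ∧ dA]`, and `[A ∧ [A ∧ A]] = 0` by the
Jacobi identity. -/
theorem IsConnection.covD_curvatureForm (hA : Q.IsConnection A) :
    covD G A (curvatureForm G A) = 0 := by
  funext p
  ext v
  rw [comp_vec3 v]
  have hs := hA.smoothNear p
  have h1 : extD 𝓘(ℝ, EP) (curvatureForm G A) p =
      (1 / 2 : ℝ) • extD 𝓘(ℝ, EP) (wedge (bracket EG G) A A) p := by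
    unfold curvatureForm
    rw [extD_add hs.extD ((hs.wedge _ hs).const_smul _), extD_extD hs, extD_smul, zero_add]
  have h2 := wedgeAlt_one_two (bracket EG G) (A p) (curvatureForm G A p) (v 0) (v 1) (v 2)
  simp only [curvatureForm_apply] at h2
  refine (congrArg₂ (· + ·) (DFunLike.congr_fun h1 ![v 0, v 1, v 2]) h2).trans ?_
  have h3 := hA.extD_wedge_bracket_apply p (v 0) (v 1) (v 2)
  refine (congrArg (fun z => (1 / 2 : ℝ) • z + _) h3).trans ?_
  have hJ := bracket_jacobi (G := G) (A p ![v 0]) (A p ![v 1]) (A p ![v 2])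
  rw [bracket_swap (A p ![v 2]) (A p ![v 0]), map_neg] at hJ
  rw [bracket_swap (extD 𝓘(ℝ, EP) A p ![v 0, v 1]), bracket_swap (extD 𝓘(ℝ, EP) A p ![v 0, v 2]),
    bracket_swap (extD 𝓘(ℝ, EP) A p ![v 1, v 2])]
  simp only [map_add]
  refine Eq.trans ?_ hJ
  module

end PrincipalBundle

end PrincipalConnections

/-! ### Connections on bundles of multiplicative gerbes -/

section GerbeBundles

variable {EG G F T EM M EP P : Type*}
    [NormedAddCommGroup EG] [NormedSpace ℝ EG] [FiniteDimensional ℝ EG]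
    [TopologicalSpace G] [ChartedSpace EG G] [Group G] [LieGroup 𝓘(ℝ, EG) ∞ G]
    [NormedAddCommGroup F] [NormedSpace ℝ F]
    [TopologicalSpace T] [ChartedSpace F T] [CommGroup T] [LieGroup 𝓘(ℝ, F) ∞ T]
    [NormedAddCommGroup EM] [NormedSpace ℝ EM]
    [TopologicalSpace M] [ChartedSpace EM M]
    [NormedAddCommGroup EP] [NormedSpace ℝ EP]
    [TopologicalSpace P] [ChartedSpace EP P]
    {𝒢 : MultGerbe.{w} EG G F T} {c : MultConnective 𝒢}
    {Θ : 𝒢.gerbe.ι → DForm EG G 2 F}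
    {Q : PrincipalBundle EM M EP P EG G} {𝓑 : GerbeBundle 𝒢 Q}

local notation "Iₚ" => ModelWithCorners.prod 𝓘(ℝ, EP) 𝓘(ℝ, EG)

/-- The Chern-Simons form in terms of `⟨dA ∧ A⟩` and `⟨A, [A, A]⟩`; the latter is already
alternating, so that `⅓ ⟨A ∧ [A ∧ A]⟩` is twice its value. -/
theorem MultConnective.IsMaurerCartan.chernSimons_apply [FiniteDimensional ℝ F]
    (hΘ : c.IsMaurerCartan Θ) (A : DForm EP P 1 EG) (p : P) (u v w : EP) :
    chernSimons G c.pairing A p ![u, v, w] =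
      (c.pairing (extD 𝓘(ℝ, EP) A p ![u, v]) (A p ![w]) -
        c.pairing (extD 𝓘(ℝ, EP) A p ![u, w]) (A p ![v]) +
        c.pairing (extD 𝓘(ℝ, EP) A p ![v, w]) (A p ![u])) +
      (2 : ℝ) • c.pairing (A p ![u]) (bracket EG G (A p ![v]) (A p ![w])) := by
  have h1 := wedgeAlt_two_one c.pairing (extD 𝓘(ℝ, EP) A p) (A p) u v w
  have h2 := wedgeAlt_one_two c.pairing (A p) (wedgeAlt (bracket EG G) (A p) (A p)) u v w
  simp only [wedgeAlt_one_one] at h2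
  refine (congrArg₂ (fun y z => y + (1 / 3 : ℝ) • z) h1 h2).trans ?_
  have hc := cyclic_of_invariant c.pairing_symm (bracket_swap (E := EG) (G := G))
    hΘ.pairing_bracket
  -- by invariance the three terms of `⟨A ∧ [A ∧ A]⟩` coincide
  simp only [bracket_swap (A p ![w]) (A p ![u]), bracket_swap (A p ![v]) (A p ![u]),
    hc (A p ![v]) (A p ![u]) (A p ![w]), hc (A p ![w]), map_neg, map_sub,
    bracket_swap (A p ![w]) (A p ![v])]
  module

namespace GerbeBundle.Connection

variable (a : 𝓑.Connection c Θ)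

theorem smoothNear_B {i : 𝓑.gerbe.ι} {p : P} (hp : p ∈ 𝓑.gerbe.U i) :
    SmoothNear 𝓘(ℝ, EP) (a.B i) p :=
  (a.isCurving.smooth i).smoothNear (𝓑.gerbe.isOpen i) hp

theorem curvature_eventuallyEq [IsManifold 𝓘(ℝ, EP) ∞ P] {i : 𝓑.gerbe.ι} {p : P}
    (hp : p ∈ 𝓑.gerbe.U i) :
    𝓑.gerbe.curvature a.B =ᶠ[𝓝 p] extD 𝓘(ℝ, EP) (a.B i) := by
  filter_upwards [(𝓑.gerbe.isOpen i).mem_nhds hp] with q hq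
    using a.isCurving.curvature_eq a.isConnective hq

theorem smoothNear_curvature [IsManifold 𝓘(ℝ, EP) ∞ P] (p : P) :
    SmoothNear 𝓘(ℝ, EP) (𝓑.gerbe.curvature a.B) p := by
  obtain ⟨i, hi⟩ := 𝓑.gerbe.cover p
  exact (a.smoothNear_B hi).extD.congr (a.curvature_eventuallyEq hi).symm

theorem extD_curvature [IsManifold 𝓘(ℝ, EP) ∞ P] (p : P) :
    extD 𝓘(ℝ, EP) (𝓑.gerbe.curvature a.B) p = 0 := by
  obtain ⟨i, hi⟩ := 𝓑.gerbe.cover p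
  rw [extD_congr (a.curvature_eventuallyEq hi), extD_extD (a.smoothNear_B hi)]

variable [FiniteDimensional ℝ F]

/-- The curvature `-⟨p^* A ∧ g^* θ^R⟩` of the action, rewritten in terms of `act^* A` and `θ^L`. -/
theorem wedge_thetaR_eq (hΘ : c.IsMaurerCartan Θ) :
    wedge c.pairing (pull Iₚ 𝓘(ℝ, EP) (Prod.fst : P × G → P) a.A)
      (pull Iₚ 𝓘(ℝ, EG) (Prod.snd : P × G → G) (thetaR EG G)) =
    wedge c.pairing (pull Iₚ 𝓘(ℝ, EP) Q.act a.A)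
      (pull Iₚ 𝓘(ℝ, EG) (Prod.snd : P × G → G) (thetaL EG G)) := by
  funext x
  ext v
  rw [comp_vec2 v]
  refine (wedgeAlt_one_one _ _ _ _ _).trans (Eq.trans ?_ (wedgeAlt_one_one _ _ _ _ _).symm)
  simp only [a.isGConnection.pull_act_apply, pull_apply_one, tderiv_fst, tderiv_snd, thetaR_eq,
    ContinuousLinearMap.coe_fst', ContinuousLinearMap.coe_snd', ← hΘ.pairing_Ad_left, map_add,
    add_apply]
  rw [c.pairing_symm (thetaL EG G x.2 ![(v 1).2])]
  abel

variable [FiniteDimensional ℝ EP] [IsManifold 𝓘(ℝ, EP) ∞ P]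

theorem smoothNear_chernSimons (K : EG →L[ℝ] EG →L[ℝ] F) (p : P) :
    SmoothNear 𝓘(ℝ, EP) (chernSimons G K a.A) p := by
  have h := a.isGConnection.smoothNear p
  exact (h.extD.wedge K h).add ((h.wedge K (h.wedge _ h)).const_smul _)

/-- The behaviour of `Ĥ` under the action, from the exterior derivative of the curvature condition:
`act^* Ĥ = p^* Ĥ + g^* dΘ^L - d⟨act^* A ∧ g^* θ^L⟩`. -/
theorem pull_act_curvature_apply (hΘ : c.IsMaurerCartan Θ) (x : P × G) (X Y Z : EP × EG) :
    pull Iₚ 𝓘(ℝ, EP) Q.act (𝓑.gerbe.curvature a.B) x ![X, Y, Z] =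
      pull Iₚ 𝓘(ℝ, EP) Prod.fst (𝓑.gerbe.curvature a.B) x ![X, Y, Z] +
      (c.pairing (bracket EG G (thetaL EG G x.2 ![X.2]) (thetaL EG G x.2 ![Y.2]))
          (thetaL EG G x.2 ![Z.2]) -
        extD Iₚ (wedge c.pairing (pull Iₚ 𝓘(ℝ, EP) Q.act a.A)
          (pull Iₚ 𝓘(ℝ, EG) (Prod.snd : P × G → G) (thetaL EG G))) x ![X, Y, Z]) := by
  obtain ⟨r, hr⟩ := 𝓑.ρ.cover x
  obtain ⟨hs1, hs2⟩ := 𝓑.ρ.subset_src r hr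
  have ht : Q.act x ∈ 𝓑.gerbe.U (𝓑.ρ.tgt r) := 𝓑.ρ.subset_tgt r hr
  have hV := 𝓑.ρ.isOpen r
  have hη := (a.isConnection.smooth r).smoothNear hV hr
  have b1 := a.smoothNear_B hs1
  have b3 := a.smoothNear_B ht
  have b2 := (hΘ.isCurving.smooth _).smoothNear (𝒢.gerbe.isOpen _) hs2
  have s1 := smoothNear_pull_fst (E := EG) (I' := 𝓘(ℝ, EP)) (x := x) b1
  have s2 := smoothNear_pull_snd (E := EG) (I' := 𝓘(ℝ, EP)) (x := x) b2
  have s3 : SmoothNear Iₚ (pull Iₚ 𝓘(ℝ, EP) Q.act (a.B (𝓑.ρ.tgt r))) x :=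
    SmoothNear.pull (Eventually.of_forall fun z => Q.act_smooth z) b3
  have he : -wedge c.pairing (pull Iₚ 𝓘(ℝ, EP) Q.act a.A)
      (pull Iₚ 𝓘(ℝ, EG) (Prod.snd : P × G → G) (thetaL EG G)) =ᶠ[𝓝 x] (extD Iₚ (a.η r) +
      -(pull Iₚ 𝓘(ℝ, EP) Prod.fst (a.B (𝓑.ρ.src r).1) +
        pull Iₚ 𝓘(ℝ, EG) Prod.snd (Θ (𝓑.ρ.src r).2))) +
      pull Iₚ 𝓘(ℝ, EP) Q.act (a.B (𝓑.ρ.tgt r)) := by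
    filter_upwards [hV.mem_nhds hr] with y hy
    rw [← a.wedge_thetaR_eq hΘ]
    refine (a.hasCurvature r y hy).trans ?_
    rw [sub_eq_add_neg]
    rfl
  have hd := extD_congr (I := Iₚ) he
  rw [extD_add (hη.extD.add (s1.add s2).neg) s3, extD_add hη.extD (s1.add s2).neg, extD_extD hη,
    extD_neg, extD_neg, extD_add s1 s2, extD_pull contMDiffAt_fst b1.contDiffAt,
    extD_pull contMDiffAt_snd b2.contDiffAt, extD_pull (Q.act_smooth x) b3.contDiffAt,
    zero_add] at hd
  have e1 : pull Iₚ 𝓘(ℝ, EP) Prod.fst (𝓑.gerbe.curvature a.B) x =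
      pull Iₚ 𝓘(ℝ, EP) Prod.fst (extD 𝓘(ℝ, EP) (a.B (𝓑.ρ.src r).1)) x :=
    pull_congr_form (a.isCurving.curvature_eq a.isConnective hs1)
  have e3 : pull Iₚ 𝓘(ℝ, EP) Q.act (𝓑.gerbe.curvature a.B) x =
      pull Iₚ 𝓘(ℝ, EP) Q.act (extD 𝓘(ℝ, EP) (a.B (𝓑.ρ.tgt r))) x :=
    pull_congr_form (a.isCurving.curvature_eq a.isConnective ht)
  have e2 : pull Iₚ 𝓘(ℝ, EG) Prod.snd (extD 𝓘(ℝ, EG) (Θ (𝓑.ρ.src r).2)) x ![X, Y, Z] =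
      c.pairing (bracket EG G (thetaL EG G x.2 ![X.2]) (thetaL EG G x.2 ![Y.2]))
          (thetaL EG G x.2 ![Z.2]) := by
    refine (pull_extD_apply_three _ _ _ _ _ _).trans ?_
    rw [tderiv_snd]
    exact hΘ.extD_apply hs2 _ _ _
  have hv := DFunLike.congr_fun hd ![X, Y, Z]
  rw [← e2, e1, e3]
  have hv' : -(extD Iₚ (wedge c.pairing (pull Iₚ 𝓘(ℝ, EP) Q.act a.A)
        (pull Iₚ 𝓘(ℝ, EG) (Prod.snd : P × G → G) (thetaL EG G))) x ![X, Y, Z]) =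
      -(pull Iₚ 𝓘(ℝ, EP) Prod.fst (extD 𝓘(ℝ, EP) (a.B (𝓑.ρ.src r).1)) x ![X, Y, Z] +
        pull Iₚ 𝓘(ℝ, EG) Prod.snd (extD 𝓘(ℝ, EG) (Θ (𝓑.ρ.src r).2)) x ![X, Y, Z]) +
      pull Iₚ 𝓘(ℝ, EP) Q.act (extD 𝓘(ℝ, EP) (a.B (𝓑.ρ.tgt r))) x ![X, Y, Z] := hv
  rw [sub_eq_add_neg]
  refine Eq.trans ?_ (congrArg (fun z => _ + (_ + z)) hv'.symm)
  abel

/-- The 3-form `Ĥ + CS(A)` is basic: its pull-backs along the action and the projection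
`P × G → P` agree. -/
theorem pull_act_curvature_add_chernSimons (hΘ : c.IsMaurerCartan Θ) (x : P × G) :
    pull Iₚ 𝓘(ℝ, EP) Q.act (𝓑.gerbe.curvature a.B + chernSimons G c.pairing a.A) x =
      pull Iₚ 𝓘(ℝ, EP) Prod.fst (𝓑.gerbe.curvature a.B + chernSimons G c.pairing a.A) x := by
  have hA := a.isGConnection
  ext V
  rw [comp_vec3 V]
  set X := V 0
  set Y := V 1
  set Z := V 2
  rw [pull_add, pull_add]
  change pull Iₚ 𝓘(ℝ, EP) Q.act (𝓑.gerbe.curvature a.B) x ![X, Y, Z] +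
    pull Iₚ 𝓘(ℝ, EP) Q.act (chernSimons G c.pairing a.A) x ![X, Y, Z] =
    pull Iₚ 𝓘(ℝ, EP) Prod.fst (𝓑.gerbe.curvature a.B) x ![X, Y, Z] +
    pull Iₚ 𝓘(ℝ, EP) Prod.fst (chernSimons G c.pairing a.A) x ![X, Y, Z]
  rw [a.pull_act_curvature_apply hΘ, add_assoc]
  congr 1
  have s1 : SmoothNear Iₚ (pull Iₚ 𝓘(ℝ, EP) Q.act a.A) x :=
    SmoothNear.pull (Eventually.of_forall fun z => Q.act_smooth z) (hA.smoothNear _)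
  have s2 := smoothNear_pull_snd (E := EG) (I' := 𝓘(ℝ, EP)) (x := x)
    (smoothNear_thetaL (E := EG) x.2)
  have hw := extD_wedge_one_one c.pairing s1 s2 X Y Z
  rw [extD_pull (Q.act_smooth x) (hA.smoothNear _).contDiffAt,
    extD_pull contMDiffAt_snd (smoothNear_thetaL (E := EG) x.2).contDiffAt] at hw
  have hτ : ∀ X Y : EP × EG, pull Iₚ 𝓘(ℝ, EG) Prod.snd (extD 𝓘(ℝ, EG) (thetaL EG G)) x ![X, Y] =
      -bracket EG G (thetaL EG G x.2 ![X.2]) (thetaL EG G x.2 ![Y.2]) := fun X Y => by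
    rw [pull_extD_apply_two, tderiv_snd]
    exact extD_thetaL _ _ _
  have hτ1 : ∀ X : EP × EG, pull Iₚ 𝓘(ℝ, EG) Prod.snd (thetaL EG G) x ![X] =
      thetaL EG G x.2 ![X.2] := fun X => by
    rw [pull_apply_one, tderiv_snd]; rfl
  simp only [hτ, hτ1, hA.pull_act_apply] at hw
  rw [hw]
  have hL : pull Iₚ 𝓘(ℝ, EP) Q.act (chernSimons G c.pairing a.A) x ![X, Y, Z] =
      (c.pairing (pull Iₚ 𝓘(ℝ, EP) Q.act (extD 𝓘(ℝ, EP) a.A) x ![X, Y])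
          (pull Iₚ 𝓘(ℝ, EP) Q.act a.A x ![Z]) -
        c.pairing (pull Iₚ 𝓘(ℝ, EP) Q.act (extD 𝓘(ℝ, EP) a.A) x ![X, Z])
          (pull Iₚ 𝓘(ℝ, EP) Q.act a.A x ![Y]) +
        c.pairing (pull Iₚ 𝓘(ℝ, EP) Q.act (extD 𝓘(ℝ, EP) a.A) x ![Y, Z])
          (pull Iₚ 𝓘(ℝ, EP) Q.act a.A x ![X])) +
      (2 : ℝ) • c.pairing (pull Iₚ 𝓘(ℝ, EP) Q.act a.A x ![X])
        (bracket EG G (pull Iₚ 𝓘(ℝ, EP) Q.act a.A x ![Y]) (pull Iₚ 𝓘(ℝ, EP) Q.act a.A x ![Z])) := by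
    rw [pull_apply_three, hΘ.chernSimons_apply]
    simp only [pull_extD_apply_two, pull_apply_one]
  have hR : pull Iₚ 𝓘(ℝ, EP) Prod.fst (chernSimons G c.pairing a.A) x ![X, Y, Z] =
      (c.pairing (Ad x.2⁻¹ (extD 𝓘(ℝ, EP) a.A x.1 ![X.1, Y.1])) (Ad x.2⁻¹ (a.A x.1 ![Z.1])) -
        c.pairing (Ad x.2⁻¹ (extD 𝓘(ℝ, EP) a.A x.1 ![X.1, Z.1])) (Ad x.2⁻¹ (a.A x.1 ![Y.1])) +
        c.pairing (Ad x.2⁻¹ (extD 𝓘(ℝ, EP) a.A x.1 ![Y.1, Z.1])) (Ad x.2⁻¹ (a.A x.1 ![X.1]))) +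
      (2 : ℝ) • c.pairing (Ad x.2⁻¹ (a.A x.1 ![X.1]))
        (bracket EG G (Ad x.2⁻¹ (a.A x.1 ![Y.1])) (Ad x.2⁻¹ (a.A x.1 ![Z.1]))) := by
    rw [pull_apply_three, tderiv_fst, hΘ.chernSimons_apply]
    simp only [← Ad_bracket, hΘ.pairing_Ad_Ad]
    rfl
  rw [hL, hR]
  simp only [hA.pull_act_apply]
  exact chernSimons_gauge c.pairing_symm (bracket_swap (E := EG) (G := G)) hΘ.pairing_bracket
    (hA.pull_act_extD_apply x X Y) (hA.pull_act_extD_apply x X Z) (hA.pull_act_extD_apply x Y Z)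

/-- The Chern-Simons form is a primitive of `⟨F_A ∧ F_A⟩` on the total space. -/
theorem extD_chernSimons (hΘ : c.IsMaurerCartan Θ) (p : P) :
    extD 𝓘(ℝ, EP) (chernSimons G c.pairing a.A) p =
      wedge c.pairing (curvatureForm G a.A) (curvatureForm G a.A) p := by
  have h := a.isGConnection.smoothNear p
  ext V
  rw [comp_vec4 V]
  set t := V 0
  set u := V 1
  set v := V 2
  set w := V 3
  have h0 : extD 𝓘(ℝ, EP) (chernSimons G c.pairing a.A) p =
      extD 𝓘(ℝ, EP) (wedge c.pairing (extD 𝓘(ℝ, EP) a.A) a.A) p +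
      (1 / 3 : ℝ) • extD 𝓘(ℝ, EP) (wedge c.pairing a.A (wedge (bracket EG G) a.A a.A)) p := by
    rw [← extD_smul]
    exact extD_add (h.extD.wedge _ h) ((h.wedge _ (h.wedge _ h)).const_smul _)
  have h1 := extD_wedge_two_one c.pairing h.extD h t u v w
  have h2 := extD_wedge_one_two c.pairing h (h.wedge (bracket EG G) h) t u v w
  have h3 := wedgeAlt_two_two c.pairing (curvatureForm G a.A p) (curvatureForm G a.A p) t u v w
  have hb : ∀ u v, wedge (bracket EG G) a.A a.A p ![u, v] =
      bracket EG G (a.A p ![u]) (a.A p ![v]) - bracket EG G (a.A p ![v]) (a.A p ![u]) :=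
    wedgeAlt_one_one _ _ _
  have hd3 : ∀ u v w : EP, extD 𝓘(ℝ, EP) (extD 𝓘(ℝ, EP) a.A) p ![u, v, w] = 0 := fun u v w => by
    rw [extD_extD h]; rfl
  simp only [hd3, map_zero, zero_apply, sub_zero, add_zero, zero_add] at h1
  simp only [hb, a.isGConnection.extD_wedge_bracket_apply] at h2
  simp only [PrincipalBundle.curvatureForm_apply] at h3
  rw [h0]
  refine (congrArg₂ (fun y z => y + (1 / 3 : ℝ) • z) h1 h2).trans (Eq.trans ?_ h3.symm)
  exact chernSimons_differential c.pairing_symm (bracket_swap (E := EG) (G := G))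
    hΘ.pairing_bracket (bracket_jacobi (G := G)) _ _ _ _ _ _ _ _ _ _

/-- The Bianchi identity for `H`: on the total space `dH` is `dĤ + d CS(A)`, and `Ĥ` is closed. -/
theorem pull_extD_isCurvature3 [IsManifold 𝓘(ℝ, EM) ∞ M] (hΘ : c.IsMaurerCartan Θ)
    {H : DForm EM M 3 F} (hH : a.IsCurvature3 H) :
    pull 𝓘(ℝ, EP) 𝓘(ℝ, EM) Q.proj (extD 𝓘(ℝ, EM) H) =
      wedge c.pairing (curvatureForm G a.A) (curvatureForm G a.A) := by
  funext p
  rw [← extD_pull (Q.proj_smooth p) (hH.smooth.smoothNear isOpen_univ trivial).contDiffAt,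
    hH.pull_eq, extD_add (a.smoothNear_curvature p) (a.smoothNear_chernSimons _ p),
    a.extD_curvature, zero_add, a.extD_chernSimons hΘ]

theorem existsUnique_isCurvature3 [FiniteDimensional ℝ EM] [IsManifold 𝓘(ℝ, EM) ∞ M]
    (hΘ : c.IsMaurerCartan Θ) : ∃! H : DForm EM M 3 F, a.IsCurvature3 H := by
  obtain ⟨H, ⟨h1, h2⟩, h3⟩ := Q.existsUnique_pull_proj
    (fun p => (a.smoothNear_curvature p).add (a.smoothNear_chernSimons c.pairing p))
    (a.pull_act_curvature_add_chernSimons hΘ)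
  exact ⟨H, ⟨h1, h2⟩, fun H' h' => h3 H' ⟨h'.smooth, h'.pull_eq⟩⟩

end GerbeBundle.Connection

end GerbeBundles

end TwoBundle

end

theorem mainTheorem11
    -- the Lie groups `G` and `T`, with `T` abelian
    {EG G F T : Type*}
    [NormedAddCommGroup EG] [NormedSpace ℝ EG] [FiniteDimensional ℝ EG]
    [TopologicalSpace G] [ChartedSpace EG G] [Group G] [LieGroup 𝓘(ℝ, EG) ∞ G]
    [NormedAddCommGroup F] [NormedSpace ℝ F] [FiniteDimensional ℝ F]
    [TopologicalSpace T] [ChartedSpace F T] [CommGroup T] [LieGroup 𝓘(ℝ, F) ∞ T]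
    -- the manifolds `M` and `P`
    {EM M EP P : Type*}
    [NormedAddCommGroup EM] [NormedSpace ℝ EM] [FiniteDimensional ℝ EM]
    [TopologicalSpace M] [ChartedSpace EM M] [IsManifold 𝓘(ℝ, EM) ∞ M]
    [NormedAddCommGroup EP] [NormedSpace ℝ EP] [FiniteDimensional ℝ EP]
    [TopologicalSpace P] [ChartedSpace EP P] [IsManifold 𝓘(ℝ, EP) ∞ P]
    -- a multiplicative gerbe with connective structure and its Maurer-Cartan curving
    (𝒢 : TwoBundle.MultGerbe EG G F T) (c : TwoBundle.MultConnective 𝒢)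
    (Θ : 𝒢.gerbe.ι → TwoBundle.DForm EG G 2 F) (hΘ : c.IsMaurerCartan Θ)
    -- a principal `𝒢`-bundle with connection
    (Q : TwoBundle.PrincipalBundle EM M EP P EG G) (𝓟 : TwoBundle.GerbeBundle 𝒢 Q)
    (a : 𝓟.Connection c Θ) :
    -- `F_A` is an `ad P`-valued 2-form on `M`, and `d_A F_A = 0`
    Q.IsTensorial (TwoBundle.curvatureForm G a.A) ∧
    TwoBundle.covD G a.A (TwoBundle.curvatureForm G a.A) = 0 ∧
    -- the 3-form `H` on `M` is well defined, and `dH - ⟨F_A ∧ F_A⟩ = 0`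
    (∃! H : TwoBundle.DForm EM M 3 F, a.IsCurvature3 H) ∧
    ∀ H : TwoBundle.DForm EM M 3 F, a.IsCurvature3 H →
      TwoBundle.pull 𝓘(ℝ, EP) 𝓘(ℝ, EM) Q.proj (TwoBundle.extD 𝓘(ℝ, EM) H) -
        TwoBundle.wedge c.pairing (TwoBundle.curvatureForm G a.A)
          (TwoBundle.curvatureForm G a.A) = 0 := by
  have hA := a.isGConnection
  refine ⟨hA.isTensorial_curvatureForm, hA.covD_curvatureForm, a.existsUnique_isCurvature3 hΘ,
    fun H hH => ?_⟩
  rw [a.pull_extD_isCurvature3 hΘ hH, sub_self]
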